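/- Conventions. A link of $c\ge 1$ components is a tame embedding of $c$ disjoint copies of $S^1$ in $\mathbb{R}^3$ (tame: carried by an ambient isotopy to disjoint simple closed polygons). A framed link is a link together with a framing vector $(\lambda_1,\dots,\lambda_c)\in\mathbb{Z}^c$, where $\lambda_i=\mathrm{lk}(K_i,K_i^0)$ is the linking number of the component $K_i$ with the longitude $K_i^0$ that describes its ribbon. Two framed links are isotopic if an ambient isotopy of $\mathbb{R}^3$ carries the components of the first bijectively to those of the second and preserves framings (orientations of components are disregarded). $RB_m$ is the framed braid group on $m$ ribbons, with generators $\sigma_1,\dots,\sigma_{m-1},t_1,\dots,t_m$ and relations $\sigma_i\sigma_j\sigma_i=\sigma_j\sigma_i\sigma_j$ for $|i-j|=1$, $\sigma_i\sigma_j=\sigma_j\sigma_i$ for $|i-j|\ge 2$, $t_it_j=t_jt_i$, and $\sigma_it_j=t_{s_i(j)}\sigma_i$ with $s_i=(i\ \,i{+}1)$; here $\sigma_i$ is a crossing of the ribbons in positions $i,i+1$, positive when both are oriented downwards, $t_j$ is a positive full twist of the ribbon in position $j$, and words are drawn from top to bottom. For $b\in RB_{2n}$, $n\ge 1$, the plat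 closure $A^*_n\,b\,A^{*-}_n$ is the framed link obtained from a diagram of $b$ by joining positions $2p-1$ and $2p$, for $1\le p\le n$, with untwisted, unlinked ribbon arcs above the braid ($A^*_n$) and below it ($A^{*-}_n$); the framing of a component is the writhe of its core in the diagram plus the sum of the exponents of the twists $t_j^{\pm1}$ on its ribbons. Proposition (every framed link is a plat closure). For every framed link $L$ there are an integer $n\ge 1$ and a framed braid $b\in RB_{2n}$ such that $L$ is isotopic, as a framed link, to the plat closure $A^*_n\,b\,A^{*-}_n$. -/

import Mathlib

noncomputable section

namespace FramedPlat

/-! ### The framed braid group -/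

/-- Generators of the framed braid group on `n` ribbons, with positions counted from `0`:
`sigma i` crosses the ribbons in positions `i` and `i + 1`, and `twist j` puts a full twist into
the ribbon in position `j`. -/
inductive Gen (n : ℕ) : Type
  | sigma (i : Fin (n - 1)) : Gen n
  | twist (j : Fin n) : Gen n

/-- The transposition of the positions `i` and `i + 1`. -/
def adjSwap {n : ℕ} (i : Fin (n - 1)) : Equiv.Perm (Fin n) :=
  Equiv.swap ⟨i.val, by omega⟩ ⟨i.val + 1, by omega⟩

/-- The generator `σ_i` in the free group. -/
def sg {n : ℕ} (i : Fin (n - 1)) : FreeGroup (Gen n) := FreeGroup.of (Gen.sigma i)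

/-- The generator `t_j` in the free group. -/
def tw {n : ℕ} (j : Fin n) : FreeGroup (Gen n) := FreeGroup.of (Gen.twist j)

/-- The defining relations `l = r` of the framed braid group on `n` ribbons. -/
inductive Relation (n : ℕ) : FreeGroup (Gen n) → FreeGroup (Gen n) → Prop
  | braid (i j : Fin (n - 1)) (h : i.val + 1 = j.val ∨ j.val + 1 = i.val) :
      Relation n (sg i * sg j * sg i) (sg j * sg i * sg j)
  | far (i j : Fin (n - 1)) (h : i.val + 2 ≤ j.val ∨ j.val + 2 ≤ i.val) :
      Relation n (sg i * sg j) (sg j * sg i)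
  | twistComm (i j : Fin n) : Relation n (tw i * tw j) (tw j * tw i)
  | slide (i : Fin (n - 1)) (j : Fin n) :
      Relation n (sg i * tw j) (tw (adjSwap i j) * sg i)

/-- The relators of the framed braid group. -/
def relators (n : ℕ) : Set (FreeGroup (Gen n)) :=
  {x | ∃ l r, Relation n l r ∧ x = l * r⁻¹}

/-- The framed braid group `RB_n`. -/
abbrev FramedBraidGroup (n : ℕ) : Type := PresentedGroup (relators n)

/-- A framed braid diagram on `n` ribbons: a word in the generators (`true`) and their inverses
(`false`), read from top to bottom. -/
abbrev BraidWord (n : ℕ) : Type := List (Gen n × Bool)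

/-- The framed braid represented by a framed braid diagram. -/
def BraidWord.toBraid {n : ℕ} (w : BraidWord n) : FramedBraidGroup n :=
  PresentedGroup.mk (relators n) (FreeGroup.mk w)

/-! ### Closed polygons, their diagrams and their writhe -/

/-- Three-dimensional space with its standard coordinates `(x, y, z)` numbered `0, 1, 2`. Only the
topology, the affine structure and the standard orientation are used. -/
abbrev Space : Type := Fin 3 → ℝ

/-- A simple closed polygon with vertices `v 0, …, v (m - 1)`, `v m = v 0` (the other values of
`v` are irrelevant) and edges from `v k` to `v (k + 1)` for `k < m`. -/
structure ClosedPolygon where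
  /-- the number of edges -/
  m : ℕ
  m_pos : 0 < m
  /-- the vertices -/
  v : ℕ → Space
  closed : v m = v 0
  simple : ∀ k < m, ∀ l < m, ∀ s ∈ Set.Ico (0 : ℝ) 1, ∀ t ∈ Set.Ico (0 : ℝ) 1,
    AffineMap.lineMap (v k) (v (k + 1)) s = AffineMap.lineMap (v l) (v (l + 1)) t →
      k = l ∧ s = t

/-- The point set of a closed polygon. -/
def ClosedPolygon.carrier (P : ClosedPolygon) : Set Space :=
  {x | ∃ k < P.m, x ∈ segment ℝ (P.v k) (P.v (k + 1))}

/-- The edges of a closed polygon, as unordered pairs of end points. -/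
def ClosedPolygon.edges (P : ClosedPolygon) : Set (Sym2 Space) :=
  {e | ∃ k < P.m, e = s(P.v k, P.v (k + 1))}

open Classical in
/-- The sign of the crossing of the oriented segments `a → b` and `c → d` in the projection
`(x, y, z) ↦ (x, z)`, and `0` if they do not cross transversally in interior points. If `p` and
`q` are the points of the two segments above the crossing, the triple product of `b - a`, `d - c`
and `p - q` equals the one of `b - a`, `d - c` and `a - c`; it is positive exactly if the crossing
is positive (the over arc has to be turned counterclockwise onto the under arc), whichever of the
two arcs is the over arc. -/
def crossingSign (a b c d : Space) : ℤ :=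
  if ∃ s ∈ Set.Ioo (0 : ℝ) 1, ∃ t ∈ Set.Ioo (0 : ℝ) 1,
      (AffineMap.lineMap a b s : Space) 0 = (AffineMap.lineMap c d t : Space) 0 ∧
      (AffineMap.lineMap a b s : Space) 2 = (AffineMap.lineMap c d t : Space) 2 then
    (SignType.sign (Matrix.det (Matrix.of ![b - a, d - c, a - c])) : ℤ)
  else 0

/-- The writhe of a closed polygon in the projection `(x, y, z) ↦ (x, z)`: the sum of the signs of
its self-crossings. -/
def ClosedPolygon.writhe (P : ClosedPolygon) : ℤ :=
  ∑ k ∈ Finset.range P.m, ∑ l ∈ Finset.range k,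
    crossingSign (P.v k) (P.v (k + 1)) (P.v l) (P.v (l + 1))

/-! ### Framed links and isotopy -/

/-- An ambient isotopy of space: a jointly continuous family of homeomorphisms that starts at the
identity. -/
def IsAmbientIsotopy (F : unitInterval → Space ≃ₜ Space) : Prop :=
  Continuous (fun p : unitInterval × Space => F p.1 p.2) ∧ F 0 = Homeomorph.refl Space

/-- The components of a family of `c` closed curves. -/
def component {c : ℕ} (γ : Fin c × Circle → Space) (i : Fin c) : Set Space :=
  Set.range fun z => γ (i, z)

/-- A framed link of `c ≥ 1` components: a tame embedding of `c` copies of the circle (tame: some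
ambient isotopy carries all components to closed polygons), together with its framing vector. The
framing of a component `K` is the integer `lk(K, K₀)`, where `K₀` is the longitude of `K` given by
the second boundary curve of the ribbon with boundary curve `K`. -/
structure FramedLink where
  /-- the number of components -/
  c : ℕ
  c_pos : 0 < c
  /-- the embedding -/
  curve : Fin c × Circle → Space
  isEmbedding : Topology.IsEmbedding curve
  tame : ∃ F : unitInterval → Space ≃ₜ Space, IsAmbientIsotopy F ∧
    ∃ P : Fin c → ClosedPolygon, ∀ i, F 1 '' component curve i = (P i).carrier
  /-- the framing vector -/
  framing : Fin c → ℤ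

/-- Two framed links are isotopic if an ambient isotopy carries the components of the first one
bijectively to components of the second one with the same framing. -/
def FramedLink.Isotopic (L L' : FramedLink) : Prop :=
  ∃ F : unitInterval → Space ≃ₜ Space, IsAmbientIsotopy F ∧
    ∃ e : Fin L.c ≃ Fin L'.c, ∀ i,
      F 1 '' component L.curve i = component L'.curve (e i) ∧ L'.framing (e i) = L.framing i

/-! ### The plat closure -/

/-- The exponent of a letter. -/
def exponent (ε : Bool) : ℤ := if ε then 1 else -1

/-- The point in position `a` of the horizontal level `j`, counted from the top of the braid. -/
def node (a j : ℕ) : Space := ![(a : ℝ), 0, -(j : ℝ)]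

/-- The additional vertex of the strand that runs from position `i` down to position `i + 1`
below level `j`. It makes this strand pass behind (`y > 0`, for `σ_i`) or in front of (`y < 0`, for
`σ_i⁻¹`) the strand from position `i + 1` to position `i`, as seen from the side of negative `y`. -/
def bend (i j : ℕ) (ε : Bool) : Space := ![(i : ℝ), (exponent ε : ℝ), -(j : ℝ) - 1 / 2]

/-- The edges of the part of the braid between the levels `j` and `j + 1` that is given by one
letter. The core of a twisted ribbon is drawn straight. -/
def layerEdges (n j : ℕ) : Gen n × Bool → Set (Sym2 Space)
  | (Gen.sigma i, ε) =>
      {s(node i j, bend i j ε), s(bend i j ε, node (i + 1) (j + 1)),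
        s(node (i + 1) j, node i (j + 1))} ∪
      {e | ∃ a < n, a ≠ i ∧ a ≠ i + 1 ∧ e = s(node a j, node a (j + 1))}
  | (Gen.twist _, _) => {e | ∃ a < n, e = s(node a j, node a (j + 1))}

/-- The edges of the `n` arcs that join the positions `2p` and `2p + 1` above the braid. -/
def topArcs (n : ℕ) : Set (Sym2 Space) :=
  {e | ∃ p < n, e = s(node (2 * p) 0, ![2 * (p : ℝ) + 1 / 2, 0, 1]) ∨
    e = s(![2 * (p : ℝ) + 1 / 2, 0, 1], node (2 * p + 1) 0)}

/-- The edges of the `n` arcs that join the positions `2p` and `2p + 1` below a braid with `k`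
letters. -/
def bottomArcs (n k : ℕ) : Set (Sym2 Space) :=
  {e | ∃ p < n, e = s(node (2 * p) k, ![2 * (p : ℝ) + 1 / 2, 0, -(k : ℝ) - 1]) ∨
    e = s(![2 * (p : ℝ) + 1 / 2, 0, -(k : ℝ) - 1], node (2 * p + 1) k)}

/-- All edges of the core curves of the closed diagram `A^*_n w A^{*-}_n`. -/
def platEdges (n : ℕ) (w : BraidWord (2 * n)) : Set (Sym2 Space) :=
  topArcs n ∪ bottomArcs n w.length ∪
    {e | ∃ j : Fin w.length, e ∈ layerEdges (2 * n) j (w.get j)}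

open Classical in
/-- The contribution of the letter between the levels `j` and `j + 1` to the twisting of the
component with edge set `E`: the exponent of a twist that sits on an edge of the component. -/
def letterTwist {n : ℕ} (E : Set (Sym2 Space)) (j : ℕ) : Gen n × Bool → ℤ
  | (Gen.sigma _, _) => 0
  | (Gen.twist a, ε) => if s(node a j, node a (j + 1)) ∈ E then exponent ε else 0

/-- `L` is the framed link given by the closed diagram `A^*_n w A^{*-}_n`: its components are the
closed polygons formed by the edges of the diagram, and the framing of a component is its writhe
plus the sum of the twists of its ribbons. -/
def IsPlatDiagramLink (n : ℕ) (w : BraidWord (2 * n)) (L : FramedLink) : Prop :=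
  ∃ P : Fin L.c → ClosedPolygon,
    (∀ i, (P i).carrier = component L.curve i) ∧
    (⋃ i, (P i).edges) = platEdges n w ∧
    ∀ i, L.framing i =
      (P i).writhe + ∑ j : Fin w.length, letterTwist (P i).edges j (w.get j)

/-- `L` is the plat closure `A^*_n b A^{*-}_n` of the framed braid `b`, drawn from some diagram
of `b`. -/
def IsPlatClosure {n : ℕ} (b : FramedBraidGroup (2 * n)) (L : FramedLink) : Prop :=
  ∃ w : BraidWord (2 * n), w.toBraid = b ∧ IsPlatDiagramLink n w L

end FramedPlat

end

open Set Topology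
open scoped NNReal

noncomputable section

namespace FramedPlat

/-! ### Homeomorphisms that are isotopic to the identity -/

/-! Framings are the easy half. A twist letter is drawn with straight strands, so it adds no
crossing, keeps the isotopy type of the core curves, and changes the framing of one chosen component
by one. Once a plat diagram has the right core curves, twist letters at its lower end correct all
framings (`Closes.exists_extend`). The writhe is never computed; it only has to be unaffected by
these letters (`Closes.writhe_eq`).

For the core curves, tameness gives disjoint simple polygons, and linear shears put them in general
position with respect to the projection to `(x, y)`. Every edge is cut at a point close to its lower
end. A shear along `z`, by a function of `(x, y)` alone, then lifts all vertices to height `H`,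
lowers all cut points to `-H`, and turns every piece into a graph over `z`. Such a shear exists
because the required change of height depends only on the projected point: it vanishes on the middle
parts of the edges, and elsewhere the projection has no double points (`IsLiftable.height_sub_eq`).
Tietze's theorem extends it to the plane (`IsLiftable.exists_lift`). The result already has the
shape of a plat, with two strands per edge that meet in pairs at maxima and minima
(`IsLiftable.exists_strands`).

Read with decreasing height as time, the strands are a motion of points in the plane. Their order in
`x` is sampled at closely spaced times, successive orders are joined by adjacent transpositions, and
the signs of the letters are read off from `y` (`exists_platData_of_motion`). The crossings of the
moving points themselves need not be generic.

The strands are finally carried onto the standard drawing of this word by the straight-line motion.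
Two strands never collide, because their relative positions in the two pictures are never opposite
vectors (`PlatData.exists_isotopy`). A straight-line motion whose velocity is a Lipschitz function
of the position extends to an ambient isotopy: it is a product of short steps, each of the form
identity plus contraction (`exists_isotopicToId_of_linear_motion`). -/

/-- `Φ` is the end of an ambient isotopy. -/
def IsotopicToId (Φ : Space ≃ₜ Space) : Prop :=
  ∃ F : unitInterval → Space ≃ₜ Space, IsAmbientIsotopy F ∧ F 1 = Φ

theorem IsotopicToId.refl : IsotopicToId (Homeomorph.refl Space) :=
  ⟨fun _ => Homeomorph.refl Space, ⟨continuous_snd, rfl⟩, rfl⟩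

theorem IsotopicToId.trans {Φ Ψ : Space ≃ₜ Space} (hΦ : IsotopicToId Φ) (hΨ : IsotopicToId Ψ) :
    IsotopicToId (Φ.trans Ψ) := by
  obtain ⟨F, ⟨hF, hF0⟩, rfl⟩ := hΦ
  obtain ⟨G, ⟨hG, hG0⟩, rfl⟩ := hΨ
  refine ⟨fun t => (F t).trans (G t), ⟨?_, ?_⟩, rfl⟩
  · exact hG.comp (continuous_fst.prodMk hF)
  · ext1 x
    simp [hF0, hG0]

/-- The ambient isotopy that adds a multiple of a function of the other coordinates to one
coordinate. -/
theorem exists_shear (i : Fin 3) (φ : Space → ℝ) (hφ : Continuous φ)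
    (hinv : ∀ x r, φ (Function.update x i r) = φ x) :
    ∃ Φ : Space ≃ₜ Space, IsotopicToId Φ ∧ ∀ x, Φ x = Function.update x i (x i + φ x) := by
  let F : unitInterval → Space ≃ₜ Space := fun t =>
    { toFun := fun x => Function.update x i (x i + t * φ x)
      invFun := fun x => Function.update x i (x i - t * φ x)
      left_inv := fun x => by simp [hinv]
      right_inv := fun x => by simp [hinv]
      continuous_toFun := continuous_id.update i (by fun_prop)
      continuous_invFun := continuous_id.update i (by fun_prop) }
  refine ⟨F 1, ⟨F, ⟨?_, ?_⟩, rfl⟩, fun x => ?_⟩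
  · change Continuous fun p : unitInterval × Space =>
      Function.update p.2 i (p.2 i + (p.1 : ℝ) * φ p.2)
    exact continuous_snd.update i (by fun_prop)
  · ext1 x
    change Function.update x i (x i + ((0 : unitInterval) : ℝ) * φ x) = x
    simp
  · change Function.update x i (x i + ((1 : unitInterval) : ℝ) * φ x) = _
    simp

/-- A perturbation of the identity by a Lipschitz map with a constant less than `1` is isotopic
to the identity. -/
theorem exists_isotopicToId_of_lipschitzWith (G : Space → Space) (K : ℝ≥0) (hK : K < 1)
    (hG : LipschitzWith K G) :
    ∃ Φ : Space ≃ₜ Space, IsotopicToId Φ ∧ ∀ x, Φ x = x + G x := by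
  -- Each map `x + t • G x` differs from the identity by a `K`-Lipschitz map with `K < 1`, so the
  -- quantitative inverse function theorem makes it a homeomorphism of the whole space, for all `t`
  -- at once.
  have happ : ∀ t : unitInterval, ApproximatesLinearOn (fun x => x + (t : ℝ) • G x)
      ((ContinuousLinearEquiv.refl ℝ Space : Space ≃L[ℝ] Space) : Space →L[ℝ] Space) univ K := by
    intro t x _ y _
    have h1 : (x + (t : ℝ) • G x - (y + (t : ℝ) • G y) -
        ((ContinuousLinearEquiv.refl ℝ Space : Space ≃L[ℝ] Space) : Space →L[ℝ] Space) (x - y)) =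
        (t : ℝ) • (G x - G y) := by
      simp [smul_sub]
      abel
    rw [h1, norm_smul, Real.norm_of_nonneg t.2.1, ← dist_eq_norm, ← dist_eq_norm]
    calc (t : ℝ) * dist (G x) (G y) ≤ 1 * dist (G x) (G y) :=
          mul_le_mul_of_nonneg_right t.2.2 dist_nonneg
      _ ≤ _ := by rw [one_mul]; exact hG.dist_le_mul x y
  have hc : Subsingleton Space ∨ K < ‖((ContinuousLinearEquiv.refl ℝ Space).symm :
      Space →L[ℝ] Space)‖₊⁻¹ := by
    right
    have : ‖((ContinuousLinearEquiv.refl ℝ Space).symm : Space →L[ℝ] Space)‖₊ = 1 := by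
      have : ((ContinuousLinearEquiv.refl ℝ Space).symm : Space →L[ℝ] Space) =
        ContinuousLinearMap.id ℝ Space := rfl
      rw [this]
      exact ContinuousLinearMap.nnnorm_id
    rw [this, inv_one]
    exact hK
  let F : unitInterval → Space ≃ₜ Space := fun t =>
    (happ t).toHomeomorph (fun x => x + (t : ℝ) • G x) hc
  have hF : ∀ t x, F t x = x + (t : ℝ) • G x := fun t x => rfl
  refine ⟨F 1, ⟨F, ⟨?_, ?_⟩, rfl⟩, fun x => by simp [hF]⟩
  · have := hG.continuous
    simp only [hF]
    fun_prop
  · ext1 x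
    simp [hF]

/-- The bound forces `g` to be constant on the fibres of `f`, so `g` is a `K`-Lipschitz function on
the range of `f`. In the sup norm it extends to all of space, coordinate by coordinate, with the
same constant. -/
theorem exists_isotopicToId_step {Ω : Type*} (f g : Ω → Space) (K : ℝ≥0) (hK : K < 1)
    (h : ∀ ω ω', ‖g ω - g ω'‖ ≤ K * ‖f ω - f ω'‖) :
    ∃ Φ : Space ≃ₜ Space, IsotopicToId Φ ∧ ∀ ω, Φ (f ω) = f ω + g ω := by
  classical
  let G : Space → Space := fun x => if hx : ∃ ω, f ω = x then g hx.choose else 0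
  have hG : ∀ ω, G (f ω) = g ω := by
    intro ω
    have hx : ∃ ω', f ω' = f ω := ⟨ω, rfl⟩
    have : G (f ω) = g hx.choose := dif_pos hx
    rw [this]
    have h' := h hx.choose ω
    rw [hx.choose_spec, sub_self, norm_zero, mul_zero] at h'
    exact sub_eq_zero.1 (norm_le_zero_iff.1 h')
  have hL : LipschitzOnWith K G (range f) := by
    apply LipschitzOnWith.of_dist_le_mul
    rintro _ ⟨ω, rfl⟩ _ ⟨ω', rfl⟩
    rw [hG, hG, dist_eq_norm, dist_eq_norm]
    exact h ω ω'
  obtain ⟨G', hG', hGG'⟩ := hL.extend_pi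
  obtain ⟨Φ, hΦ, hΦG⟩ := exists_isotopicToId_of_lipschitzWith G' K hK hG'
  refine ⟨Φ, hΦ, fun ω => ?_⟩
  rw [hΦG, ← hGG' (mem_range_self ω), hG]

/-- Isotopy extension: a linear motion of a subset of space whose velocities are uniformly
Lipschitz functions of the position extends to an ambient isotopy. -/
theorem exists_isotopicToId_of_linear_motion {Ω : Type*} (f₀ f₁ : Ω → Space) (C : ℝ)
    (h : ∀ t ∈ Icc (0 : ℝ) 1, ∀ ω ω', ‖(f₁ ω - f₀ ω) - (f₁ ω' - f₀ ω')‖ ≤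
      C * ‖((1 - t) • f₀ ω + t • f₁ ω) - ((1 - t) • f₀ ω' + t • f₁ ω')‖) :
    ∃ Φ : Space ≃ₜ Space, IsotopicToId Φ ∧ ∀ ω, Φ (f₀ ω) = f₁ ω := by
  -- The motion is cut into `N` equal steps. The hypothesis at time `j / N` bounds the displacement
  -- of the next step, as a function of the current position, with constant `max C 0 / N < 1`.
  obtain ⟨N, hN⟩ := exists_nat_gt (max C 0)
  have hN0 : (0 : ℝ) < N := lt_of_le_of_lt (le_max_right _ _) hN
  have hCN : max C 0 / N < 1 := (div_lt_one hN0).2 hN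
  let K : ℝ≥0 := ⟨max C 0 / N, by positivity⟩
  have key : ∀ j : ℕ, j ≤ N → ∃ Φ : Space ≃ₜ Space, IsotopicToId Φ ∧
      ∀ ω, Φ (f₀ ω) = (1 - (j / N : ℝ)) • f₀ ω + (j / N : ℝ) • f₁ ω := by
    intro j
    induction j with
    | zero =>
      intro _
      exact ⟨_, IsotopicToId.refl, fun ω => by simp⟩
    | succ j ih =>
      intro hj
      obtain ⟨Φ, hΦ, hΦf⟩ := ih (by omega)
      have ht : ((j / N : ℝ)) ∈ Icc (0 : ℝ) 1 := by
        refine ⟨by positivity, (div_le_one hN0).2 ?_⟩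
        exact_mod_cast (by omega : j ≤ N)
      obtain ⟨Ψ, hΨ, hΨf⟩ := exists_isotopicToId_step
        (fun ω => (1 - (j / N : ℝ)) • f₀ ω + (j / N : ℝ) • f₁ ω)
        (fun ω => (1 / N : ℝ) • (f₁ ω - f₀ ω)) K hCN (by
          intro ω ω'
          rw [← smul_sub, norm_smul, Real.norm_of_nonneg (by positivity)]
          have h1 := h _ ht ω ω'
          have h2 : C * ‖((1 - (j / N : ℝ)) • f₀ ω + (j / N : ℝ) • f₁ ω) -
              ((1 - (j / N : ℝ)) • f₀ ω' + (j / N : ℝ) • f₁ ω')‖ ≤ max C 0 *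
              ‖((1 - (j / N : ℝ)) • f₀ ω + (j / N : ℝ) • f₁ ω) -
              ((1 - (j / N : ℝ)) • f₀ ω' + (j / N : ℝ) • f₁ ω')‖ :=
            mul_le_mul_of_nonneg_right (le_max_left _ _) (norm_nonneg _)
          have h3 : ((K : ℝ≥0) : ℝ) = 1 / N * max C 0 := by
            change max C 0 / N = _
            ring
          rw [h3, mul_assoc]
          exact mul_le_mul_of_nonneg_left (h1.trans h2) (by positivity))
      refine ⟨Φ.trans Ψ, hΦ.trans hΨ, fun ω => ?_⟩
      rw [Homeomorph.trans_apply, hΦf, hΨf]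
      push_cast
      ext i
      simp only [Pi.add_apply, Pi.smul_apply, Pi.sub_apply, smul_eq_mul]
      ring
  obtain ⟨Φ, hΦ, hΦf⟩ := key N le_rfl
  refine ⟨Φ, hΦ, fun ω => ?_⟩
  rw [hΦf, div_self hN0.ne']
  simp

/-! ### Rankings and adjacent transpositions -/

theorem adjSwap_val {M : ℕ} (i : Fin (M - 1)) (p : Fin M) :
    (adjSwap i p).val = if p.val = i.val then i.val + 1 else
      if p.val = i.val + 1 then i.val else p.val := by
  unfold adjSwap
  rw [Equiv.swap_apply_def]
  simp only [Fin.ext_iff]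
  split_ifs <;> rfl

theorem adjSwap_lt_adjSwap {M : ℕ} (i : Fin (M - 1)) {p q : Fin M} (h : p < q)
    (h' : ¬ (p.val = i.val ∧ q.val = i.val + 1)) : adjSwap i p < adjSwap i q := by
  rw [Fin.lt_def] at h ⊢
  rw [adjSwap_val, adjSwap_val]
  split_ifs <;> omega

section Sorting

variable {A : Type*} [Fintype A] {M : ℕ}

/-- If no neighbours were inverted, `R ∘ ρ⁻¹` would be strictly increasing, and the identity is the
only order automorphism of `Fin M`. -/
theorem exists_adjacent_inversion {ρ R : A ≃ Fin M} (h : ρ ≠ R) :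
    ∃ i : Fin (M - 1), ∀ a b, (ρ a).val = i.val → (ρ b).val = i.val + 1 → R b < R a := by
  by_contra! hno
  apply h
  have hmono : StrictMono (fun p : Fin M => R (ρ.symm p)) := by
    cases M with
    | zero => exact fun p => p.elim0
    | succ m =>
      rw [Fin.strictMono_iff_lt_succ]
      intro i
      obtain ⟨a, b, ha, hb, hab⟩ := hno ⟨i.val, by have := i.2; omega⟩
      have ha' : ρ.symm i.castSucc = a := by
        rw [Equiv.symm_apply_eq]; exact Fin.ext ha.symm
      have hb' : ρ.symm i.succ = b := by
        rw [Equiv.symm_apply_eq]; exact Fin.ext hb.symm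
      have hne : a ≠ b := by rintro rfl; simp at ha hb; omega
      rw [ha', hb']
      exact lt_of_le_of_ne hab (fun h => hne (R.injective h))
  have hid : ∀ p : Fin M, R (ρ.symm p) = p := by
    have h1 := Subsingleton.elim
      (hmono.orderIsoOfSurjective _ (ρ.symm.trans R).surjective) (OrderIso.refl (Fin M))
    intro p
    exact congrArg (fun e : Fin M ≃o Fin M => e p) h1
  ext a
  have := hid (ρ a)
  simp only [Equiv.symm_apply_apply] at this
  rw [this]

open Classical in
/-- The pairs that are inverted between two rankings. -/
def inversions (ρ R : A ≃ Fin M) : Finset (A × A) :=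
  Finset.univ.filter fun c => ρ c.1 < ρ c.2 ∧ R c.2 < R c.1

theorem mem_inversions {ρ R : A ≃ Fin M} {a b : A} :
    (a, b) ∈ inversions ρ R ↔ ρ a < ρ b ∧ R b < R a := by
  simp only [inversions, Finset.mem_filter, Finset.mem_univ, true_and]

/-- One step of bubble sort: exchanging inverted neighbours removes this inversion and creates none.
The sorted ranking is a fixed point, so the step can be iterated without a stopping rule. -/
theorem exists_sorting_step (ρ R : A ≃ Fin M) : ∃ ρ' : A ≃ Fin M,
    (ρ' = ρ ∧ ρ = R ∨ (inversions ρ' R ⊂ inversions ρ R ∧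
      ∃ i : Fin (M - 1), ρ' = ρ.trans (adjSwap i) ∧
        ∀ a b, (ρ a).val = i.val → (ρ b).val = i.val + 1 → R b < R a)) := by
  by_cases h : ρ = R
  · exact ⟨ρ, Or.inl ⟨rfl, h⟩⟩
  · obtain ⟨i, hi⟩ := exists_adjacent_inversion h
    refine ⟨ρ.trans (adjSwap i), Or.inr ⟨?_, i, rfl, hi⟩⟩
    rw [Finset.ssubset_iff_of_subset]
    · let a := ρ.symm ⟨i.val, by omega⟩
      let b := ρ.symm ⟨i.val + 1, by omega⟩
      have ha : (ρ a).val = i.val := by simp [a]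
      have hb : (ρ b).val = i.val + 1 := by simp [b]
      refine ⟨(a, b), ?_, ?_⟩
      · exact mem_inversions.2 ⟨by rw [Fin.lt_def]; omega, hi a b ha hb⟩
      · rw [mem_inversions, Equiv.trans_apply, Equiv.trans_apply, Fin.lt_def, adjSwap_val,
          adjSwap_val, ha, hb]
        simp
    · rintro ⟨a, b⟩ hab
      rw [mem_inversions, Equiv.trans_apply, Equiv.trans_apply] at hab
      rw [mem_inversions]
      refine ⟨?_, hab.2⟩
      by_contra hlt
      have hne : ρ b ≠ ρ a := fun h => by
        have := ρ.injective h
        subst this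
        exact lt_irrefl _ hab.2
      have hlt' : ρ b < ρ a := lt_of_le_of_ne (not_lt.1 hlt) hne
      by_cases hc : (ρ b).val = i.val ∧ (ρ a).val = i.val + 1
      · exact absurd (hi b a hc.1 hc.2) (not_lt.2 hab.2.le)
      · exact absurd (adjSwap_lt_adjSwap i hlt' hc) (not_lt.2 hab.1.le)

/-- Two rankings are joined by a sequence of adjacent transpositions that interchange only pairs
which the two rankings order differently. -/
theorem exists_sorting_sequence (R R' : A ≃ Fin M) : ∃ ρ : ℕ → (A ≃ Fin M), ρ 0 = R ∧
    (∀ k, Fintype.card (A × A) ≤ k → ρ k = R') ∧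
    (∀ k a b, R a < R b → R' a < R' b → ρ k a < ρ k b) ∧
    ∀ k, ρ (k + 1) = ρ k ∨ ∃ i : Fin (M - 1), ρ (k + 1) = (ρ k).trans (adjSwap i) ∧
      ∀ a b, (ρ k a).val = i.val → (ρ k b).val = i.val + 1 → R a < R b ∧ R' b < R' a := by
  choose step hstep using fun ρ : A ≃ Fin M => exists_sorting_step ρ R'
  let ρ : ℕ → (A ≃ Fin M) := fun k => step^[k] R
  have hsucc : ∀ k, ρ (k + 1) = step (ρ k) := fun k => Function.iterate_succ_apply' step k R
  have hsub : ∀ k, inversions (ρ k) R' ⊆ inversions R R' := by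
    intro k
    induction k with
    | zero => exact subset_rfl
    | succ k ih =>
      rw [hsucc]
      rcases hstep (ρ k) with h | h
      · rw [h.1]; exact ih
      · exact h.1.subset.trans ih
  -- Each genuine step lowers the number of inversions, which is at most `card (A × A)` at the
  -- start; this is the source of the uniform number of steps.
  have hcard : ∀ k, ρ k = R' ∨ (inversions (ρ k) R').card + k ≤ Fintype.card (A × A) := by
    intro k
    induction k with
    | zero => exact Or.inr (Finset.card_le_univ _)
    | succ k ih =>
      rw [hsucc]
      rcases hstep (ρ k) with h | h
      · left; rw [h.1, h.2]
      · rcases ih with ih | ih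
        · rw [ih] at h
          have : inversions R' R' = ∅ := by
            ext c
            rw [mem_inversions]
            exact iff_of_false (fun h => lt_asymm h.1 h.2) (Finset.notMem_empty _)
          rw [this] at h
          exact absurd h.1 (Finset.not_ssubset_empty _)
        · right
          have := Finset.card_lt_card h.1
          omega
  -- Since the inversions only shrink, a pair that is still inverted at stage `k` was inverted
  -- between `R` and `R'`. Both final claims follow from this.
  have hmem : ∀ k a b, ρ k a < ρ k b → R' b < R' a → R a < R b ∧ R' b < R' a := by
    intro k a b h1 h2
    have : (a, b) ∈ inversions (ρ k) R' := mem_inversions.2 ⟨h1, h2⟩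
    exact mem_inversions.1 (hsub k this)
  refine ⟨ρ, rfl, ?_, ?_, ?_⟩
  · intro k hk
    rcases hcard k with h | h
    · exact h
    · have h0 : (inversions (ρ k) R').card = 0 := by omega
      by_contra hne
      obtain ⟨i, hi⟩ := exists_adjacent_inversion hne
      let a := (ρ k).symm ⟨i.val, by omega⟩
      let b := (ρ k).symm ⟨i.val + 1, by omega⟩
      have ha : (ρ k a).val = i.val := by simp [a]
      have hb : (ρ k b).val = i.val + 1 := by simp [b]
      have : (a, b) ∈ inversions (ρ k) R' :=
        mem_inversions.2 ⟨by rw [Fin.lt_def]; omega, hi a b ha hb⟩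
      rw [Finset.card_eq_zero.1 h0] at this
      exact absurd this (Finset.notMem_empty _)
  · intro k a b h1 h2
    by_contra hlt
    have hne : ρ k b ≠ ρ k a := fun h => by
      have := (ρ k).injective h
      subst this
      exact lt_irrefl _ h2
    have := hmem k b a (lt_of_le_of_ne (not_lt.1 hlt) hne) h2
    exact absurd this.1 (not_lt.2 h1.le)
  · intro k
    rw [hsucc]
    rcases hstep (ρ k) with h | ⟨-, i, h1, h2⟩
    · exact Or.inl h.1
    · refine Or.inr ⟨i, h1, fun a b ha hb => hmem k a b ?_ (h2 a b ha hb)⟩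
      rw [Fin.lt_def]
      omega

end Sorting

/-- A ranking that sorts a real-valued function. -/
theorem exists_ranking {A : Type*} {M : ℕ} (e : A ≃ Fin M) (x : A → ℝ) :
    ∃ R : A ≃ Fin M, ∀ a b, R a < R b → x a ≤ x b := by
  refine ⟨e.trans (Tuple.sort (x ∘ e.symm)).symm, fun a b hab => ?_⟩
  have := Tuple.monotone_sort (x ∘ e.symm) hab.le
  simpa using this

/-- A ranking of pairs by blocks that sorts a real-valued function within each block. -/
theorem exists_block_ranking {A I : Type*} {n : ℕ} (e : A ≃ I × Bool) (r : I ≃ Fin n)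
    (x : A → ℝ) : ∃ R : A ≃ Fin (2 * n), (∀ a, (R a).val / 2 = (r (e a).1).val) ∧
      ∀ a b, (e a).1 = (e b).1 → R a < R b → x a ≤ x b := by
  classical
  -- A block is reversed exactly if its `true` element lies strictly to the left. Adding this bit by
  -- `xor` is an involution.
  let flip : I → Bool := fun j => decide (x (e.symm (j, true)) < x (e.symm (j, false)))
  let f : I × Bool ≃ I × Bool :=
    { toFun := fun c => (c.1, xor c.2 (flip c.1))
      invFun := fun c => (c.1, xor c.2 (flip c.1))
      left_inv := fun c => by simp
      right_inv := fun c => by simp }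
  let g : I × Bool ≃ Fin (2 * n) :=
    ((r.prodCongr finTwoEquiv.symm).trans finProdFinEquiv).trans (finCongr (mul_comm n 2))
  have hg : ∀ j b, (g (j, b)).val = 2 * (r j).val + if b then 1 else 0 := by
    intro j b
    cases b <;> simp [g, finProdFinEquiv, finTwoEquiv, add_comm]
  refine ⟨(e.trans f).trans g, fun a => ?_, fun a b hab hlt => ?_⟩
  · change (g ((e a).1, xor (e a).2 (flip (e a).1))).val / 2 = _
    rw [hg]
    split_ifs <;> omega
  · obtain ⟨⟨j, c⟩, rfl⟩ := e.symm.surjective a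
    obtain ⟨⟨j', c'⟩, rfl⟩ := e.symm.surjective b
    simp only [Equiv.apply_symm_apply] at hab
    subst hab
    simp only [Equiv.trans_apply, Equiv.apply_symm_apply, f, Equiv.coe_fn_mk, Fin.lt_def, hg] at hlt
    by_cases hx : x (e.symm (j, true)) < x (e.symm (j, false))
    · have hf : flip j = true := decide_eq_true hx
      rw [hf] at hlt
      cases c <;> cases c' <;> simp at hlt
      exact hx.le
    · have hf : flip j = false := decide_eq_false hx
      rw [hf] at hlt
      cases c <;> cases c' <;> simp at hlt
      exact not_lt.1 hx

/-! ### Piecewise linear functions -/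

/-- The piecewise linear function on `[0, m]` with the values `y 0, …, y m` at the integers. -/
def plin (y : ℕ → ℝ) (m : ℕ) (v : ℝ) : ℝ :=
  y 0 + ∑ k ∈ Finset.range m, (y (k + 1) - y k) * max 0 (min 1 (v - k))

/-- The clamps before `k` equal one and telescope, the clamp at `k` is `v - k`, and the later ones
vanish. -/
theorem plin_eq (y : ℕ → ℝ) {m k : ℕ} (hk : k < m) {v : ℝ} (h0 : (k : ℝ) ≤ v)
    (h1 : v ≤ k + 1) : plin y m v = (1 - (v - k)) * y k + (v - k) * y (k + 1) := by
  have hsum : ∀ j, j ≤ m → ∑ i ∈ Finset.range j, (y (i + 1) - y i) * max 0 (min 1 (v - i)) =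
      if j ≤ k then y j - y 0 else y k - y 0 + (y (k + 1) - y k) * (v - k) := by
    intro j
    induction j with
    | zero => simp
    | succ j ih =>
      intro hj
      rw [Finset.sum_range_succ, ih (by omega)]
      rcases lt_trichotomy j k with h | h | h
      · have hjk : (j : ℝ) + 1 ≤ k := by exact_mod_cast h
        rw [if_pos h.le, if_pos (by omega), min_eq_left (by linarith), max_eq_right (by norm_num)]
        ring
      · subst h
        rw [if_pos le_rfl, if_neg (by omega), min_eq_right (by linarith),
          max_eq_right (by linarith)]
      · have hjk : (k : ℝ) + 1 ≤ j := by exact_mod_cast h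
        rw [if_neg (by omega), if_neg (by omega), min_eq_right (by linarith),
          max_eq_left (by linarith)]
        ring
  unfold plin
  rw [hsum m le_rfl, if_neg (by omega)]
  ring

theorem lipschitzWith_clamp (c : ℝ) : LipschitzWith 1 (fun v : ℝ => max 0 (min 1 (v - c))) := by
  have h1 : LipschitzWith 1 (fun v : ℝ => v - c) := by
    apply LipschitzWith.of_dist_le_mul
    intro x y
    simp [Real.dist_eq]
  exact (h1.const_min 1).const_max 0

theorem exists_lipschitzWith_plin (y : ℕ → ℝ) (m : ℕ) : ∃ C, LipschitzWith C (plin y m) := by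
  unfold plin
  induction m with
  | zero => exact ⟨0, by simp⟩
  | succ m ih =>
    obtain ⟨C, hC⟩ := ih
    refine ⟨C + ‖y (m + 1) - y m‖₊ * 1, ?_⟩
    simp only [Finset.sum_range_succ, ← add_assoc]
    apply hC.add
    apply LipschitzWith.of_dist_le_mul
    intro v w
    have := (lipschitzWith_clamp (m : ℝ)).dist_le_mul v w
    rw [Real.dist_eq, ← mul_sub, abs_mul]
    rw [Real.dist_eq] at this
    push_cast
    rw [mul_assoc]
    exact mul_le_mul_of_nonneg_left this (abs_nonneg _)

/-! ### Isotopies of families of monotone strands -/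

/-- This reduces the Lipschitz condition for linear motions to pairs of points with the same
parameter. By `hh` the distance during the motion controls `|v - w|`, so one point may be slid along
its strand to the parameter of the other at a controlled cost. -/
theorem exists_isotopicToId_of_strands {A : Type*} (f₀ f₁ : A → ℝ → Space) (J : Set ℝ)
    (Λ μ C : ℝ) (hμ : 0 < μ) (hΛ : 0 ≤ Λ)
    (hL₀ : ∀ a, ∀ v ∈ J, ∀ w ∈ J, ‖f₀ a v - f₀ a w‖ ≤ Λ * |v - w|)
    (hL₁ : ∀ a, ∀ v ∈ J, ∀ w ∈ J, ‖f₁ a v - f₁ a w‖ ≤ Λ * |v - w|)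
    (hh : ∀ t ∈ Icc (0 : ℝ) 1, ∀ a b, ∀ v ∈ J, ∀ w ∈ J, μ * |v - w| ≤
      ‖((1 - t) • f₀ a v + t • f₁ a v) - ((1 - t) • f₀ b w + t • f₁ b w)‖)
    (hlev : ∀ t ∈ Icc (0 : ℝ) 1, ∀ a b, ∀ v ∈ J, ‖(f₁ a v - f₁ b v) - (f₀ a v - f₀ b v)‖ ≤
      C * ‖(1 - t) • (f₀ a v - f₀ b v) + t • (f₁ a v - f₁ b v)‖) :
    ∃ Φ : Space ≃ₜ Space, IsotopicToId Φ ∧ ∀ a, ∀ v ∈ J, Φ (f₀ a v) = f₁ a v := by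
  obtain ⟨Φ, hΦ, h⟩ := exists_isotopicToId_of_linear_motion
    (fun ω : A × J => f₀ ω.1 ω.2) (fun ω : A × J => f₁ ω.1 ω.2)
    -- The first term is the comparison at equal parameters, after sliding has enlarged the distance
    -- by the factor `1 + Λ / μ`; the second collects the sliding errors of the two velocities.
    (max C 0 * (1 + Λ / μ) + 2 * Λ / μ) (by
      rintro t ht ⟨a, v, hv⟩ ⟨b, w, hw⟩
      dsimp only
      set E := ‖((1 - t) • f₀ a v + t • f₁ a v) - ((1 - t) • f₀ b w + t • f₁ b w)‖ with hE
      have h1 : |v - w| ≤ E / μ := by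
        rw [le_div_iff₀ hμ, mul_comm]
        exact hh t ht a b v hv w hw
      have h0 : Λ * |v - w| ≤ Λ / μ * E := by
        calc Λ * |v - w| ≤ Λ * (E / μ) := mul_le_mul_of_nonneg_left h1 hΛ
          _ = _ := by ring
      have h2 : ‖(1 - t) • (f₀ a v - f₀ b v) + t • (f₁ a v - f₁ b v)‖ ≤ E + Λ / μ * E := by
        have e : (1 - t) • (f₀ a v - f₀ b v) + t • (f₁ a v - f₁ b v) =
            (((1 - t) • f₀ a v + t • f₁ a v) - ((1 - t) • f₀ b w + t • f₁ b w)) +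
              ((1 - t) • (f₀ b w - f₀ b v) + t • (f₁ b w - f₁ b v)) := by
          module
        rw [e]
        refine (norm_add_le _ _).trans (add_le_add le_rfl ?_)
        refine (norm_add_le _ _).trans ?_
        rw [norm_smul, norm_smul, Real.norm_of_nonneg (by linarith [ht.2]),
          Real.norm_of_nonneg ht.1]
        have h3 := hL₀ b w hw v hv
        have h4 := hL₁ b w hw v hv
        rw [abs_sub_comm] at h3 h4
        calc _ ≤ (1 - t) * (Λ * |v - w|) + t * (Λ * |v - w|) :=
              add_le_add (mul_le_mul_of_nonneg_left h3 (by linarith [ht.2]))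
                (mul_le_mul_of_nonneg_left h4 ht.1)
          _ = Λ * |v - w| := by ring
          _ ≤ _ := h0
      have h5 : (f₁ a v - f₀ a v) - (f₁ b w - f₀ b w) =
          ((f₁ a v - f₁ b v) - (f₀ a v - f₀ b v)) + (f₁ b v - f₁ b w) - (f₀ b v - f₀ b w) := by
        abel
      rw [h5]
      refine (norm_sub_le _ _).trans ?_
      refine (add_le_add_left (norm_add_le _ _) _).trans ?_
      have h6 := hlev t ht a b v hv
      have h7 := hL₀ b v hv w hw
      have h8 := hL₁ b v hv w hw
      have h9 : C * ‖(1 - t) • (f₀ a v - f₀ b v) + t • (f₁ a v - f₁ b v)‖ ≤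
          max C 0 * (E + Λ / μ * E) :=
        (mul_le_mul_of_nonneg_right (le_max_left _ _) (norm_nonneg _)).trans
          (mul_le_mul_of_nonneg_left h2 (le_max_right _ _))
      calc _ ≤ max C 0 * (E + Λ / μ * E) + Λ / μ * E + Λ / μ * E := by linarith
        _ = _ := by ring)
  exact ⟨Φ, hΦ, fun a v hv => h (a, ⟨v, hv⟩)⟩

/-- A uniform bound on a compact interval for the ratio of the velocity and the distance of two
strands that move without meeting. -/
theorem exists_ratio_bound (D₀ D₁ : ℝ → Space) (p q : ℝ) (h₀ : Continuous D₀)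
    (h₁ : Continuous D₁)
    (hne : ∀ v ∈ Icc p q, ∀ t ∈ Icc (0 : ℝ) 1, (1 - t) • D₀ v + t • D₁ v ≠ 0) :
    ∃ C : ℝ, 0 ≤ C ∧ ∀ v ∈ Icc p q, ∀ t ∈ Icc (0 : ℝ) 1,
      ‖D₁ v - D₀ v‖ ≤ C * ‖(1 - t) • D₀ v + t • D₁ v‖ := by
  have hc : IsCompact (Icc p q ×ˢ Icc (0 : ℝ) 1) := isCompact_Icc.prod isCompact_Icc
  have hcont : ContinuousOn (fun c : ℝ × ℝ =>
      ‖D₁ c.1 - D₀ c.1‖ / ‖(1 - c.2) • D₀ c.1 + c.2 • D₁ c.1‖) (Icc p q ×ˢ Icc (0 : ℝ) 1) := by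
    apply ContinuousOn.div
    · fun_prop
    · fun_prop
    · rintro ⟨v, t⟩ ⟨hv, ht⟩
      exact norm_ne_zero_iff.2 (hne v hv t ht)
  obtain ⟨C, hC⟩ := (hc.image_of_continuousOn hcont).bddAbove
  refine ⟨max C 0, le_max_right _ _, fun v hv t ht => ?_⟩
  have h1 : _ ≤ C := hC ⟨(v, t), ⟨hv, ht⟩, rfl⟩
  have h2 := norm_pos_iff.2 (hne v hv t ht)
  dsimp only at h1
  rw [div_le_iff₀ h2] at h1
  exact h1.trans (mul_le_mul_of_nonneg_right (le_max_left _ _) h2.le)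

/-! ### The strands of a closed diagram -/

/-- The effect of a letter on a ranking of the strands. -/
def LetterStep {A : Type*} {M : ℕ} (l : Gen M × Bool) (ρ ρ' : A ≃ Fin M) : Prop :=
  match l.1 with
  | Gen.sigma i => ρ' = ρ.trans (adjSwap i)
  | Gen.twist _ => ρ' = ρ

/-- The first coordinate of the strand in position `p` half-way through a letter. -/
def midX {M : ℕ} (l : Gen M × Bool) (p : Fin M) : ℝ :=
  match l.1 with
  | Gen.sigma i => if p.val = i.val then i.val else if p.val = i.val + 1 then i.val + 1 / 2 else p.val
  | Gen.twist _ => p.val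

/-- The second coordinate of the strand in position `p` half-way through a letter. -/
def midY {M : ℕ} (l : Gen M × Bool) (p : Fin M) : ℝ :=
  match l.1 with
  | Gen.sigma i => if p.val = i.val then exponent l.2 else 0
  | Gen.twist _ => 0

/-- A braid word on `2 n` strands with `K` letters, whose strands are labelled by `A`:
`ρ k` gives the positions of the strands at level `k`. -/
structure PlatData (A : Type*) (n : ℕ) where
  K : ℕ
  ρ : ℕ → A ≃ Fin (2 * n)
  l : ℕ → Gen (2 * n) × Bool
  step : ∀ k, LetterStep (l k) (ρ k) (ρ (k + 1))

namespace PlatData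

variable {A : Type*} {n : ℕ} (D : PlatData A n)

/-- The number of the upper arc at the strand `a`. -/
def top (a : A) : ℕ := (D.ρ 0 a).val / 2

/-- The number of the lower arc at the strand `a`. -/
def bot (a : A) : ℕ := (D.ρ D.K a).val / 2

/-- The first coordinate of the strand `a` at level `j`, counted from the upper tips. -/
def level (a : A) (j : ℕ) : ℝ :=
  if j = 0 then 2 * (D.top a : ℝ) + 1 / 2 else
    if j = D.K + 2 then 2 * (D.bot a : ℝ) + 1 / 2 else (D.ρ (j - 1) a).val

/-- The vertices of the strand `a`, with middle points in all layers: first coordinate. -/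
def nodeX (a : A) (m : ℕ) : ℝ :=
  if m % 2 = 0 then D.level a (m / 2) else
    -- The middle points of the arcs are the midpoints of their straight edges, so they add no
    -- corner.
    if m = 1 ∨ m = 2 * D.K + 3 then (D.level a (m / 2) + D.level a (m / 2 + 1)) / 2 else
      midX (D.l (m / 2 - 1)) (D.ρ (m / 2 - 1) a)

/-- The vertices of the strand `a`, with middle points in all layers: second coordinate. -/
def nodeY (a : A) (m : ℕ) : ℝ :=
  if m % 2 = 0 ∨ m = 1 ∨ m = 2 * D.K + 3 then 0 else midY (D.l (m / 2 - 1)) (D.ρ (m / 2 - 1) a)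

/-- The first coordinate of the strand `a`. -/
def x (a : A) : ℝ → ℝ := plin (D.nodeX a) (2 * D.K + 4)

/-- The second coordinate of the strand `a`. -/
def y (a : A) : ℝ → ℝ := plin (D.nodeY a) (2 * D.K + 4)

/-- The strand `a`, with heights from `1` to `-K - 1`. -/
def pt (a : A) (v : ℝ) : Space := ![D.x a v, D.y a v, 1 - v / 2]

theorem nodeX_zero (a : A) : D.nodeX a 0 = 2 * (D.top a : ℝ) + 1 / 2 := by
  simp [nodeX, level]

theorem nodeX_one (a : A) :
    D.nodeX a 1 = ((2 * (D.top a : ℝ) + 1 / 2) + (D.ρ 0 a).val) / 2 := by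
  simp [nodeX, level]

theorem nodeX_level (a : A) {k : ℕ} (hk : k ≤ D.K) : D.nodeX a (2 * k + 2) = (D.ρ k a).val := by
  have h1 : (2 * k + 2) / 2 = k + 1 := by omega
  have h2 : ¬ (k + 1 = D.K + 2) := by omega
  have h3 : (2 * k + 2) % 2 = 0 := by omega
  rw [nodeX, if_pos h3, level, h1, if_neg (by omega), if_neg h2, Nat.add_sub_cancel]

theorem nodeX_mid (a : A) {k : ℕ} (hk : k < D.K) :
    D.nodeX a (2 * k + 3) = midX (D.l k) (D.ρ k a) := by
  have h1 : (2 * k + 3) / 2 = k + 1 := by omega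
  have h2 : ¬ (2 * k + 3 = 1 ∨ 2 * k + 3 = 2 * D.K + 3) := by omega
  have h3 : ¬ (2 * k + 3) % 2 = 0 := by omega
  rw [nodeX, if_neg h3, if_neg h2, h1, Nat.add_sub_cancel]

theorem nodeX_last (a : A) : D.nodeX a (2 * D.K + 4) = 2 * (D.bot a : ℝ) + 1 / 2 := by
  have h1 : (2 * D.K + 4) / 2 = D.K + 2 := by omega
  have h3 : (2 * D.K + 4) % 2 = 0 := by omega
  rw [nodeX, if_pos h3, level, h1, if_neg (by omega), if_pos rfl]

theorem nodeX_pred_last (a : A) : D.nodeX a (2 * D.K + 3) =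
    ((D.ρ D.K a).val + (2 * (D.bot a : ℝ) + 1 / 2)) / 2 := by
  have h1 : (2 * D.K + 3) / 2 = D.K + 1 := by omega
  have h3 : ¬ (2 * D.K + 3) % 2 = 0 := by omega
  rw [nodeX, if_neg h3, if_pos (Or.inr rfl), level, level, h1, if_neg (by omega),
    if_neg (by omega), if_neg (by omega), if_pos rfl, Nat.add_sub_cancel]

theorem nodeY_even (a : A) (k : ℕ) : D.nodeY a (2 * k) = 0 := by
  simp [nodeY]

theorem nodeY_one (a : A) : D.nodeY a 1 = 0 := by
  simp [nodeY]

theorem nodeY_pred_last (a : A) : D.nodeY a (2 * D.K + 3) = 0 := by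
  simp [nodeY]

theorem nodeY_mid (a : A) {k : ℕ} (hk : k < D.K) :
    D.nodeY a (2 * k + 3) = midY (D.l k) (D.ρ k a) := by
  have h1 : (2 * k + 3) / 2 = k + 1 := by omega
  have h2 : ¬ ((2 * k + 3) % 2 = 0 ∨ 2 * k + 3 = 1 ∨ 2 * k + 3 = 2 * D.K + 3) := by omega
  rw [nodeY, if_neg h2, h1, Nat.add_sub_cancel]

/-- A strand has two units of parameter per layer: `[0, 2]` is the upper arc, `[2k + 2, 2k + 4]` the
letter `k` with its middle at `2k + 3`, and `[2K + 2, 2K + 4]` the lower arc. -/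
theorem x_y_top (a : A) {v : ℝ} (hv : v ∈ Icc (0 : ℝ) 2) :
    D.x a v = (1 - v / 2) * (2 * (D.top a : ℝ) + 1 / 2) + v / 2 * (D.ρ 0 a).val ∧
      D.y a v = 0 := by
  have hl := D.nodeX_level a (Nat.zero_le D.K)
  have hy := D.nodeY_even a 1
  have hy0 := D.nodeY_even a 0
  simp only [mul_zero, zero_add, mul_one] at hl hy hy0
  rcases le_total v 1 with h | h
  · rw [x, y, plin_eq (k := 0) _ (by omega) (by simpa using hv.1) (by simpa using h),
      plin_eq (k := 0) _ (by omega) (by simpa using hv.1) (by simpa using h)]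
    simp only [zero_add, hy0, nodeY_one, nodeX_zero, nodeX_one, Nat.cast_zero]
    constructor <;> ring
  · rw [x, y, plin_eq (k := 1) _ (by omega) (by simpa using h) (by norm_num; exact hv.2),
      plin_eq (k := 1) _ (by omega) (by simpa using h) (by norm_num; exact hv.2)]
    simp only [one_add_one_eq_two, hy, hl, nodeY_one, nodeX_one, Nat.cast_one]
    constructor <;> ring

theorem x_y_bot (a : A) {v : ℝ} (hv : v ∈ Icc (2 * D.K + 2 : ℝ) (2 * D.K + 4)) :
    D.x a v = (1 - (v - (2 * D.K + 2)) / 2) * (D.ρ D.K a).val +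
      (v - (2 * D.K + 2)) / 2 * (2 * (D.bot a : ℝ) + 1 / 2) ∧ D.y a v = 0 := by
  have hl := D.nodeX_level a (le_refl D.K)
  have hy := D.nodeY_even a (D.K + 1)
  have hy0 := D.nodeY_even a (D.K + 2)
  rw [show 2 * (D.K + 1) = 2 * D.K + 2 by ring] at hy
  rw [show 2 * (D.K + 2) = 2 * D.K + 4 by ring] at hy0
  rcases le_total v (2 * D.K + 3) with h | h
  · have e1 : ((2 * D.K + 2 : ℕ) : ℝ) ≤ v := by push_cast; exact hv.1
    have e2 : v ≤ ((2 * D.K + 2 : ℕ) : ℝ) + 1 := by push_cast; linarith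
    rw [x, y, plin_eq _ (by omega) e1 e2, plin_eq _ (by omega) e1 e2]
    rw [show 2 * D.K + 2 + 1 = 2 * D.K + 3 by ring, hl, hy, nodeX_pred_last, nodeY_pred_last]
    push_cast
    constructor <;> ring
  · have e1 : ((2 * D.K + 3 : ℕ) : ℝ) ≤ v := by push_cast; exact h
    have e2 : v ≤ ((2 * D.K + 3 : ℕ) : ℝ) + 1 := by push_cast; linarith [hv.2]
    rw [x, y, plin_eq _ (by omega) e1 e2, plin_eq _ (by omega) e1 e2]
    rw [show 2 * D.K + 3 + 1 = 2 * D.K + 4 by ring, hy0, nodeX_pred_last, nodeY_pred_last,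
      nodeX_last]
    push_cast
    constructor <;> ring

theorem x_y_fst (a : A) {k : ℕ} (hk : k < D.K) {v : ℝ}
    (hv : v ∈ Icc (2 * k + 2 : ℝ) (2 * k + 3)) :
    D.x a v = (1 - (v - (2 * k + 2))) * (D.ρ k a).val +
      (v - (2 * k + 2)) * midX (D.l k) (D.ρ k a) ∧
    D.y a v = (v - (2 * k + 2)) * midY (D.l k) (D.ρ k a) := by
  have hl := D.nodeX_level a hk.le
  have hy := D.nodeY_even a (k + 1)
  rw [show 2 * (k + 1) = 2 * k + 2 by ring] at hy
  have e1 : ((2 * k + 2 : ℕ) : ℝ) ≤ v := by push_cast; exact hv.1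
  have e2 : v ≤ ((2 * k + 2 : ℕ) : ℝ) + 1 := by push_cast; linarith [hv.2]
  rw [x, y, plin_eq _ (by omega) e1 e2, plin_eq _ (by omega) e1 e2]
  rw [show 2 * k + 2 + 1 = 2 * k + 3 by ring, hl, hy, nodeX_mid _ _ hk, nodeY_mid _ _ hk]
  push_cast
  constructor <;> ring

theorem x_y_snd (a : A) {k : ℕ} (hk : k < D.K) {v : ℝ}
    (hv : v ∈ Icc (2 * k + 3 : ℝ) (2 * k + 4)) :
    D.x a v = (1 - (v - (2 * k + 3))) * midX (D.l k) (D.ρ k a) +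
      (v - (2 * k + 3)) * (D.ρ (k + 1) a).val ∧
    D.y a v = (1 - (v - (2 * k + 3))) * midY (D.l k) (D.ρ k a) := by
  have hl := D.nodeX_level a (show k + 1 ≤ D.K by omega)
  have hy := D.nodeY_even a (k + 2)
  rw [show 2 * (k + 1) + 2 = 2 * k + 4 by ring] at hl
  rw [show 2 * (k + 2) = 2 * k + 4 by ring] at hy
  have e1 : ((2 * k + 3 : ℕ) : ℝ) ≤ v := by push_cast; exact hv.1
  have e2 : v ≤ ((2 * k + 3 : ℕ) : ℝ) + 1 := by push_cast; linarith [hv.2]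
  rw [x, y, plin_eq _ (by omega) e1 e2, plin_eq _ (by omega) e1 e2]
  rw [show 2 * k + 3 + 1 = 2 * k + 4 by ring, hl, hy, nodeX_mid _ _ hk, nodeY_mid _ _ hk]
  push_cast
  constructor <;> ring

end PlatData

/-! ### The relative position of two strands of a closed diagram -/

theorem exponent_abs (ε : Bool) : |(exponent ε : ℝ)| = 1 := by
  cases ε <;> simp [exponent]

/-- The middle points of two strands that do not cross in a letter. -/
theorem mid_sub_mid_of_lt {A : Type*} {M : ℕ} {l : Gen M × Bool} {ρ ρ' : A ≃ Fin M}
    (h : LetterStep l ρ ρ') {a b : A} (hab : ρ a < ρ b) (hab' : ρ' a < ρ' b) :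
    midX l (ρ a) - midX l (ρ b) < 0 ∧
      midX l (ρ a) - midX l (ρ b) ≤ -|midY l (ρ a) - midY l (ρ b)| := by
  obtain ⟨g, ε⟩ := l
  rw [Fin.lt_def] at hab hab'
  cases g with
  | twist j =>
    have : ((ρ a).val : ℝ) < (ρ b).val := by exact_mod_cast hab
    simp only [midX, midY, sub_zero, abs_zero, neg_zero]
    constructor <;> linarith
  | sigma i =>
    change ρ' = ρ.trans (adjSwap i) at h
    rw [h, Equiv.trans_apply, Equiv.trans_apply, adjSwap_val, adjSwap_val] at hab'
    have hε := exponent_abs ε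
    simp only [midX, midY]
    generalize (ρ a).val = p at *
    generalize (ρ b).val = q at *
    generalize i.val = i at *
    have hpq : (p : ℝ) + 1 ≤ q := by exact_mod_cast hab
    by_cases h1 : p = i
    · subst h1
      -- A strand starting directly to the right of the bent one would cross it, so here the gap is
      -- at least two and exceeds the depth of the bend.
      have h2 : q ≠ p + 1 := by
        rintro rfl
        simp at hab'
      have h3 : (p : ℝ) + 2 ≤ q := by exact_mod_cast (by omega : p + 2 ≤ q)
      rw [if_pos rfl, if_neg (by omega), if_neg h2, if_pos rfl, if_neg (by omega), sub_zero, hε]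
      constructor <;> linarith
    · by_cases h2 : q = i
      · subst h2
        rw [if_neg h1, if_neg (by omega), if_pos rfl, if_neg h1, if_pos rfl, zero_sub, abs_neg, hε]
        constructor <;> linarith
      · rw [if_neg h1, if_neg h2, if_neg h1, if_neg h2, sub_zero, abs_zero, neg_zero]
        have : (if p = i + 1 then (i : ℝ) + 1 / 2 else p) - (if q = i + 1 then (i : ℝ) + 1 / 2 else q)
            < 0 := by
          split_ifs with h3 h4 h4
          · omega
          · subst h3
            push_cast at hpq
            linarith
          · have h5 : p < i := by omega
            have : (p : ℝ) < i := by exact_mod_cast h5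
            linarith
          · linarith
        exact ⟨this, this.le⟩

/-- The middle points of two strands that cross in a letter. -/
theorem mid_sub_mid_of_crossing {A : Type*} {M : ℕ} {l : Gen M × Bool} {ρ ρ' : A ≃ Fin M}
    (h : LetterStep l ρ ρ') {a b : A} (hab : ρ a < ρ b) (hab' : ρ' b < ρ' a) :
    (ρ b).val = (ρ a).val + 1 ∧ (ρ' a).val = (ρ' b).val + 1 ∧
    midX l (ρ a) - midX l (ρ b) = -1 / 2 ∧ midY l (ρ a) - midY l (ρ b) = exponent l.2 := by
  obtain ⟨g, ε⟩ := l
  cases g with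
  | twist j =>
    change ρ' = ρ at h
    rw [h] at hab'
    exact absurd hab (lt_asymm hab')
  | sigma i =>
    change ρ' = ρ.trans (adjSwap i) at h
    have hc : (ρ a).val = i.val ∧ (ρ b).val = i.val + 1 := by
      by_contra hc
      have := adjSwap_lt_adjSwap i hab hc
      rw [h] at hab'
      exact lt_asymm hab' this
    rw [h, Equiv.trans_apply, Equiv.trans_apply, adjSwap_val, adjSwap_val, hc.1, hc.2]
    simp only [midX, midY, hc.1, hc.2]
    refine ⟨by simp, by simp, ?_, ?_⟩
    · simp; norm_num
    · simp

namespace PlatData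

variable {A : Type*} {n : ℕ} (D : PlatData A n)

/-- The cone of relative positions with `x < 0` and `x ≤ -|y|` is convex. It contains the relative
positions at both levels and at the middle of the letter, hence everything between. The cone
condition, rather than `x < 0` alone, is what the interpolation below needs. -/
theorem rel_of_lt {k : ℕ} (hk : k < D.K) {a b : A} (hab : D.ρ k a < D.ρ k b)
    (hab' : D.ρ (k + 1) a < D.ρ (k + 1) b) {v : ℝ} (hv : v ∈ Icc (2 * k + 2 : ℝ) (2 * k + 4)) :
    D.x a v - D.x b v < 0 ∧ D.x a v - D.x b v ≤ -|D.y a v - D.y b v| := by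
  obtain ⟨h1, h2⟩ := mid_sub_mid_of_lt (D.step k) hab hab'
  have h3 : ((D.ρ k a).val : ℝ) - (D.ρ k b).val ≤ -1 := by
    have : ((D.ρ k a).val : ℝ) + 1 ≤ (D.ρ k b).val := by exact_mod_cast hab
    linarith
  have h4 : ((D.ρ (k + 1) a).val : ℝ) - (D.ρ (k + 1) b).val ≤ -1 := by
    have : ((D.ρ (k + 1) a).val : ℝ) + 1 ≤ (D.ρ (k + 1) b).val := by exact_mod_cast hab'
    linarith
  have key : ∀ r q u w : ℝ, 0 ≤ r → r ≤ 1 → q ≤ -1 → u < 0 → u ≤ -|w| →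
      (1 - r) * q + r * u < 0 ∧ (1 - r) * q + r * u ≤ -|r * w| := by
    intro r q u w hr0 hr1 hq hu huw
    rw [abs_mul, abs_of_nonneg hr0]
    have e1 : (1 - r) * q ≤ -(1 - r) := by nlinarith
    have e2 : r * u ≤ -(r * |w|) := by nlinarith
    constructor
    · rcases eq_or_lt_of_le hr0 with rfl | hr
      · linarith
      · nlinarith [mul_neg_of_pos_of_neg hr hu]
    · linarith
  rcases le_total v (2 * k + 3) with h | h
  · obtain ⟨xa, ya⟩ := D.x_y_fst a hk ⟨hv.1, h⟩
    obtain ⟨xb, yb⟩ := D.x_y_fst b hk ⟨hv.1, h⟩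
    have := key (v - (2 * k + 2)) _ _ _ (by linarith [hv.1]) (by linarith) h3 h1 h2
    rw [xa, xb, ya, yb]
    convert this using 2
    · ring
    · ring
    · congr 2; ring
  · obtain ⟨xa, ya⟩ := D.x_y_snd a hk ⟨h, hv.2⟩
    obtain ⟨xb, yb⟩ := D.x_y_snd b hk ⟨h, hv.2⟩
    have := key (1 - (v - (2 * k + 3))) _ _ _ (by linarith [hv.2]) (by linarith) h4 h1 h2
    rw [xa, xb, ya, yb]
    convert this using 2
    · ring
    · ring
    · congr 2; ring

/-- In the first half of the letter the `x`-difference stays negative. In the second half the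
`y`-difference is a positive multiple of the sign until the end, where the `x`-difference is one. -/
theorem rel_of_crossing {k : ℕ} (hk : k < D.K) {a b : A} (hab : D.ρ k a < D.ρ k b)
    (hab' : D.ρ (k + 1) b < D.ρ (k + 1) a) {v : ℝ}
    (hv : v ∈ Icc (2 * k + 2 : ℝ) (2 * k + 4)) :
    0 ≤ (exponent (D.l k).2 : ℝ) * (D.y a v - D.y b v) ∧
      (D.x a v - D.x b v ≠ 0 ∨ D.y a v - D.y b v ≠ 0) := by
  obtain ⟨h1, h2, h3, h4⟩ := mid_sub_mid_of_crossing (D.step k) hab hab'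
  have h1' : ((D.ρ k b).val : ℝ) = (D.ρ k a).val + 1 := by exact_mod_cast h1
  have h2' : ((D.ρ (k + 1) a).val : ℝ) = (D.ρ (k + 1) b).val + 1 := by exact_mod_cast h2
  have hε : (exponent (D.l k).2 : ℝ) * exponent (D.l k).2 = 1 := by
    rw [← abs_mul_abs_self, exponent_abs, one_mul]
  have hε0 : (exponent (D.l k).2 : ℝ) ≠ 0 := left_ne_zero_of_mul_eq_one hε
  rcases le_total v (2 * k + 3) with h | h
  · obtain ⟨xa, ya⟩ := D.x_y_fst a hk ⟨hv.1, h⟩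
    obtain ⟨xb, yb⟩ := D.x_y_fst b hk ⟨hv.1, h⟩
    have hy : D.y a v - D.y b v = (v - (2 * k + 2)) * exponent (D.l k).2 := by
      rw [ya, yb, ← mul_sub, h4]
    have hx : D.x a v - D.x b v = -(1 - (v - (2 * k + 2))) + (v - (2 * k + 2)) * (-1 / 2) := by
      rw [xa, xb, ← h3, h1']; ring
    refine ⟨?_, Or.inl ?_⟩
    · rw [hy, mul_left_comm, hε]
      linarith [hv.1]
    · rw [hx]
      exact ne_of_lt (by linarith [hv.1])
  · obtain ⟨xa, ya⟩ := D.x_y_snd a hk ⟨h, hv.2⟩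
    obtain ⟨xb, yb⟩ := D.x_y_snd b hk ⟨h, hv.2⟩
    have hy : D.y a v - D.y b v = (1 - (v - (2 * k + 3))) * exponent (D.l k).2 := by
      rw [ya, yb, ← mul_sub, h4]
    have hx : D.x a v - D.x b v = (1 - (v - (2 * k + 3))) * (-1 / 2) + (v - (2 * k + 3)) := by
      rw [xa, xb, ← h3, h2']; ring
    refine ⟨?_, ?_⟩
    · rw [hy, mul_left_comm, hε]
      linarith [hv.2]
    · rcases eq_or_lt_of_le hv.2 with h' | h'
      · left
        rw [hx, h']
        norm_num
      · right
        rw [hy]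
        exact mul_ne_zero (by linarith) hε0

theorem rel_top_of_ne {a b : A} (h : D.top a < D.top b) {v : ℝ} (hv : v ∈ Icc (0 : ℝ) 2) :
    D.x a v - D.x b v < 0 := by
  rw [(D.x_y_top a hv).1, (D.x_y_top b hv).1]
  have h1 : (D.top a : ℝ) + 1 ≤ D.top b := by exact_mod_cast h
  have h2 : ((D.ρ 0 a).val : ℝ) + 1 ≤ (D.ρ 0 b).val := by
    unfold top at h
    exact_mod_cast (by omega : (D.ρ 0 a).val + 1 ≤ (D.ρ 0 b).val)
  nlinarith [hv.1, hv.2]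

theorem rel_bot_of_ne {a b : A} (h : D.bot a < D.bot b) {v : ℝ}
    (hv : v ∈ Icc (2 * D.K + 2 : ℝ) (2 * D.K + 4)) : D.x a v - D.x b v < 0 := by
  rw [(D.x_y_bot a hv).1, (D.x_y_bot b hv).1]
  have h1 : (D.bot a : ℝ) + 1 ≤ D.bot b := by exact_mod_cast h
  have h2 : ((D.ρ D.K a).val : ℝ) + 1 ≤ (D.ρ D.K b).val := by
    unfold bot at h
    exact_mod_cast (by omega : (D.ρ D.K a).val + 1 ≤ (D.ρ D.K b).val)
  nlinarith [hv.1, hv.2]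

theorem rel_top_of_eq {a b : A} (h : D.top a = D.top b) {v : ℝ} (hv : v ∈ Icc (0 : ℝ) 2) :
    D.x a v - D.x b v = v / 2 * (((D.ρ 0 a).val : ℝ) - (D.ρ 0 b).val) := by
  rw [(D.x_y_top a hv).1, (D.x_y_top b hv).1, h]
  ring

theorem rel_bot_of_eq {a b : A} (h : D.bot a = D.bot b) {v : ℝ}
    (hv : v ∈ Icc (2 * D.K + 2 : ℝ) (2 * D.K + 4)) : D.x a v - D.x b v =
      (1 - (v - (2 * D.K + 2)) / 2) * (((D.ρ D.K a).val : ℝ) - (D.ρ D.K b).val) := by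
  rw [(D.x_y_bot a hv).1, (D.x_y_bot b hv).1, h]
  ring

theorem exists_layer {v : ℝ} (h0 : 2 ≤ v) (h1 : v ≤ 2 * D.K + 2) (hK : 0 < D.K) :
    ∃ k < D.K, v ∈ Icc (2 * k + 2 : ℝ) (2 * k + 4) := by
  rcases eq_or_lt_of_le h1 with h | h
  · refine ⟨D.K - 1, by omega, ?_⟩
    rw [Nat.cast_sub hK]
    constructor <;> push_cast <;> linarith
  · have hn : 0 ≤ (v - 2) / 2 := by linarith
    refine ⟨⌊(v - 2) / 2⌋₊, ?_, ?_⟩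
    · rw [Nat.floor_lt hn]
      linarith
    · have e1 := Nat.floor_le hn
      have e2 := Nat.lt_floor_add_one ((v - 2) / 2)
      constructor <;> linarith

/-- Distinct strands meet only in the tips of the arcs. -/
theorem strands_disjoint (hK : 0 < D.K) {a b : A} (hab : a ≠ b) {v : ℝ}
    (hv : v ∈ Icc (0 : ℝ) (2 * D.K + 4)) (h0 : v = 0 → D.top a ≠ D.top b)
    (h1 : v = 2 * D.K + 4 → D.bot a ≠ D.bot b) :
    D.x a v - D.x b v ≠ 0 ∨ D.y a v - D.y b v ≠ 0 := by
  have hne : ∀ k, (D.ρ k a).val ≠ (D.ρ k b).val :=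
    fun k h => hab ((D.ρ k).injective (Fin.ext h))
  rcases le_total v 2 with h | h
  · left
    by_cases ht : D.top a = D.top b
    · rw [D.rel_top_of_eq ht ⟨hv.1, h⟩]
      refine mul_ne_zero (div_ne_zero (fun hv0 => h0 hv0 ht) two_ne_zero) (sub_ne_zero.2 ?_)
      exact_mod_cast hne 0
    · rcases lt_or_gt_of_ne ht with ht | ht
      · exact (D.rel_top_of_ne ht ⟨hv.1, h⟩).ne
      · have := D.rel_top_of_ne ht ⟨hv.1, h⟩
        intro h'
        linarith
  · rcases le_total (2 * D.K + 2 : ℝ) v with h' | h'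
    · left
      by_cases ht : D.bot a = D.bot b
      · rw [D.rel_bot_of_eq ht ⟨h', hv.2⟩]
        refine mul_ne_zero (fun hv0 => h1 (by linarith) ht) (sub_ne_zero.2 ?_)
        exact_mod_cast hne D.K
      · rcases lt_or_gt_of_ne ht with ht | ht
        · exact (D.rel_bot_of_ne ht ⟨h', hv.2⟩).ne
        · have := D.rel_bot_of_ne ht ⟨h', hv.2⟩
          intro h'
          linarith
    · obtain ⟨k, hk, hvk⟩ := D.exists_layer h h' hK
      have hne' := hne (k + 1)
      rcases lt_or_gt_of_ne (hne k) with h1 | h1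
      · rcases lt_or_gt_of_ne hne' with h2 | h2
        · exact Or.inl (D.rel_of_lt hk h1 h2 hvk).1.ne
        · exact (D.rel_of_crossing hk h1 h2 hvk).2
      · have hs : D.x b v - D.x a v ≠ 0 ∨ D.y b v - D.y a v ≠ 0 := by
          rcases lt_or_gt_of_ne hne' with h2 | h2
          · exact (D.rel_of_crossing hk h1 h2 hvk).2
          · exact Or.inl (D.rel_of_lt hk h1 h2 hvk).1.ne
        simp only [ne_eq, sub_eq_zero] at hs ⊢
        rcases hs with hs | hs
        · exact Or.inl fun h => hs h.symm
        · exact Or.inr fun h => hs h.symm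

end PlatData

/-! ### Isotopies onto closed diagrams -/

/-- Passing through the origin would make `(x₀, y₀)` a nonnegative multiple of `-(x₁, y₁)`, which
lies in the cone `x ≥ |y|` excluded by `h₀`. Thus the moving strands may be out of order in `x` as
long as `y` separates them. -/
theorem interpolation_ne_zero_of_lt {x₀ y₀ x₁ y₁ t : ℝ} (ht : t ∈ Icc (0 : ℝ) 1)
    (h₀ : x₀ < |y₀|) (h₁ : x₁ < 0) (h₁' : x₁ ≤ -|y₁|) :
    ¬ ((1 - t) * x₀ + t * x₁ = 0 ∧ (1 - t) * y₀ + t * y₁ = 0) := by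
  rintro ⟨hx, hy⟩
  have e : (1 - t) * |y₀| = t * |y₁| := by
    have e0 : |(1 - t) * y₀| = |t * y₁| := by rw [eq_neg_of_add_eq_zero_left hy, abs_neg]
    rwa [abs_mul, abs_mul, abs_of_nonneg ht.1, abs_of_nonneg (sub_nonneg.2 ht.2)] at e0
  rcases eq_or_lt_of_le ht.2 with rfl | h
  · simp at hx
    exact h₁.ne hx
  · have h2 : t * x₁ ≤ t * -|y₁| := mul_le_mul_of_nonneg_left h₁' ht.1
    have h3 : (1 - t) * x₀ < (1 - t) * |y₀| := mul_lt_mul_of_pos_left h₀ (by linarith)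
    linarith

/-- For `t < 1` the `y`-difference keeps a strict sign, and for `t = 1` the final position is
nonzero by assumption. -/
theorem interpolation_ne_zero_of_pos {x₀ y₀ x₁ y₁ t ε : ℝ} (ht : t ∈ Icc (0 : ℝ) 1)
    (h₀ : 0 < ε * y₀) (h₁ : 0 ≤ ε * y₁) (h₁' : x₁ ≠ 0 ∨ y₁ ≠ 0) :
    ¬ ((1 - t) * x₀ + t * x₁ = 0 ∧ (1 - t) * y₀ + t * y₁ = 0) := by
  rintro ⟨hx, hy⟩
  have e : (1 - t) * (ε * y₀) + t * (ε * y₁) = 0 := by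
    calc _ = ε * ((1 - t) * y₀ + t * y₁) := by ring
      _ = 0 := by rw [hy, mul_zero]
  rcases eq_or_lt_of_le ht.2 with rfl | h
  · simp only [sub_self, zero_mul, zero_add, one_mul] at hx hy
    tauto
  · have h2 : 0 < (1 - t) * (ε * y₀) := mul_pos (by linarith) h₀
    have h3 := mul_nonneg ht.1 h₁
    linarith

theorem interpolation_neg {x₀ x₁ t : ℝ} (ht : t ∈ Icc (0 : ℝ) 1) (h₀ : x₀ < 0) (h₁ : x₁ < 0) :
    (1 - t) * x₀ + t * x₁ < 0 := by
  rcases eq_or_lt_of_le ht.1 with rfl | h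
  · linarith
  · nlinarith [mul_neg_of_pos_of_neg h h₁, ht.2]

/-- The ratio bound for motions that are homogeneous near a common end point of two strands. -/
theorem ratio_bound_of_homogeneous {D₀ D₁ E₀ E₁ : Space} {r C t : ℝ} (hr : 0 ≤ r)
    (h₀ : D₀ = r • E₀) (h₁ : D₁ = r • E₁) (h : ‖E₁ - E₀‖ ≤ C * ‖(1 - t) • E₀ + t • E₁‖) :
    ‖D₁ - D₀‖ ≤ C * ‖(1 - t) • D₀ + t • D₁‖ := by
  have e1 : D₁ - D₀ = r • (E₁ - E₀) := by rw [h₀, h₁, smul_sub]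
  have e2 : (1 - t) • D₀ + t • D₁ = r • ((1 - t) • E₀ + t • E₁) := by rw [h₀, h₁]; module
  rw [e1, e2, norm_smul, norm_smul, Real.norm_of_nonneg hr]
  calc r * ‖E₁ - E₀‖ ≤ r * (C * ‖(1 - t) • E₀ + t • E₁‖) := mul_le_mul_of_nonneg_left h hr
    _ = _ := by ring

theorem norm_vec_le {x y z B : ℝ} (hx : |x| ≤ B) (hy : |y| ≤ B) (hz : |z| ≤ B) :
    ‖(![x, y, z] : Space)‖ ≤ B := by
  rw [pi_norm_le_iff_of_nonneg ((abs_nonneg x).trans hx)]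
  intro i
  fin_cases i
  · exact hx
  · exact hy
  · exact hz

theorem vec_sub (x y z x' y' z' : ℝ) :
    (![x, y, z] : Space) - ![x', y', z'] = ![x - x', y - y', z - z'] := by
  ext i
  fin_cases i <;> simp

theorem smul_vec (r x y z : ℝ) : r • (![x, y, z] : Space) = ![r * x, r * y, r * z] := by
  ext i
  fin_cases i <;> simp

namespace PlatData

variable {A : Type*} {n : ℕ} (D : PlatData A n)

theorem exists_lipschitzWith [Finite A] :
    ∃ C : ℝ≥0, (∀ a, LipschitzWith C (D.x a)) ∧ ∀ a, LipschitzWith C (D.y a) := by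
  cases nonempty_fintype A
  choose C hC using fun a => exists_lipschitzWith_plin (D.nodeX a) (2 * D.K + 4)
  choose C' hC' using fun a => exists_lipschitzWith_plin (D.nodeY a) (2 * D.K + 4)
  refine ⟨∑ a, (C a + C' a), fun a => (hC a).weaken ?_, fun a => (hC' a).weaken ?_⟩
  · exact le_trans (le_add_of_nonneg_right zero_le) (Finset.single_le_sum
      (f := fun a => C a + C' a) (fun _ _ => zero_le) (Finset.mem_univ a))
  · exact le_trans (le_add_of_nonneg_left zero_le) (Finset.single_le_sum
      (f := fun a => C a + C' a) (fun _ _ => zero_le) (Finset.mem_univ a))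

/-- Strands whose relative position agrees with the one of the strands of a closed diagram are
isotopic to the closed diagram. -/
theorem exists_isotopy [Finite A] (hK : 0 < D.K) (X Y : A → ℝ → ℝ) (h : ℝ → ℝ) (C : ℝ≥0)
    (hX : ∀ a, LipschitzWith C (X a)) (hY : ∀ a, LipschitzWith C (Y a)) (hh : LipschitzWith C h)
    (μ : ℝ) (hμ : 0 < μ) (hdec : ∀ v w, v ≤ w → μ * (w - v) ≤ h v - h w)
    (top_ne : ∀ a b, D.top a < D.top b → ∀ v ∈ Icc (0 : ℝ) 2, X a v < X b v)
    (top_eq : ∀ a b, D.top a = D.top b → ∀ v ∈ Icc (0 : ℝ) 2,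
      X a v - X b v = v / 2 * (X a 2 - X b 2) ∧ Y a v - Y b v = v / 2 * (Y a 2 - Y b 2))
    (bot_ne : ∀ a b, D.bot a < D.bot b → ∀ v ∈ Icc (2 * D.K + 2 : ℝ) (2 * D.K + 4), X a v < X b v)
    (bot_eq : ∀ a b, D.bot a = D.bot b → ∀ v ∈ Icc (2 * D.K + 2 : ℝ) (2 * D.K + 4),
      X a v - X b v = (1 - (v - (2 * D.K + 2)) / 2) * (X a (2 * D.K + 2) - X b (2 * D.K + 2)) ∧
      Y a v - Y b v = (1 - (v - (2 * D.K + 2)) / 2) * (Y a (2 * D.K + 2) - Y b (2 * D.K + 2)))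
    (lt : ∀ k < D.K, ∀ a b, D.ρ k a < D.ρ k b → D.ρ (k + 1) a < D.ρ (k + 1) b →
      ∀ v ∈ Icc (2 * k + 2 : ℝ) (2 * k + 4), X a v - X b v < |Y a v - Y b v|)
    (crossing : ∀ k < D.K, ∀ a b, D.ρ k a < D.ρ k b → D.ρ (k + 1) b < D.ρ (k + 1) a →
      ∀ v ∈ Icc (2 * k + 2 : ℝ) (2 * k + 4), 0 < (exponent (D.l k).2 : ℝ) * (Y a v - Y b v)) :
    ∃ Φ : Space ≃ₜ Space, IsotopicToId Φ ∧
      ∀ a, ∀ v ∈ Icc (0 : ℝ) (2 * D.K + 4), Φ ![X a v, Y a v, h v] = D.pt a v := by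
  obtain ⟨C', hx, hy⟩ := D.exists_lipschitzWith
  -- For each pair, a bound on relative velocity by distance at equal parameters is found separately
  -- on the upper arcs, the braid and the lower arcs. Except for a common tip, absence of collisions
  -- and compactness suffice.
  have hpair : ∀ a b, ∃ B : ℝ, 0 ≤ B ∧ ∀ v ∈ Icc (0 : ℝ) (2 * D.K + 4), ∀ t ∈ Icc (0 : ℝ) 1,
      ‖(D.pt a v - D.pt b v) - (![X a v, Y a v, h v] - ![X b v, Y b v, h v])‖ ≤
      B * ‖(1 - t) • ((![X a v, Y a v, h v] : Space) - ![X b v, Y b v, h v]) +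
        t • (D.pt a v - D.pt b v)‖ := by
    intro a b
    simp only [pt, vec_sub, sub_self]
    by_cases hab : a = b
    · subst hab
      exact ⟨0, le_rfl, fun v _ t _ => by simp⟩
    have hcont : Continuous (fun v => (![X a v - X b v, Y a v - Y b v, 0] : Space)) := by
      have h1 := (hX a).continuous
      have h2 := (hX b).continuous
      have h3 := (hY a).continuous
      have h4 := (hY b).continuous
      refine continuous_pi fun i => ?_
      fin_cases i
      · exact h1.sub h2
      · exact h3.sub h4
      · exact continuous_const
    have hcont' : Continuous
        (fun v => (![D.x a v - D.x b v, D.y a v - D.y b v, 0] : Space)) := by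
      have h1 := (hx a).continuous
      have h2 := (hx b).continuous
      have h3 := (hy a).continuous
      have h4 := (hy b).continuous
      refine continuous_pi fun i => ?_
      fin_cases i
      · exact h1.sub h2
      · exact h3.sub h4
      · exact continuous_const
    have key : ∀ p q : ℝ, (∀ v ∈ Icc p q, ∀ t ∈ Icc (0 : ℝ) 1,
        ¬ ((1 - t) * (X a v - X b v) + t * (D.x a v - D.x b v) = 0 ∧
          (1 - t) * (Y a v - Y b v) + t * (D.y a v - D.y b v) = 0)) →
        ∃ B : ℝ, 0 ≤ B ∧ ∀ v ∈ Icc p q, ∀ t ∈ Icc (0 : ℝ) 1,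
          ‖(![D.x a v - D.x b v, D.y a v - D.y b v, 0] : Space) -
            ![X a v - X b v, Y a v - Y b v, 0]‖ ≤
          B * ‖(1 - t) • (![X a v - X b v, Y a v - Y b v, 0] : Space) +
            t • ![D.x a v - D.x b v, D.y a v - D.y b v, 0]‖ := by
      intro p q hne
      refine exists_ratio_bound _ _ p q hcont hcont' fun v hv t ht h0 => hne v hv t ht ?_
      have e0 := congrFun h0 0
      have e1 := congrFun h0 1
      simpa using And.intro e0 e1
    have hmid : ∀ v ∈ Icc (2 : ℝ) (2 * D.K + 2), ∀ t ∈ Icc (0 : ℝ) 1,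
        ¬ ((1 - t) * (X a v - X b v) + t * (D.x a v - D.x b v) = 0 ∧
          (1 - t) * (Y a v - Y b v) + t * (D.y a v - D.y b v) = 0) := by
      intro v hv t ht
      obtain ⟨k, hk, hvk⟩ := D.exists_layer hv.1 hv.2 hK
      have main : ∀ a b, D.ρ k a < D.ρ k b →
          ¬ ((1 - t) * (X a v - X b v) + t * (D.x a v - D.x b v) = 0 ∧
          (1 - t) * (Y a v - Y b v) + t * (D.y a v - D.y b v) = 0) := by
        intro a b hab
        rcases lt_or_ge (D.ρ (k + 1) a) (D.ρ (k + 1) b) with h1 | h1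
        · obtain ⟨h2, h3⟩ := D.rel_of_lt hk hab h1 hvk
          exact interpolation_ne_zero_of_lt ht (lt k hk a b hab h1 v hvk) h2 h3
        · have h1' : D.ρ (k + 1) b < D.ρ (k + 1) a := by
            refine lt_of_le_of_ne h1 fun h => ?_
            have := (D.ρ (k + 1)).injective h
            subst this
            exact lt_irrefl _ hab
          obtain ⟨h2, h3⟩ := D.rel_of_crossing hk hab h1' hvk
          exact interpolation_ne_zero_of_pos ht (crossing k hk a b hab h1' v hvk) h2 h3
      rcases lt_or_gt_of_ne (fun h => hab ((D.ρ k).injective h)) with h1 | h1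
      · exact main a b h1
      · rintro ⟨e1, e2⟩
        exact main b a h1 ⟨by linarith, by linarith⟩
    have htop : ∃ B : ℝ, 0 ≤ B ∧ ∀ v ∈ Icc (0 : ℝ) 2, ∀ t ∈ Icc (0 : ℝ) 1,
          ‖(![D.x a v - D.x b v, D.y a v - D.y b v, 0] : Space) -
            ![X a v - X b v, Y a v - Y b v, 0]‖ ≤
          B * ‖(1 - t) • (![X a v - X b v, Y a v - Y b v, 0] : Space) +
            t • ![D.x a v - D.x b v, D.y a v - D.y b v, 0]‖ := by
      by_cases htt : D.top a = D.top b
      -- Strands with a common tip have distance tending to zero, so compactness fails. Both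
      -- relative positions are `v / 2` times their values at `v = 2`, however, and the bound at `2`
      -- scales.
      · obtain ⟨B, hB, hB'⟩ := key _ _ hmid
        refine ⟨B, hB, fun v hv t ht => ?_⟩
        refine ratio_bound_of_homogeneous (by linarith [hv.1] : (0 : ℝ) ≤ v / 2) ?_ ?_
          (hB' 2 ⟨le_rfl, by linarith [(Nat.cast_nonneg D.K : (0 : ℝ) ≤ D.K)]⟩ t ht)
        · rw [smul_vec, (top_eq a b htt v hv).1, (top_eq a b htt v hv).2, mul_zero]
        · have h2 : (2 : ℝ) ∈ Icc (0 : ℝ) 2 := by norm_num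
          rw [smul_vec, D.rel_top_of_eq htt hv, D.rel_top_of_eq htt h2, (D.x_y_top a hv).2,
            (D.x_y_top b hv).2, (D.x_y_top a h2).2, (D.x_y_top b h2).2]
          simp
      · refine key _ _ fun v hv t ht => ?_
        rcases lt_or_gt_of_ne htt with h1 | h1
        · rintro ⟨e, -⟩
          have e1 := top_ne a b h1 v hv
          have e2 := D.rel_top_of_ne h1 hv
          linarith [interpolation_neg ht (sub_neg.2 e1) e2]
        · rintro ⟨e, -⟩
          have e1 := top_ne b a h1 v hv
          have e2 := D.rel_top_of_ne h1 hv
          linarith [interpolation_neg ht (sub_neg.2 e1) e2]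
    have hbot : ∃ B : ℝ, 0 ≤ B ∧ ∀ v ∈ Icc (2 * D.K + 2 : ℝ) (2 * D.K + 4),
        ∀ t ∈ Icc (0 : ℝ) 1,
          ‖(![D.x a v - D.x b v, D.y a v - D.y b v, 0] : Space) -
            ![X a v - X b v, Y a v - Y b v, 0]‖ ≤
          B * ‖(1 - t) • (![X a v - X b v, Y a v - Y b v, 0] : Space) +
            t • ![D.x a v - D.x b v, D.y a v - D.y b v, 0]‖ := by
      by_cases htt : D.bot a = D.bot b
      · obtain ⟨B, hB, hB'⟩ := key _ _ hmid
        refine ⟨B, hB, fun v hv t ht => ?_⟩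
        refine ratio_bound_of_homogeneous
          (by linarith [hv.2] : (0 : ℝ) ≤ 1 - (v - (2 * D.K + 2)) / 2) ?_ ?_
          (hB' (2 * D.K + 2) ⟨by linarith [(Nat.cast_nonneg D.K : (0 : ℝ) ≤ D.K)], le_rfl⟩ t ht)
        · rw [smul_vec, (bot_eq a b htt v hv).1, (bot_eq a b htt v hv).2, mul_zero]
        · have h2 : (2 * D.K + 2 : ℝ) ∈ Icc (2 * D.K + 2 : ℝ) (2 * D.K + 4) :=
            ⟨le_rfl, by linarith⟩
          rw [smul_vec, D.rel_bot_of_eq htt hv, D.rel_bot_of_eq htt h2, (D.x_y_bot a hv).2,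
            (D.x_y_bot b hv).2, (D.x_y_bot a h2).2, (D.x_y_bot b h2).2]
          simp
      · refine key _ _ fun v hv t ht => ?_
        rcases lt_or_gt_of_ne htt with h1 | h1
        · rintro ⟨e, -⟩
          have e1 := bot_ne a b h1 v hv
          have e2 := D.rel_bot_of_ne h1 hv
          linarith [interpolation_neg ht (sub_neg.2 e1) e2]
        · rintro ⟨e, -⟩
          have e1 := bot_ne b a h1 v hv
          have e2 := D.rel_bot_of_ne h1 hv
          linarith [interpolation_neg ht (sub_neg.2 e1) e2]
    obtain ⟨B₁, hB₁, h₁⟩ := htop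
    obtain ⟨B₂, hB₂, h₂⟩ := key _ _ hmid
    obtain ⟨B₃, hB₃, h₃⟩ := hbot
    refine ⟨B₁ + B₂ + B₃, by linarith, fun v hv t ht => ?_⟩
    rw [show (![D.x a v - D.x b v - (X a v - X b v), D.y a v - D.y b v - (Y a v - Y b v), 0] :
      Space) = ![D.x a v - D.x b v, D.y a v - D.y b v, 0] - ![X a v - X b v, Y a v - Y b v, 0] by
        rw [vec_sub, sub_zero]]
    have hB₁' : B₁ ≤ B₁ + B₂ + B₃ := by linarith
    have hB₂' : B₂ ≤ B₁ + B₂ + B₃ := by linarith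
    have hB₃' : B₃ ≤ B₁ + B₂ + B₃ := by linarith
    rcases le_total v 2 with hv2 | hv2
    · exact (h₁ v ⟨hv.1, hv2⟩ t ht).trans (mul_le_mul_of_nonneg_right hB₁' (norm_nonneg _))
    · rcases le_total v (2 * D.K + 2) with hv3 | hv3
      · exact (h₂ v ⟨hv2, hv3⟩ t ht).trans (mul_le_mul_of_nonneg_right hB₂' (norm_nonneg _))
      · exact (h₃ v ⟨hv3, hv.2⟩ t ht).trans (mul_le_mul_of_nonneg_right hB₃' (norm_nonneg _))
  choose B hB hB' using hpair
  cases nonempty_fintype A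
  have hL : ∀ (K : ℝ≥0) (f : ℝ → ℝ), LipschitzWith K f → (K : ℝ) ≤ C + C' + 1 →
      ∀ v w, |f v - f w| ≤ ((C : ℝ) + C' + 1) * |v - w| := by
    intro K f hf hK v w
    have := hf.dist_le_mul v w
    rw [Real.dist_eq, Real.dist_eq] at this
    exact this.trans (mul_le_mul_of_nonneg_right hK (abs_nonneg _))
  have hC : (C : ℝ) ≤ C + C' + 1 := by linarith [C'.2]
  have hC' : (C' : ℝ) ≤ C + C' + 1 := by linarith [C.2]
  -- The constant `min μ (1 / 2)` is the smaller rate of descent: at least `μ` for the given strands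
  -- and `1 / 2` for those of the diagram.
  refine exists_isotopicToId_of_strands (fun a v => ![X a v, Y a v, h v]) D.pt
    (Icc (0 : ℝ) (2 * D.K + 4)) (C + C' + 1) (min μ (1 / 2)) (∑ a, ∑ b, B a b)
    (lt_min hμ (by norm_num)) (by positivity) ?_ ?_ ?_ ?_
  · intro a v _ w _
    rw [vec_sub]
    exact norm_vec_le (hL C _ (hX a) hC v w) (hL C _ (hY a) hC v w) (hL C _ hh hC v w)
  · intro a v _ w _
    unfold pt
    rw [vec_sub]
    refine norm_vec_le (hL C' _ (hx a) hC' v w) (hL C' _ (hy a) hC' v w) ?_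
    have : (1 - v / 2 - (1 - w / 2)) = -(1 / 2) * (v - w) := by ring
    rw [this, abs_mul]
    refine mul_le_mul_of_nonneg_right ?_ (abs_nonneg _)
    rw [abs_neg, abs_of_pos (by norm_num)]
    linarith [C.2, C'.2]
  · intro t ht a b v _ w _
    -- Both height functions are the same for all strands and decrease, so the third coordinate
    -- alone separates different parameters during the motion.
    refine le_trans ?_ (norm_le_pi_norm _ 2)
    have e : ((1 - t) • (![X a v, Y a v, h v] : Space) + t • D.pt a v -
        ((1 - t) • (![X b w, Y b w, h w] : Space) + t • D.pt b w)) 2 =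
        (1 - t) * (h v - h w) + t * (1 / 2 * (w - v)) := by
      simp [pt]
      ring
    rw [e, Real.norm_eq_abs]
    have main : ∀ v w : ℝ, v ≤ w → min μ (1 / 2) * (w - v) ≤
        (1 - t) * (h v - h w) + t * (1 / 2 * (w - v)) := by
      intro v w hvw
      have h1 := hdec v w hvw
      have h2 : min μ (1 / 2) * (w - v) ≤ h v - h w :=
        (mul_le_mul_of_nonneg_right (min_le_left _ _) (by linarith)).trans h1
      have h3 : min μ (1 / 2) * (w - v) ≤ 1 / 2 * (w - v) :=
        mul_le_mul_of_nonneg_right (min_le_right _ _) (by linarith)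
      have h4 := mul_le_mul_of_nonneg_left h2 (sub_nonneg.2 ht.2)
      have h5 := mul_le_mul_of_nonneg_left h3 ht.1
      linarith
    rcases le_total v w with hvw | hvw
    · rw [abs_sub_comm, abs_of_nonneg (by linarith)]
      exact (main v w hvw).trans (le_abs_self _)
    · rw [abs_of_nonneg (by linarith)]
      refine (main w v hvw).trans ?_
      rw [← abs_neg]
      refine le_trans (le_of_eq ?_) (le_abs_self _)
      ring
  · intro t ht a b v hv
    refine (hB' a b v hv t ht).trans (mul_le_mul_of_nonneg_right ?_ (norm_nonneg _))
    exact (Finset.single_le_sum (fun b _ => hB a b) (Finset.mem_univ b)).trans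
      (Finset.single_le_sum (f := fun a => ∑ b, B a b)
        (fun a _ => Finset.sum_nonneg fun b _ => hB a b) (Finset.mem_univ a))

end PlatData

/-! ### Closed polygons from lists of edges -/

section Paths

variable {δ : Type*} (s e : δ → Space)

/-- A list of oriented edges (with sources `s` and targets `e`) is a path. -/
def IsPath : List δ → Space → Space → Prop
  | [], p, q => p = q
  | d :: L, p, q => s d = p ∧ IsPath L (e d) q

variable {s e}

theorem IsPath.append {L L' : List δ} {p q r : Space} (h : IsPath s e L p q)
    (h' : IsPath s e L' q r) : IsPath s e (L ++ L') p r := by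
  induction L generalizing p with
  | nil =>
    change p = q at h
    rw [h]
    exact h'
  | cons d L ih => exact ⟨h.1, ih h.2⟩

theorem IsPath.flatMap_range {f : ℕ → List δ} {X : ℕ → Space} (K : ℕ)
    (h : ∀ k < K, IsPath s e (f k) (X k) (X (k + 1))) :
    IsPath s e ((List.range K).flatMap f) (X 0) (X K) := by
  induction K with
  | zero => exact rfl
  | succ K ih =>
    rw [List.range_succ, List.flatMap_append]
    refine (ih fun k hk => h k (by omega)).append ?_
    simpa using h K (by omega)

theorem IsPath.reverse {δ' : Type*} {s' e' : δ' → Space} {f : δ → δ'} (hs : ∀ d, s' (f d) = e d)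
    (he : ∀ d, e' (f d) = s d) {L : List δ} {p q : Space} (h : IsPath s e L p q) :
    IsPath s' e' (L.reverse.map f) q p := by
  induction L generalizing p with
  | nil =>
    change p = q at h
    exact h.symm
  | cons d L ih =>
    rw [List.reverse_cons, List.map_append]
    refine (ih h.2).append ?_
    exact ⟨hs d, (he d).trans h.1⟩

theorem IsPath.map {δ' : Type*} {s' e' : δ' → Space} {f : δ → δ'} (hs : ∀ d, s' (f d) = s d)
    (he : ∀ d, e' (f d) = e d) {L : List δ} {p q : Space} (h : IsPath s e L p q) :
    IsPath s' e' (L.map f) p q := by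
  induction L generalizing p with
  | nil => exact h
  | cons d L ih =>
    refine ⟨(hs d).trans h.1, ?_⟩
    rw [he]
    exact ih h.2

theorem IsPath.getElem {L : List δ} {p q : Space} (h : IsPath s e L p q) :
    (∀ h0 : 0 < L.length, s L[0] = p) ∧
    ∀ k (hk : k < L.length), (∀ hk' : k + 1 < L.length, s L[k + 1] = e L[k]) ∧
      (k + 1 = L.length → e L[k] = q) := by
  induction L generalizing p with
  | nil => exact ⟨fun h0 => absurd h0 (by simp), fun k hk => absurd hk (by simp)⟩
  | cons d L ih =>
    obtain ⟨ih0, ih1⟩ := ih h.2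
    refine ⟨fun _ => h.1, fun k hk => ?_⟩
    cases k with
    | zero =>
      refine ⟨fun hk' => ih0 (by simpa using hk'), fun hk' => ?_⟩
      have : L = [] := List.length_eq_zero_iff.1 (by simpa using hk'.symm)
      subst this
      exact h.2
    | succ k =>
      have := ih1 k (by simpa using hk)
      exact ⟨fun hk' => this.1 (by simpa using hk'), fun hk' => this.2 (by simpa using hk')⟩

/-- A closed path without self-intersections is a closed polygon. -/
theorem exists_closedPolygon {L : List δ} {p : Space} (h : IsPath s e L p p) (hne : L ≠ [])
    (hnd : L.Nodup) (hdis : ∀ d ∈ L, ∀ d' ∈ L, ∀ r ∈ Ico (0 : ℝ) 1, ∀ r' ∈ Ico (0 : ℝ) 1,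
      AffineMap.lineMap (s d) (e d) r = AffineMap.lineMap (s d') (e d') r' → d = d' ∧ r = r') :
    ∃ P : ClosedPolygon, P.m = L.length ∧
      ∀ k (hk : k < L.length), P.v k = s L[k] ∧ P.v (k + 1) = e L[k] := by
  obtain ⟨h0, h1⟩ := h.getElem
  have hpos : 0 < L.length := List.length_pos_iff.2 hne
  -- The default value is the common start and end point `p`; at index `L.length` it closes the
  -- polygon.
  let v : ℕ → Space := fun k => if hk : k < L.length then s L[k] else p
  have hv : ∀ k (hk : k < L.length), v k = s L[k] ∧ v (k + 1) = e L[k] := by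
    intro k hk
    refine ⟨dif_pos hk, ?_⟩
    by_cases hk' : k + 1 < L.length
    · rw [← (h1 k hk).1 hk']
      exact dif_pos hk'
    · rw [(h1 k hk).2 (by omega)]
      exact dif_neg hk'
  refine ⟨⟨L.length, hpos, v, ?_, ?_⟩, rfl, hv⟩
  · rw [(hv 0 hpos).1, h0]
    exact dif_neg (lt_irrefl _)
  · intro k hk l hl r hr r' hr' heq
    rw [(hv k hk).1, (hv k hk).2, (hv l hl).1, (hv l hl).2] at heq
    obtain ⟨h2, h3⟩ := hdis _ (List.getElem_mem hk) _ (List.getElem_mem hl) r hr r' hr' heq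
    exact ⟨(hnd.getElem_inj_iff).1 h2, h3⟩

variable {P : ClosedPolygon} {L : List δ}

theorem carrier_of_list (hm : P.m = L.length)
    (hv : ∀ k (hk : k < L.length), P.v k = s L[k] ∧ P.v (k + 1) = e L[k]) :
    P.carrier = {x | ∃ d ∈ L, x ∈ segment ℝ (s d) (e d)} := by
  ext x
  constructor
  · rintro ⟨k, hk, hx⟩
    rw [hm] at hk
    rw [(hv k hk).1, (hv k hk).2] at hx
    exact ⟨_, List.getElem_mem hk, hx⟩
  · rintro ⟨d, hd, hx⟩
    obtain ⟨k, hk, rfl⟩ := List.getElem_of_mem hd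
    refine ⟨k, by rwa [hm], ?_⟩
    rwa [(hv k hk).1, (hv k hk).2]

theorem edges_of_list (hm : P.m = L.length)
    (hv : ∀ k (hk : k < L.length), P.v k = s L[k] ∧ P.v (k + 1) = e L[k]) :
    P.edges = {x | ∃ d ∈ L, x = s(s d, e d)} := by
  ext x
  constructor
  · rintro ⟨k, hk, hx⟩
    rw [hm] at hk
    rw [(hv k hk).1, (hv k hk).2] at hx
    exact ⟨_, List.getElem_mem hk, hx⟩
  · rintro ⟨d, hd, hx⟩
    obtain ⟨k, hk, rfl⟩ := List.getElem_of_mem hd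
    refine ⟨k, by rwa [hm], ?_⟩
    rwa [(hv k hk).1, (hv k hk).2]

/-- Exchanging the segments swaps two rows of the determinant and negates the third, and the two
signs cancel. -/
theorem crossingSign_comm (a b c d : Space) : crossingSign a b c d = crossingSign c d a b := by
  have hdet : Matrix.det (Matrix.of ![b - a, d - c, a - c]) =
      Matrix.det (Matrix.of ![d - c, b - a, c - a]) := by
    rw [Matrix.det_fin_three, Matrix.det_fin_three]
    simp
    ring
  unfold crossingSign
  rw [hdet]
  congr 1
  apply propext
  constructor
  · rintro ⟨s, hs, t, ht, h1, h2⟩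
    exact ⟨t, ht, s, hs, h1.symm, h2.symm⟩
  · rintro ⟨s, hs, t, ht, h1, h2⟩
    exact ⟨t, ht, s, hs, h1.symm, h2.symm⟩

theorem crossingSign_self (a b : Space) : crossingSign a b a b = 0 := by
  have hdet : Matrix.det (Matrix.of ![b - a, b - a, a - a]) = 0 := by
    rw [Matrix.det_fin_three]
    simp
  unfold crossingSign
  rw [hdet]
  simp

theorem two_mul_sum_lower_triangle (f : ℕ → ℕ → ℤ) (hf : ∀ k l, f k l = f l k)
    (h0 : ∀ k, f k k = 0) (m : ℕ) :
    2 * ∑ k ∈ Finset.range m, ∑ l ∈ Finset.range k, f k l =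
      ∑ k ∈ Finset.range m, ∑ l ∈ Finset.range m, f k l := by
  induction m with
  | zero => simp
  | succ m ih =>
    simp only [Finset.sum_range_succ, mul_add, ih, h0, Finset.sum_add_distrib, add_zero]
    rw [Finset.sum_congr rfl fun l _ => hf m l]
    ring

/-- Twice the writhe is a sum over all ordered pairs of edges. The numbering of the edges no longer
matters, so the sum can be regrouped by layers. -/
theorem two_mul_writhe_of_list (hm : P.m = L.length)
    (hv : ∀ k (hk : k < L.length), P.v k = s L[k] ∧ P.v (k + 1) = e L[k]) :
    2 * P.writhe = (L.map fun d => (L.map fun d' =>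
      crossingSign (s d) (e d) (s d') (e d')).sum).sum := by
  have hsum : ∀ g : δ → ℤ, ∀ g' : ℕ → ℤ, (∀ k (hk : k < L.length), g' k = g L[k]) →
      ∑ k ∈ Finset.range L.length, g' k = (L.map g).sum := by
    intro g g' hg
    rw [Finset.sum_range, ← Fin.sum_univ_fun_getElem]
    exact Finset.sum_congr rfl fun k _ => hg k k.2
  unfold ClosedPolygon.writhe
  rw [two_mul_sum_lower_triangle _ (fun k l => crossingSign_comm _ _ _ _)
    (fun k => crossingSign_self _ _), hm]
  apply hsum
  intro k hk
  apply hsum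
  intro l hl
  rw [(hv k hk).1, (hv k hk).2, (hv l hl).1, (hv l hl).2]

end Paths

theorem sum_map_flatMap_range {β : Type*} (K : ℕ) (g : ℕ → List β) (f : β → ℤ) :
    (((List.range K).flatMap g).map f).sum = ∑ k ∈ Finset.range K, ((g k).map f).sum := by
  induction K with
  | zero => simp
  | succ K ih =>
    rw [List.range_succ, List.flatMap_append, List.map_append, List.sum_append, ih,
      Finset.sum_range_succ]
    simp

/-! ### The edges of the strands of a closed diagram -/

namespace PlatData

variable {A : Type*} {n : ℕ} (D : PlatData A n)

/-- The strand `a` is the one that is drawn with an additional vertex in the letter `k`. -/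
def IsBent (a : A) (k : ℕ) : Prop :=
  ∃ i, (D.l k).1 = Gen.sigma i ∧ (D.ρ k a).val = i.val

open Classical in
/-- The edges of the strand `a` in the layer `j` (the arcs being the first and the last layer), as
intervals of the parameter. -/
def layerDarts (a : A) (j : ℕ) : List (ℕ × ℕ) :=
  if 0 < j ∧ j ≤ D.K ∧ D.IsBent a (j - 1) then [(2 * j, 2 * j + 1), (2 * j + 1, 2 * j + 2)]
  else [(2 * j, 2 * j + 2)]

/-- The edges of the strand `a`, as intervals of the parameter. -/
def strandDarts (a : A) : List (ℕ × ℕ) :=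
  (List.range (D.K + 2)).flatMap (D.layerDarts a)

variable {D}

theorem layerDarts_bounds {a : A} {j : ℕ} {c : ℕ × ℕ} (hc : c ∈ D.layerDarts a j) :
    2 * j ≤ c.1 ∧ c.1 < c.2 ∧ c.2 ≤ 2 * j + 2 := by
  unfold layerDarts at hc
  split_ifs at hc <;> simp only [List.mem_cons, List.not_mem_nil, or_false] at hc
  · rcases hc with rfl | rfl <;> simp
  · subst hc; simp

theorem layerDarts_disjoint {a : A} {j : ℕ} {c c' : ℕ × ℕ} (hc : c ∈ D.layerDarts a j)
    (hc' : c' ∈ D.layerDarts a j) : c = c' ∨ c.2 ≤ c'.1 ∨ c'.2 ≤ c.1 := by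
  unfold layerDarts at hc hc'
  split_ifs at hc hc' <;> simp only [List.mem_cons, List.not_mem_nil, or_false] at hc hc'
  · rcases hc with rfl | rfl <;> rcases hc' with rfl | rfl <;> simp
  · subst hc hc'; simp

theorem layerDarts_nodup (a : A) (j : ℕ) : (D.layerDarts a j).Nodup := by
  unfold layerDarts
  split_ifs <;> simp

theorem mem_strandDarts {a : A} {c : ℕ × ℕ} :
    c ∈ D.strandDarts a ↔ ∃ j < D.K + 2, c ∈ D.layerDarts a j := by
  simp [strandDarts]

theorem strandDarts_bounds {a : A} {c : ℕ × ℕ} (hc : c ∈ D.strandDarts a) :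
    c.1 < c.2 ∧ c.2 ≤ 2 * D.K + 4 := by
  obtain ⟨j, hj, hc⟩ := mem_strandDarts.1 hc
  have := layerDarts_bounds hc
  omega

theorem strandDarts_disjoint {a : A} {c c' : ℕ × ℕ} (hc : c ∈ D.strandDarts a)
    (hc' : c' ∈ D.strandDarts a) : c = c' ∨ c.2 ≤ c'.1 ∨ c'.2 ≤ c.1 := by
  obtain ⟨j, hj, hc⟩ := mem_strandDarts.1 hc
  obtain ⟨j', hj', hc'⟩ := mem_strandDarts.1 hc'
  by_cases h : j = j'
  · subst h
    exact layerDarts_disjoint hc hc'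
  · have h1 := layerDarts_bounds hc
    have h2 := layerDarts_bounds hc'
    right
    omega

theorem strandDarts_nodup (a : A) : (D.strandDarts a).Nodup := by
  unfold strandDarts
  rw [List.nodup_flatMap]
  refine ⟨fun j _ => layerDarts_nodup a j, ?_⟩
  refine List.nodup_range.pairwise_of_forall_ne fun j _ j' _ h => ?_
  intro c hc hc'
  have h1 := layerDarts_bounds hc
  have h2 := layerDarts_bounds hc'
  omega

theorem exists_layerDart (a : A) {j : ℕ} {v : ℝ} (hv : v ∈ Icc (2 * j : ℝ) (2 * j + 2)) :
    ∃ c ∈ D.layerDarts a j, v ∈ Icc (c.1 : ℝ) c.2 := by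
  unfold layerDarts
  split_ifs
  · rcases le_total v (2 * j + 1) with h | h
    · exact ⟨_, List.mem_cons_self, by push_cast; exact ⟨hv.1, h⟩⟩
    · exact ⟨_, List.mem_cons_of_mem _ List.mem_cons_self, by push_cast; exact ⟨h, hv.2⟩⟩
  · exact ⟨_, List.mem_cons_self, by push_cast; exact hv⟩

theorem exists_strandDart (a : A) {v : ℝ} (hv : v ∈ Icc (0 : ℝ) (2 * D.K + 4)) :
    ∃ c ∈ D.strandDarts a, v ∈ Icc (c.1 : ℝ) c.2 := by
  have main : ∃ j < D.K + 2, v ∈ Icc (2 * j : ℝ) (2 * j + 2) := by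
    rcases eq_or_lt_of_le hv.2 with h | h
    · refine ⟨D.K + 1, by omega, ?_⟩
      constructor <;> push_cast <;> linarith
    · have hn : 0 ≤ v / 2 := by linarith [hv.1]
      refine ⟨⌊v / 2⌋₊, ?_, ?_⟩
      · rw [Nat.floor_lt hn]
        push_cast
        linarith
      · have e1 := Nat.floor_le hn
        have e2 := Nat.lt_floor_add_one (v / 2)
        constructor <;> linarith
  obtain ⟨j, hj, hv⟩ := main
  obtain ⟨c, hc, hv⟩ := D.exists_layerDart a hv
  exact ⟨c, mem_strandDarts.2 ⟨j, hj, hc⟩, hv⟩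

/-- Of the two strands that cross in a letter only the one from position `i` has a corner. All other
middle points lie halfway on a straight edge, so each such strand contributes one edge to the layer.
-/
theorem mid_of_not_isBent {a : A} {k : ℕ} (h : ¬ D.IsBent a k) :
    midX (D.l k) (D.ρ k a) = ((D.ρ k a).val + (D.ρ (k + 1) a).val) / 2 ∧
      midY (D.l k) (D.ρ k a) = 0 := by
  have hs := D.step k
  unfold IsBent at h
  unfold LetterStep at hs
  unfold midX midY
  cases hl : (D.l k).1 with
  | twist j =>
    rw [hl] at hs
    change D.ρ (k + 1) = D.ρ k at hs
    rw [hs]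
    exact ⟨by ring, rfl⟩
  | sigma i =>
    rw [hl] at hs
    change D.ρ (k + 1) = (D.ρ k).trans (adjSwap i) at hs
    have h1 : (D.ρ k a).val ≠ i.val := fun h' => h ⟨i, hl, h'⟩
    dsimp only
    rw [hs, Equiv.trans_apply, adjSwap_val, if_neg h1, if_neg h1, if_neg h1]
    refine ⟨?_, rfl⟩
    split_ifs with h2
    · rw [h2]; push_cast; ring
    · ring

/-- The strands are affine on each edge. -/
theorem affine_on_layerDart {a : A} {j : ℕ} (hj : j < D.K + 2) {c : ℕ × ℕ}
    (hc : c ∈ D.layerDarts a j) : ∃ α β γ δ : ℝ, ∀ v ∈ Icc (c.1 : ℝ) c.2,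
      D.x a v = α + β * v ∧ D.y a v = γ + δ * v := by
  unfold layerDarts at hc
  split_ifs at hc with h <;> simp only [List.mem_cons, List.not_mem_nil, or_false] at hc
  · obtain ⟨h0, hK, hb⟩ := h
    obtain ⟨k, rfl⟩ : ∃ k, j = k + 1 := ⟨j - 1, by omega⟩
    have hk : k < D.K := by omega
    rcases hc with rfl | rfl
    · refine ⟨(D.ρ k a).val - (2 * k + 2) * (midX (D.l k) (D.ρ k a) - (D.ρ k a).val),
        midX (D.l k) (D.ρ k a) - (D.ρ k a).val,
        -(2 * k + 2) * midY (D.l k) (D.ρ k a), midY (D.l k) (D.ρ k a), fun v hv => ?_⟩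
      push_cast at hv
      obtain ⟨h1, h2⟩ := D.x_y_fst a hk (v := v) ⟨by linarith [hv.1], by linarith [hv.2]⟩
      rw [h1, h2]
      constructor <;> ring
    · refine ⟨midX (D.l k) (D.ρ k a) -
          (2 * k + 3) * ((D.ρ (k + 1) a).val - midX (D.l k) (D.ρ k a)),
        (D.ρ (k + 1) a).val - midX (D.l k) (D.ρ k a),
        (2 * k + 4) * midY (D.l k) (D.ρ k a), -midY (D.l k) (D.ρ k a), fun v hv => ?_⟩
      push_cast at hv
      obtain ⟨h1, h2⟩ := D.x_y_snd a hk (v := v) ⟨by linarith [hv.1], by linarith [hv.2]⟩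
      rw [h1, h2]
      constructor <;> ring
  · subst hc
    push_cast
    rcases Nat.eq_zero_or_pos j with rfl | h0
    · refine ⟨2 * D.top a + 1 / 2, ((D.ρ 0 a).val - (2 * D.top a + 1 / 2)) / 2, 0, 0,
        fun v hv => ?_⟩
      obtain ⟨h1, h2⟩ := D.x_y_top a (v := v) (by simpa using hv)
      rw [h1, h2]
      constructor <;> ring
    · rcases Nat.lt_or_ge D.K j with hK | hK
      · have : j = D.K + 1 := by omega
        subst this
        refine ⟨(D.ρ D.K a).val - (D.K + 1) * (2 * D.bot a + 1 / 2 - (D.ρ D.K a).val),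
          (2 * D.bot a + 1 / 2 - (D.ρ D.K a).val) / 2, 0, 0, fun v hv => ?_⟩
        push_cast at hv
        obtain ⟨h1, h2⟩ := D.x_y_bot a (v := v) ⟨by linarith [hv.1], by linarith [hv.2]⟩
        rw [h1, h2]
        constructor <;> ring
      · obtain ⟨k, rfl⟩ : ∃ k, j = k + 1 := ⟨j - 1, by omega⟩
        have hk : k < D.K := by omega
        have hb : ¬ D.IsBent a k := fun hb => h ⟨h0, hK, hb⟩
        obtain ⟨m1, m2⟩ := mid_of_not_isBent hb
        refine ⟨(D.ρ k a).val - (k + 1) * ((D.ρ (k + 1) a).val - (D.ρ k a).val),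
          ((D.ρ (k + 1) a).val - (D.ρ k a).val) / 2, 0, 0, fun v hv => ?_⟩
        push_cast at hv
        rcases le_total v (2 * k + 3) with h3 | h3
        · obtain ⟨h1, h2⟩ := D.x_y_fst a hk (v := v) ⟨by linarith [hv.1], h3⟩
          rw [h1, h2, m1, m2]
          constructor <;> ring
        · obtain ⟨h1, h2⟩ := D.x_y_snd a hk (v := v) ⟨h3, by linarith [hv.2]⟩
          rw [h1, h2, m1, m2]
          constructor <;> ring

theorem pt_lineMap {a : A} {c : ℕ × ℕ} (hc : c ∈ D.strandDarts a) {r : ℝ}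
    (hr : r ∈ Icc (0 : ℝ) 1) : D.pt a (AffineMap.lineMap (c.1 : ℝ) (c.2 : ℝ) r) =
      AffineMap.lineMap (D.pt a c.1) (D.pt a c.2) r := by
  obtain ⟨j, hj, hcj⟩ := mem_strandDarts.1 hc
  obtain ⟨α, β, γ, δ, h⟩ := affine_on_layerDart hj hcj
  have hlt : (c.1 : ℝ) ≤ c.2 := by exact_mod_cast (strandDarts_bounds hc).1.le
  have h1 := h c.1 ⟨le_rfl, hlt⟩
  have h2 := h c.2 ⟨hlt, le_rfl⟩
  have h3 := h (AffineMap.lineMap (c.1 : ℝ) (c.2 : ℝ) r) (by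
    rw [AffineMap.lineMap_apply_module', smul_eq_mul]
    constructor <;> nlinarith [hr.1, hr.2])
  rw [AffineMap.lineMap_apply_module, smul_eq_mul, smul_eq_mul] at h3 ⊢
  rw [AffineMap.lineMap_apply_module]
  unfold pt
  rw [h1.1, h1.2, h2.1, h2.2, h3.1, h3.2, smul_vec, smul_vec]
  ext i
  fin_cases i <;> simp <;> ring

theorem pt_lineMap_swap {a : A} {c : ℕ × ℕ} (hc : c.swap ∈ D.strandDarts a) {r : ℝ}
    (hr : r ∈ Icc (0 : ℝ) 1) : D.pt a (AffineMap.lineMap (c.1 : ℝ) (c.2 : ℝ) r) =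
      AffineMap.lineMap (D.pt a c.1) (D.pt a c.2) r := by
  have := pt_lineMap hc (r := 1 - r) ⟨by linarith [hr.2], by linarith [hr.1]⟩
  rwa [Prod.fst_swap, Prod.snd_swap, AffineMap.lineMap_apply_one_sub,
    AffineMap.lineMap_apply_one_sub] at this

-- The height determines the parameter, and at equal parameters `strands_disjoint` leaves only the
-- tips.
variable (D) in
theorem pt_eq_pt (hK : 0 < D.K) {a b : A} {v w : ℝ} (hv : v ∈ Icc (0 : ℝ) (2 * D.K + 4))
    (h : D.pt a v = D.pt b w) : v = w ∧ (a = b ∨ v = 0 ∧ D.top a = D.top b ∨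
      v = 2 * D.K + 4 ∧ D.bot a = D.bot b) := by
  have h2 := congrFun h 2
  have hvw : v = w := by
    simp only [pt, Matrix.cons_val] at h2
    linarith
  subst hvw
  refine ⟨rfl, ?_⟩
  by_contra! hne
  have h0 := congrFun h 0
  have h1 := congrFun h 1
  simp only [pt, Matrix.cons_val] at h0 h1
  rcases D.strands_disjoint hK hne.1 hv hne.2.1 hne.2.2 with h | h
  · exact h (sub_eq_zero.2 h0)
  · exact h (sub_eq_zero.2 h1)

variable (D) in
theorem pt_zero_eq {a b : A} (h : D.top a = D.top b) : D.pt a 0 = D.pt b 0 := by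
  have h2 : (0 : ℝ) ∈ Icc (0 : ℝ) 2 := by norm_num
  unfold pt
  rw [(D.x_y_top a h2).1, (D.x_y_top b h2).1, (D.x_y_top a h2).2, (D.x_y_top b h2).2, h]
  simp

variable (D) in
theorem pt_last_eq {a b : A} (h : D.bot a = D.bot b) :
    D.pt a (2 * D.K + 4) = D.pt b (2 * D.K + 4) := by
  have h2 : (2 * D.K + 4 : ℝ) ∈ Icc (2 * D.K + 2 : ℝ) (2 * D.K + 4) := by
    constructor <;> linarith
  unfold pt
  rw [(D.x_y_bot a h2).1, (D.x_y_bot b h2).1, (D.x_y_bot a h2).2, (D.x_y_bot b h2).2, h]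
  congr 1
  ring

variable (D) in
theorem isPath_strandDarts (a : A) : IsPath (fun c : ℕ × ℕ => D.pt a c.1)
    (fun c : ℕ × ℕ => D.pt a c.2) (D.strandDarts a) (D.pt a 0) (D.pt a (2 * D.K + 4)) := by
  have := IsPath.flatMap_range (s := fun c : ℕ × ℕ => D.pt a c.1)
    (e := fun c : ℕ × ℕ => D.pt a c.2) (f := D.layerDarts a)
    (X := fun j => D.pt a ((2 * j : ℕ) : ℝ)) (D.K + 2) (by
      intro j _
      unfold layerDarts
      split_ifs
      · exact ⟨rfl, rfl, rfl⟩
      · exact ⟨rfl, rfl⟩)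
  have e0 : ((2 * 0 : ℕ) : ℝ) = 0 := by simp
  have e1 : ((2 * (D.K + 2) : ℕ) : ℝ) = 2 * D.K + 4 := by push_cast; ring
  rwa [e0, e1] at this

end PlatData

/-! ### The components of a closed diagram -/

section Components

variable {c : ℕ} {m : Fin c → ℕ}

/-- The vertices of a family of cyclic graphs with `m i` vertices. -/
abbrev Vertex {c : ℕ} (m : Fin c → ℕ) : Type := Σ i, Fin (m i)

variable [∀ i, NeZero (m i)]

/-- The `k`-th vertex of a component, counted cyclically. -/
def vertex (m : Fin c → ℕ) [∀ i, NeZero (m i)] (i : Fin c) (k : ℕ) : Vertex m :=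
  ⟨i, Fin.ofNat (m i) k⟩

/-- The next vertex on the same component. -/
def nextVertex (k : Vertex m) : Vertex m := vertex m k.1 (k.2.val + 1)

theorem nextVertex_vertex (i : Fin c) (k : ℕ) :
    nextVertex (vertex m i k) = vertex m i (k + 1) := by
  simp [nextVertex, vertex, Fin.ofNat]

theorem vertex_val (k : Vertex m) : vertex m k.1 k.2.val = k := by
  obtain ⟨i, k⟩ := k
  simp [vertex, Fin.ofNat, Nat.mod_eq_of_lt k.2]

theorem vertex_length (i : Fin c) : vertex m i (m i) = vertex m i 0 := by
  simp [vertex, Fin.ofNat]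

theorem vertex_inj {i : Fin c} {k l : ℕ} (hk : k < m i) (hl : l < m i)
    (h : vertex m i k = vertex m i l) : k = l := by
  simpa [vertex, Fin.ext_iff, Fin.ofNat, Nat.mod_eq_of_lt hk, Nat.mod_eq_of_lt hl] using h

theorem nextVertex_injective : Function.Injective (nextVertex (m := m)) := by
  rintro ⟨i, k⟩ ⟨i', l⟩ h
  have hi : i = i' := congrArg Sigma.fst h
  subst hi
  have h' : (k.val + 1) % m i = (l.val + 1) % m i := by
    simpa [nextVertex, vertex, Fin.ext_iff, Fin.ofNat] using h
  have h2 : k.val % m i = l.val % m i := Nat.ModEq.add_right_cancel' 1 h'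
  rw [Nat.mod_eq_of_lt k.2, Nat.mod_eq_of_lt l.2] at h2
  rw [Fin.ext h2]

/-- The strands of a closed diagram close up to a family of cyclic graphs: the strands
`(k, false)` and `(k, true)` run down from the vertex `k` and up to the next vertex. -/
structure PlatData.Closes {n : ℕ} (D : PlatData (Vertex m × Bool) n) : Prop where
  pos : 0 < D.K
  top_true : ∀ k, D.top (k, true) = D.top (nextVertex k, false)
  bot_true : ∀ k, D.bot (k, true) = D.bot (k, false)
  top_injective : ∀ k l, D.top (k, false) = D.top (l, false) → k = l
  bot_injective : ∀ k l, D.bot (k, false) = D.bot (l, false) → k = l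

namespace PlatData

variable {n : ℕ} (D : PlatData (Vertex m × Bool) n)

/-- The oriented edges of the component `i`. -/
def compDarts (i : Fin c) : List ((Vertex m × Bool) × ℕ × ℕ) :=
  (List.range (m i)).flatMap fun k =>
    (D.strandDarts (vertex m i k, false)).map (fun d => ((vertex m i k, false), d)) ++
    (D.strandDarts (vertex m i k, true)).reverse.map (fun d => ((vertex m i k, true), d.swap))

/-- The source of an oriented edge. -/
def source (d : (Vertex m × Bool) × ℕ × ℕ) : Space := D.pt d.1 d.2.1

/-- The target of an oriented edge. -/
def target (d : (Vertex m × Bool) × ℕ × ℕ) : Space := D.pt d.1 d.2.2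

variable {D}

theorem mem_compDarts {i : Fin c} {d : (Vertex m × Bool) × ℕ × ℕ} :
    d ∈ D.compDarts i ↔ d.1.1.1 = i ∧ (d.1.2 = false ∧ d.2 ∈ D.strandDarts d.1 ∨
      d.1.2 = true ∧ d.2.swap ∈ D.strandDarts d.1) := by
  unfold compDarts
  simp only [List.mem_flatMap, List.mem_range, List.mem_append, List.mem_map, List.mem_reverse]
  constructor
  · rintro ⟨k, hk, ⟨e, he, rfl⟩ | ⟨e, he, rfl⟩⟩
    · exact ⟨rfl, Or.inl ⟨rfl, he⟩⟩
    · exact ⟨rfl, Or.inr ⟨rfl, by simpa using he⟩⟩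
  · obtain ⟨⟨k, b⟩, e⟩ := d
    rintro ⟨rfl, ⟨hb, he⟩ | ⟨hb, he⟩⟩
    · dsimp only at hb
      subst hb
      refine ⟨k.2.val, k.2.2, Or.inl ⟨e, ?_, ?_⟩⟩
      · rwa [vertex_val]
      · rw [vertex_val]
    · dsimp only at hb
      subst hb
      refine ⟨k.2.val, k.2.2, Or.inr ⟨e.swap, ?_, ?_⟩⟩
      · rwa [vertex_val]
      · rw [vertex_val, Prod.swap_swap]

theorem compDarts_nodup (i : Fin c) : (D.compDarts i).Nodup := by
  unfold compDarts
  rw [List.nodup_flatMap]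
  constructor
  · intro k _
    rw [List.nodup_append]
    refine ⟨(strandDarts_nodup _).map fun _ _ h => (Prod.ext_iff.1 h).2,
      (List.nodup_reverse.2 (strandDarts_nodup _)).map fun _ _ h =>
        Prod.swap_injective (Prod.ext_iff.1 h).2, ?_⟩
    intro d hd d' hd' h
    subst h
    simp only [List.mem_map] at hd hd'
    obtain ⟨e, -, rfl⟩ := hd
    obtain ⟨e', -, h⟩ := hd'
    simp at h
  · refine List.nodup_range.pairwise_of_forall_ne fun k hk k' hk' h => ?_
    intro d hd hd'
    apply h
    simp only [List.mem_append, List.mem_map] at hd hd'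
    have h1 : d.1.1 = vertex m i k := by
      rcases hd with ⟨e, -, rfl⟩ | ⟨e, -, rfl⟩ <;> rfl
    have h2 : d.1.1 = vertex m i k' := by
      rcases hd' with ⟨e, -, rfl⟩ | ⟨e, -, rfl⟩ <;> rfl
    exact vertex_inj (List.mem_range.1 hk) (List.mem_range.1 hk') (h1.symm.trans h2)

/-- The component runs down `(k, false)`, turns at the common lower tip, runs up `(k, true)` to the
upper tip shared with the next vertex, and returns after `m i` rounds. -/
theorem Closes.isPath_compDarts (h : D.Closes) (i : Fin c) :
    IsPath D.source D.target (D.compDarts i) (D.pt (vertex m i 0, false) 0)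
      (D.pt (vertex m i 0, false) 0) := by
  have key : ∀ k, IsPath D.source D.target
      ((D.strandDarts (vertex m i k, false)).map (fun d => ((vertex m i k, false), d)) ++
        (D.strandDarts (vertex m i k, true)).reverse.map
          (fun d => ((vertex m i k, true), d.swap)))
      (D.pt (vertex m i k, false) 0) (D.pt (vertex m i (k + 1), false) 0) := by
    intro k
    have h1 : IsPath D.source D.target
        ((D.strandDarts (vertex m i k, false)).map (fun d => ((vertex m i k, false), d))) _ _ :=
      (D.isPath_strandDarts (vertex m i k, false)).map (fun _ => rfl) (fun _ => rfl)
    have h2 : IsPath D.source D.target ((D.strandDarts (vertex m i k, true)).reverse.map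
        (fun d => ((vertex m i k, true), d.swap))) _ _ :=
      (D.isPath_strandDarts (vertex m i k, true)).reverse (fun _ => rfl) (fun _ => rfl)
    rw [D.pt_last_eq (h.bot_true _), D.pt_zero_eq (h.top_true _), nextVertex_vertex] at h2
    exact h1.append h2
  have := IsPath.flatMap_range (X := fun k => D.pt (vertex m i k, false) 0) (m i)
    fun k _ => key k
  rw [vertex_length] at this
  exact this

/-- The parameters of the points on an oriented edge, without the target. -/
theorem dart_param_mem {i : Fin c} {d : (Vertex m × Bool) × ℕ × ℕ} (hd : d ∈ D.compDarts i)
    {r : ℝ} (hr : r ∈ Icc (0 : ℝ) 1) :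
    D.pt d.1 (AffineMap.lineMap (d.2.1 : ℝ) (d.2.2 : ℝ) r) =
      AffineMap.lineMap (D.source d) (D.target d) r ∧
    AffineMap.lineMap (d.2.1 : ℝ) (d.2.2 : ℝ) r ∈ Icc (0 : ℝ) (2 * D.K + 4) := by
  have hn : ∀ k, k ≤ 2 * D.K + 4 → (k : ℝ) ∈ Icc (0 : ℝ) (2 * D.K + 4) :=
    fun k hk => ⟨Nat.cast_nonneg k, by exact_mod_cast hk⟩
  obtain ⟨-, ⟨-, he⟩ | ⟨-, he⟩⟩ := mem_compDarts.1 hd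
  · have hb := strandDarts_bounds he
    exact ⟨pt_lineMap he hr, (convex_Icc _ _).lineMap_mem (hn _ (by omega)) (hn _ (by omega)) hr⟩
  · have hb := strandDarts_bounds he
    rw [Prod.fst_swap, Prod.snd_swap] at hb
    exact ⟨pt_lineMap_swap he hr,
      (convex_Icc _ _).lineMap_mem (hn _ (by omega)) (hn _ (by omega)) hr⟩

theorem interval_unique {u w u' w' : ℕ} {r r' : ℝ} (h : u < w) (h' : u' < w')
    (hd : (u, w) = (u', w') ∨ w ≤ u' ∨ w' ≤ u) (hr : r ∈ Ico (0 : ℝ) 1) (hr' : r' ∈ Ico (0 : ℝ) 1)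
    (he : AffineMap.lineMap (u : ℝ) (w : ℝ) r = AffineMap.lineMap (u' : ℝ) (w' : ℝ) r') :
    (u, w) = (u', w') ∧ r = r' := by
  rw [AffineMap.lineMap_apply_module', AffineMap.lineMap_apply_module', smul_eq_mul,
    smul_eq_mul] at he
  have h1 : (u : ℝ) < w := by exact_mod_cast h
  have h1' : (u' : ℝ) < w' := by exact_mod_cast h'
  have e1 := mul_nonneg hr.1 (sub_nonneg.2 h1.le)
  have e2 := mul_nonneg hr'.1 (sub_nonneg.2 h1'.le)
  have e3 : r * ((w : ℝ) - u) < w - u := by nlinarith [hr.2]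
  have e4 : r' * ((w' : ℝ) - u') < w' - u' := by nlinarith [hr'.2]
  rcases hd with hd | hd | hd
  · refine ⟨hd, ?_⟩
    obtain ⟨rfl, rfl⟩ := Prod.ext_iff.1 hd
    exact mul_right_cancel₀ (sub_pos.2 h1).ne' (add_right_cancel he)
  · have : (w : ℝ) ≤ u' := by exact_mod_cast hd
    linarith
  · have : (w' : ℝ) ≤ u := by exact_mod_cast hd
    linarith

theorem interval_unique' {u w u' w' : ℕ} {r r' : ℝ} (h : u < w) (h' : u' < w')
    (hd : (u, w) = (u', w') ∨ w ≤ u' ∨ w' ≤ u) (hr : r ∈ Ico (0 : ℝ) 1) (hr' : r' ∈ Ico (0 : ℝ) 1)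
    (he : AffineMap.lineMap (w : ℝ) (u : ℝ) r = AffineMap.lineMap (w' : ℝ) (u' : ℝ) r') :
    (u, w) = (u', w') ∧ r = r' := by
  rw [AffineMap.lineMap_apply_module', AffineMap.lineMap_apply_module', smul_eq_mul,
    smul_eq_mul] at he
  have h1 : (u : ℝ) < w := by exact_mod_cast h
  have h1' : (u' : ℝ) < w' := by exact_mod_cast h'
  have e1 := mul_nonneg hr.1 (sub_nonneg.2 h1.le)
  have e2 := mul_nonneg hr'.1 (sub_nonneg.2 h1'.le)
  have e3 : r * ((w : ℝ) - u) < w - u := by nlinarith [hr.2]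
  have e4 : r' * ((w' : ℝ) - u') < w' - u' := by nlinarith [hr'.2]
  rcases hd with hd | hd | hd
  · refine ⟨hd, ?_⟩
    obtain ⟨rfl, rfl⟩ := Prod.ext_iff.1 hd
    exact mul_right_cancel₀ (sub_neg.2 h1).ne (add_right_cancel he)
  · have : (w : ℝ) ≤ u' := by exact_mod_cast hd
    linarith
  · have : (w' : ℝ) ≤ u := by exact_mod_cast hd
    linarith

/-- Points on different strands can only coincide at tips. With targets removed, an upper tip
belongs only to edges running down and a lower tip only to edges running up; the injectivity of the
tips then determines the strand. -/
theorem Closes.darts_disjoint (h : D.Closes) {i : Fin c} {d d' : (Vertex m × Bool) × ℕ × ℕ}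
    (hd : d ∈ D.compDarts i) (hd' : d' ∈ D.compDarts i) {r r' : ℝ} (hr : r ∈ Ico (0 : ℝ) 1)
    (hr' : r' ∈ Ico (0 : ℝ) 1) (he : AffineMap.lineMap (D.source d) (D.target d) r =
      AffineMap.lineMap (D.source d') (D.target d') r') : d = d' ∧ r = r' := by
  obtain ⟨p1, b1⟩ := dart_param_mem hd (Ico_subset_Icc_self hr)
  obtain ⟨p2, -⟩ := dart_param_mem hd' (Ico_subset_Icc_self hr')
  rw [← p1, ← p2] at he
  obtain ⟨hv, hab⟩ := D.pt_eq_pt h.pos b1 he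
  obtain ⟨-, h1⟩ := mem_compDarts.1 hd
  obtain ⟨-, h2⟩ := mem_compDarts.1 hd'
  obtain ⟨⟨k, b⟩, u, w⟩ := d
  obtain ⟨⟨k', b'⟩, u', w'⟩ := d'
  dsimp only [Prod.swap_prod_mk] at *
  clear p1 p2 he b1
  have hup : ∀ {u w : ℕ} {r : ℝ}, u < w → r ∈ Ico (0 : ℝ) 1 →
      AffineMap.lineMap (u : ℝ) (w : ℝ) r < (w : ℝ) ∧
        (0 : ℝ) < AffineMap.lineMap (w : ℝ) (u : ℝ) r := by
    intro u w r huw hr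
    have h1 : (u : ℝ) < w := by exact_mod_cast huw
    have h0 : (0 : ℝ) ≤ u := Nat.cast_nonneg u
    rw [AffineMap.lineMap_apply_module', AffineMap.lineMap_apply_module', smul_eq_mul,
      smul_eq_mul]
    constructor <;> nlinarith [hr.1, hr.2]
  have hkb : k = k' ∧ b = b' := by
    rcases hab with hab | ⟨h0, ht⟩ | ⟨h0, ht⟩
    · exact Prod.ext_iff.1 hab
    · rcases h1 with ⟨rfl, h1⟩ | ⟨rfl, h1⟩
      · rcases h2 with ⟨rfl, h2⟩ | ⟨rfl, h2⟩
        · exact ⟨h.top_injective _ _ ht, rfl⟩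
        · have := (hup (strandDarts_bounds h2).1 hr').2
          rw [← hv, h0] at this
          exact absurd this (lt_irrefl _)
      · have := (hup (strandDarts_bounds h1).1 hr).2
        rw [h0] at this
        exact absurd this (lt_irrefl _)
    · have hlast : ∀ {a : Vertex m × Bool} {e : ℕ × ℕ}, e ∈ D.strandDarts a →
          (e.2 : ℝ) ≤ 2 * D.K + 4 := fun he => by exact_mod_cast (strandDarts_bounds he).2
      rcases h1 with ⟨rfl, h1⟩ | ⟨rfl, h1⟩
      · have := (hup (strandDarts_bounds h1).1 hr).1
        rw [h0] at this
        exact absurd (hlast h1) (not_le.2 this)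
      · rcases h2 with ⟨rfl, h2⟩ | ⟨rfl, h2⟩
        · have := (hup (strandDarts_bounds h2).1 hr').1
          rw [← hv, h0] at this
          exact absurd (hlast h2) (not_le.2 this)
        · rw [h.bot_true, h.bot_true] at ht
          exact ⟨h.bot_injective _ _ ht, rfl⟩
  obtain ⟨rfl, rfl⟩ := hkb
  rcases h1 with ⟨rfl, h1⟩ | ⟨rfl, h1⟩
  · rcases h2 with ⟨-, h2⟩ | ⟨h2, -⟩
    · obtain ⟨e1, e2⟩ := interval_unique (strandDarts_bounds h1).1 (strandDarts_bounds h2).1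
        (strandDarts_disjoint h1 h2) hr hr' hv
      exact ⟨by rw [e1], e2⟩
    · cases h2
  · rcases h2 with ⟨h2, -⟩ | ⟨-, h2⟩
    · cases h2
    · obtain ⟨e1, e2⟩ := interval_unique' (strandDarts_bounds h1).1 (strandDarts_bounds h2).1
        (strandDarts_disjoint h1 h2) hr hr' hv
      obtain ⟨rfl, rfl⟩ := Prod.ext_iff.1 e1
      exact ⟨rfl, e2⟩

/-- The components of a closed diagram are closed polygons. -/
theorem Closes.exists_closedPolygon (h : D.Closes) (i : Fin c) : ∃ P : ClosedPolygon,
    P.m = (D.compDarts i).length ∧ ∀ k (hk : k < (D.compDarts i).length),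
      P.v k = D.source (D.compDarts i)[k] ∧ P.v (k + 1) = D.target (D.compDarts i)[k] := by
  refine FramedPlat.exists_closedPolygon (h.isPath_compDarts i) ?_ (compDarts_nodup i)
    fun d hd d' hd' r hr r' hr' he => h.darts_disjoint hd hd' hr hr' he
  obtain ⟨e, he, -⟩ := D.exists_strandDart (vertex m i 0, false) (v := 0)
    ⟨le_rfl, by positivity⟩
  exact List.ne_nil_of_mem (mem_compDarts.2 ⟨rfl, Or.inl ⟨rfl, he⟩⟩ :
    ((vertex m i 0, false), e) ∈ D.compDarts i)

/-- The polygon of the component `i` of a closed diagram. -/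
def Closes.polygon (h : D.Closes) (i : Fin c) : ClosedPolygon := (h.exists_closedPolygon i).choose

theorem Closes.carrier_polygon (h : D.Closes) (i : Fin c) : (h.polygon i).carrier =
    {x | ∃ a : Vertex m × Bool, a.1.1 = i ∧ ∃ v ∈ Icc (0 : ℝ) (2 * D.K + 4), x = D.pt a v} := by
  obtain ⟨hm, hv⟩ := (h.exists_closedPolygon i).choose_spec
  change (h.exists_closedPolygon i).choose.carrier = _
  rw [carrier_of_list hm hv]
  ext x
  constructor
  · rintro ⟨d, hd, hx⟩
    rw [segment_eq_image_lineMap] at hx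
    obtain ⟨r, hr, rfl⟩ := hx
    obtain ⟨h1, h2⟩ := dart_param_mem hd hr
    exact ⟨d.1, (mem_compDarts.1 hd).1, _, h2, h1.symm⟩
  · rintro ⟨⟨k, b⟩, rfl, v, hv, rfl⟩
    obtain ⟨e, he, hve⟩ := D.exists_strandDart (k, b) hv
    rw [← segment_eq_Icc (hve.1.trans hve.2), segment_eq_image_lineMap] at hve
    obtain ⟨r, hr, rfl⟩ := hve
    cases b with
    | false =>
      refine ⟨((k, false), e), mem_compDarts.2 ⟨rfl, Or.inl ⟨rfl, he⟩⟩, ?_⟩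
      rw [pt_lineMap he hr, segment_eq_image_lineMap]
      exact ⟨r, hr, rfl⟩
    | true =>
      refine ⟨((k, true), e.swap), mem_compDarts.2 ⟨rfl, Or.inr ⟨rfl, he⟩⟩, ?_⟩
      rw [pt_lineMap he hr, segment_symm, segment_eq_image_lineMap]
      exact ⟨r, hr, rfl⟩

theorem Closes.edges_polygon (h : D.Closes) (i : Fin c) : (h.polygon i).edges =
    {x | ∃ a : Vertex m × Bool, a.1.1 = i ∧ ∃ e ∈ D.strandDarts a,
      x = s(D.pt a e.1, D.pt a e.2)} := by
  obtain ⟨hm, hv⟩ := (h.exists_closedPolygon i).choose_spec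
  change (h.exists_closedPolygon i).choose.edges = _
  rw [edges_of_list hm hv]
  ext x
  constructor
  · rintro ⟨⟨a, e⟩, hd, rfl⟩
    obtain ⟨h1, ⟨-, h2⟩ | ⟨-, h2⟩⟩ := mem_compDarts.1 hd
    · exact ⟨a, h1, e, h2, rfl⟩
    · exact ⟨a, h1, e.swap, h2, Sym2.eq_swap⟩
  · rintro ⟨⟨k, b⟩, rfl, e, he, rfl⟩
    cases b with
    | false => exact ⟨((k, false), e), mem_compDarts.2 ⟨rfl, Or.inl ⟨rfl, he⟩⟩, rfl⟩
    | true => exact ⟨((k, true), e.swap), mem_compDarts.2 ⟨rfl, Or.inr ⟨rfl, he⟩⟩, Sym2.eq_swap⟩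

theorem Closes.two_mul_writhe_polygon (h : D.Closes) (i : Fin c) : 2 * (h.polygon i).writhe =
    ((D.compDarts i).map fun d => ((D.compDarts i).map fun d' =>
      crossingSign (D.source d) (D.target d) (D.source d') (D.target d')).sum).sum := by
  obtain ⟨hm, hv⟩ := (h.exists_closedPolygon i).choose_spec
  exact two_mul_writhe_of_list hm hv

end PlatData

end Components

/-! ### Comparison of the strands with the edges and twists of the plat diagram. -/

theorem plin_natCast (y : ℕ → ℝ) {m k : ℕ} (hk : k ≤ m) (hm : 0 < m) : plin y m k = y k := by
  rcases eq_or_lt_of_le hk with rfl | h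
  · obtain ⟨j, rfl⟩ : ∃ j, k = j + 1 := ⟨k - 1, by omega⟩
    rw [plin_eq y (Nat.lt_succ_self j) (by push_cast; linarith) (by push_cast; linarith)]
    push_cast
    ring
  · rw [plin_eq y h le_rfl (by linarith)]
    ring

namespace PlatData

section Nodes

variable {A : Type*} {n : ℕ} (D : PlatData A n)

theorem pt_natCast (a : A) {k : ℕ} (hk : k ≤ 2 * D.K + 4) :
    D.pt a k = ![D.nodeX a k, D.nodeY a k, 1 - (k : ℝ) / 2] := by
  unfold pt x y
  rw [plin_natCast _ hk (by omega), plin_natCast _ hk (by omega)]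

theorem pt_level (a : A) {k : ℕ} (hk : k ≤ D.K) :
    D.pt a ((2 * (k + 1) : ℕ) : ℝ) = node (D.ρ k a).val k := by
  rw [D.pt_natCast a (by omega), nodeY_even, show 2 * (k + 1) = 2 * k + 2 by ring,
    D.nodeX_level a hk]
  unfold node
  congr 1
  push_cast
  ring_nf

theorem pt_mid (a : A) {k : ℕ} (hk : k < D.K) {i : Fin (2 * n - 1)}
    (hi : (D.l k).1 = Gen.sigma i) (ha : (D.ρ k a).val = i.val) :
    D.pt a ((2 * (k + 1) + 1 : ℕ) : ℝ) = bend i k (D.l k).2 := by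
  rw [D.pt_natCast a (by omega), show 2 * (k + 1) + 1 = 2 * k + 3 by ring, D.nodeX_mid a hk,
    D.nodeY_mid a hk]
  unfold midX midY bend
  rw [hi]
  simp only [ha, if_true]
  congr 2
  push_cast
  ring_nf

theorem pt_top (a : A) : D.pt a ((2 * 0 : ℕ) : ℝ) = ![2 * (D.top a : ℝ) + 1 / 2, 0, 1] := by
  rw [D.pt_natCast a (by omega), nodeY_even, mul_zero, nodeX_zero]
  simp

theorem pt_bot (a : A) : D.pt a ((2 * (D.K + 1) + 2 : ℕ) : ℝ) =
    ![2 * (D.bot a : ℝ) + 1 / 2, 0, -(D.K : ℝ) - 1] := by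
  rw [D.pt_natCast a (by omega), show 2 * (D.K + 1) + 2 = 2 * (D.K + 2) by ring, nodeY_even,
    show 2 * (D.K + 2) = 2 * D.K + 4 by ring, nodeX_last]
  congr 2
  push_cast
  ring_nf

theorem layerDarts_zero (a : A) : D.layerDarts a 0 = [(2 * 0, 2 * (0 + 1))] := by
  simp [layerDarts]

theorem layerDarts_last (a : A) :
    D.layerDarts a (D.K + 1) = [(2 * (D.K + 1), 2 * (D.K + 1) + 2)] := by
  simp [layerDarts]

theorem layerDarts_of_not_isBent (a : A) {k : ℕ} (h : ¬ D.IsBent a k) :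
    D.layerDarts a (k + 1) = [(2 * (k + 1), 2 * (k + 1 + 1))] := by
  simp [layerDarts, h, mul_add]

theorem layerDarts_of_isBent (a : A) {k : ℕ} (hk : k < D.K) (h : D.IsBent a k) :
    D.layerDarts a (k + 1) =
      [(2 * (k + 1), 2 * (k + 1) + 1), (2 * (k + 1) + 1, 2 * (k + 1 + 1))] := by
  unfold layerDarts
  rw [if_pos ⟨by omega, by omega, h⟩]
  rfl

theorem top_edges : {x : Sym2 Space | ∃ a, ∃ e ∈ D.layerDarts a 0,
    x = s(D.pt a e.1, D.pt a e.2)} = topArcs n := by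
  have h0 : ∀ a, ∀ e ∈ D.layerDarts a 0, s(D.pt a e.1, D.pt a e.2) =
      s(![2 * (D.top a : ℝ) + 1 / 2, 0, 1], node (D.ρ 0 a).val 0) := by
    intro a e he
    rw [layerDarts_zero, List.mem_singleton] at he
    subst he
    rw [D.pt_top, D.pt_level a (Nat.zero_le _)]
  have hmem : ∀ a, ∃ e, e ∈ D.layerDarts a 0 := fun a =>
    ⟨_, by rw [layerDarts_zero]; exact List.mem_singleton_self _⟩
  ext x
  constructor
  · rintro ⟨a, e, he, rfl⟩
    rw [h0 a e he]
    have ha : (D.ρ 0 a).val = 2 * D.top a ∨ (D.ρ 0 a).val = 2 * D.top a + 1 := by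
      unfold top; omega
    have hlt := (D.ρ 0 a).2
    refine ⟨D.top a, by omega, ?_⟩
    rcases ha with ha | ha
    · rw [ha]; exact Or.inl Sym2.eq_swap
    · rw [ha]; exact Or.inr rfl
  · rintro ⟨p, hp, hx⟩
    rcases hx with rfl | rfl
    · let a := (D.ρ 0).symm ⟨2 * p, by omega⟩
      have ha : (D.ρ 0 a).val = 2 * p := by simp [a]
      have ht : D.top a = p := by unfold top; omega
      obtain ⟨e, he⟩ := hmem a
      refine ⟨a, e, he, ?_⟩
      rw [h0 a e he, ha, ht]
      exact Sym2.eq_swap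
    · let a := (D.ρ 0).symm ⟨2 * p + 1, by omega⟩
      have ha : (D.ρ 0 a).val = 2 * p + 1 := by simp [a]
      have ht : D.top a = p := by unfold top; omega
      obtain ⟨e, he⟩ := hmem a
      refine ⟨a, e, he, ?_⟩
      rw [h0 a e he, ha, ht]

theorem bot_edges : {x : Sym2 Space | ∃ a, ∃ e ∈ D.layerDarts a (D.K + 1),
    x = s(D.pt a e.1, D.pt a e.2)} = bottomArcs n D.K := by
  have h0 : ∀ a, ∀ e ∈ D.layerDarts a (D.K + 1), s(D.pt a e.1, D.pt a e.2) =
      s(node (D.ρ D.K a).val D.K, ![2 * (D.bot a : ℝ) + 1 / 2, 0, -(D.K : ℝ) - 1]) := by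
    intro a e he
    rw [layerDarts_last, List.mem_singleton] at he
    subst he
    rw [D.pt_bot, D.pt_level a le_rfl]
  have hmem : ∀ a, ∃ e, e ∈ D.layerDarts a (D.K + 1) := fun a =>
    ⟨_, by rw [layerDarts_last]; exact List.mem_singleton_self _⟩
  ext x
  constructor
  · rintro ⟨a, e, he, rfl⟩
    rw [h0 a e he]
    have ha : (D.ρ D.K a).val = 2 * D.bot a ∨ (D.ρ D.K a).val = 2 * D.bot a + 1 := by
      unfold bot; omega
    have hlt := (D.ρ D.K a).2
    refine ⟨D.bot a, by omega, ?_⟩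
    rcases ha with ha | ha
    · rw [ha]; exact Or.inl rfl
    · rw [ha]; exact Or.inr Sym2.eq_swap
  · rintro ⟨p, hp, hx⟩
    rcases hx with rfl | rfl
    · let a := (D.ρ D.K).symm ⟨2 * p, by omega⟩
      have ha : (D.ρ D.K a).val = 2 * p := by simp [a]
      have ht : D.bot a = p := by unfold bot; omega
      obtain ⟨e, he⟩ := hmem a
      refine ⟨a, e, he, ?_⟩
      rw [h0 a e he, ha, ht]
    · let a := (D.ρ D.K).symm ⟨2 * p + 1, by omega⟩
      have ha : (D.ρ D.K a).val = 2 * p + 1 := by simp [a]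
      have ht : D.bot a = p := by unfold bot; omega
      obtain ⟨e, he⟩ := hmem a
      refine ⟨a, e, he, ?_⟩
      rw [h0 a e he, ha, ht]
      exact Sym2.eq_swap

theorem straight_edge {a : A} {k : ℕ} (hk : k < D.K) (h : ¬ D.IsBent a k) (x : Sym2 Space) :
    (∃ e ∈ D.layerDarts a (k + 1), x = s(D.pt a e.1, D.pt a e.2)) ↔
      x = s(node (D.ρ k a).val k, node (D.ρ (k + 1) a).val (k + 1)) := by
  rw [D.layerDarts_of_not_isBent a h]
  simp only [List.mem_singleton, exists_eq_left]
  rw [D.pt_level a hk.le, D.pt_level a hk]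

/-- For a crossing, the strand at `i` gives the two bent edges, the one at `i + 1` the straight
crossing edge, and the others vertical edges. Since the ranking is a bijection, every edge of the
layer arises. -/
theorem layer_edges {k : ℕ} (hk : k < D.K) : {x : Sym2 Space | ∃ a,
    ∃ e ∈ D.layerDarts a (k + 1), x = s(D.pt a e.1, D.pt a e.2)} =
      layerEdges (2 * n) k (D.l k) := by
  have hs := D.step k
  unfold LetterStep at hs
  obtain ⟨ε, hε⟩ : ∃ ε, ε = (D.l k).2 := ⟨_, rfl⟩
  cases hl : (D.l k).1 with
  | twist j =>
    rw [hl] at hs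
    change D.ρ (k + 1) = D.ρ k at hs
    have hb : ∀ a, ¬ D.IsBent a k := by
      rintro a ⟨i, hi, -⟩
      rw [hl] at hi
      cases hi
    have hlk : D.l k = (Gen.twist j, ε) := by rw [hε, ← hl]
    rw [hlk]
    ext x
    simp only [mem_ofPred_eq, D.straight_edge hk (hb _), hs]
    constructor
    · rintro ⟨a, rfl⟩
      exact ⟨_, (D.ρ k a).2, rfl⟩
    · rintro ⟨p, hp, rfl⟩
      exact ⟨(D.ρ k).symm ⟨p, hp⟩, by simp⟩
  | sigma i =>
    rw [hl] at hs
    change D.ρ (k + 1) = (D.ρ k).trans (adjSwap i) at hs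
    have hb : ∀ a, D.IsBent a k ↔ (D.ρ k a).val = i.val := by
      intro a
      constructor
      · rintro ⟨i', hi', h⟩
        rw [hl] at hi'
        cases hi'
        exact h
      · exact fun h => ⟨i, hl, h⟩
    have hlk : D.l k = (Gen.sigma i, ε) := by rw [hε, ← hl]
    have hρ : ∀ a, (D.ρ (k + 1) a).val = if (D.ρ k a).val = i.val then i.val + 1 else
        if (D.ρ k a).val = i.val + 1 then i.val else (D.ρ k a).val := by
      intro a
      rw [hs, Equiv.trans_apply, adjSwap_val]
    have hbent : ∀ a, (D.ρ k a).val = i.val → ∀ x : Sym2 Space,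
        (∃ e ∈ D.layerDarts a (k + 1), x = s(D.pt a e.1, D.pt a e.2)) ↔
        x = s(node i k, bend i k ε) ∨ x = s(bend i k ε, node (i + 1) (k + 1)) := by
      intro a ha x
      rw [D.layerDarts_of_isBent a hk ((hb a).2 ha)]
      simp only [List.mem_cons, List.not_mem_nil, or_false, exists_eq_or_imp, exists_eq_left]
      rw [D.pt_level a hk.le, D.pt_level a hk, D.pt_mid a hk hl ha, hρ, if_pos ha, ha, hε]
    rw [hlk]
    ext x
    constructor
    · rintro ⟨a, hx⟩
      by_cases ha : (D.ρ k a).val = i.val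
      · rw [hbent a ha] at hx
        rcases hx with rfl | rfl
        · exact Or.inl (Or.inl rfl)
        · exact Or.inl (Or.inr (Or.inl rfl))
      · rw [D.straight_edge hk (fun h => ha ((hb a).1 h)), hρ, if_neg ha] at hx
        by_cases ha' : (D.ρ k a).val = i.val + 1
        · rw [if_pos ha', ha'] at hx
          exact Or.inl (Or.inr (Or.inr hx))
        · rw [if_neg ha'] at hx
          exact Or.inr ⟨_, (D.ρ k a).2, ha, ha', hx⟩
    · have hi := i.2
      rintro ((rfl | rfl | rfl) | ⟨p, hp, h1, h2, rfl⟩)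
      · refine ⟨(D.ρ k).symm ⟨i.val, by omega⟩, ?_⟩
        rw [hbent _ (by simp)]
        exact Or.inl rfl
      · refine ⟨(D.ρ k).symm ⟨i.val, by omega⟩, ?_⟩
        rw [hbent _ (by simp)]
        exact Or.inr rfl
      · refine ⟨(D.ρ k).symm ⟨i.val + 1, by omega⟩, ?_⟩
        rw [D.straight_edge hk (fun h => by simpa using (hb _).1 h), hρ]
        simp
      · refine ⟨(D.ρ k).symm ⟨p, hp⟩, ?_⟩
        rw [D.straight_edge hk (fun h => h1 (by simpa using (hb _).1 h)), hρ]
        simp [h1, h2]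

/-- The word of a closed diagram. -/
def word : BraidWord (2 * n) := List.ofFn fun j : Fin D.K => D.l j

/-- Layer `0` gives the upper arcs, layer `K + 1` the lower arcs, and layer `k + 1` the edges of the
letter `k`. -/
theorem all_edges : {x : Sym2 Space | ∃ a, ∃ e ∈ D.strandDarts a,
    x = s(D.pt a e.1, D.pt a e.2)} = platEdges n D.word := by
  have hlen : D.word.length = D.K := List.length_ofFn
  have hbot : bottomArcs n D.word.length = bottomArcs n D.K := by rw [hlen]
  unfold platEdges
  have h3 : {e | ∃ j : Fin D.word.length, e ∈ layerEdges (2 * n) j (D.word.get j)} =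
      {x : Sym2 Space | ∃ k < D.K, ∃ a, ∃ e ∈ D.layerDarts a (k + 1),
        x = s(D.pt a e.1, D.pt a e.2)} := by
    ext x
    constructor
    · rintro ⟨⟨k, hk⟩, hx⟩
      have hk' : k < D.K := by rwa [hlen] at hk
      refine ⟨k, hk', ?_⟩
      have := D.layer_edges hk'
      have hx' : x ∈ layerEdges (2 * n) k (D.l k) := by
        simpa [word] using hx
      rwa [← this] at hx'
    · rintro ⟨k, hk, hx⟩
      refine ⟨⟨k, by rwa [hlen]⟩, ?_⟩
      have hx' : x ∈ layerEdges (2 * n) k (D.l k) := by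
        rw [← D.layer_edges hk]
        exact hx
      simpa [word] using hx'
  rw [h3, hbot, ← D.top_edges, ← D.bot_edges]
  ext x
  constructor
  · rintro ⟨a, e, he, hx⟩
    obtain ⟨j, hj, he⟩ := mem_strandDarts.1 he
    rcases Nat.eq_zero_or_pos j with rfl | h0
    · exact Or.inl (Or.inl ⟨a, e, he, hx⟩)
    · rcases eq_or_lt_of_le (Nat.lt_succ_iff.1 hj) with rfl | hlt
      · exact Or.inl (Or.inr ⟨a, e, he, hx⟩)
      · obtain ⟨k, rfl⟩ : ∃ k, j = k + 1 := ⟨j - 1, by omega⟩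
        exact Or.inr ⟨k, by omega, a, e, he, hx⟩
  · rintro ((⟨a, e, he, hx⟩ | ⟨a, e, he, hx⟩) | ⟨k, hk, a, e, he, hx⟩)
    · exact ⟨a, e, mem_strandDarts.2 ⟨0, by omega, he⟩, hx⟩
    · exact ⟨a, e, mem_strandDarts.2 ⟨D.K + 1, by omega, he⟩, hx⟩
    · exact ⟨a, e, mem_strandDarts.2 ⟨k + 1, by omega, he⟩, hx⟩

end Nodes

section Components

variable {c : ℕ} {m : Fin c → ℕ} [∀ i, NeZero (m i)] {n : ℕ}
  {D : PlatData (Vertex m × Bool) n}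

theorem Closes.iUnion_edges (h : D.Closes) :
    (⋃ i, (h.polygon i).edges) = platEdges n D.word := by
  rw [← D.all_edges]
  ext x
  simp only [mem_iUnion, h.edges_polygon, mem_ofPred_eq]
  constructor
  · rintro ⟨i, a, -, hx⟩
    exact ⟨a, hx⟩
  · rintro ⟨a, hx⟩
    exact ⟨_, a, rfl, hx⟩

open Classical in
/-- The contribution of the letter `k` to the twisting of the component `i`. -/
def compTwist (D : PlatData (Vertex m × Bool) n) (i : Fin c) (k : ℕ) : ℤ :=
  match (D.l k).1 with
  | Gen.sigma _ => 0
  | Gen.twist p => if ((D.ρ k).symm p).1.1 = i then exponent (D.l k).2 else 0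

/-- The node where the twisted edge starts is not a tip, so it lies on a single strand. Hence the
edge belongs to the component of the strand in that position and to no other. -/
theorem Closes.letterTwist_eq (h : D.Closes) (i : Fin c) {k : ℕ} (hk : k < D.K) :
    letterTwist (h.polygon i).edges k (D.l k) = D.compTwist i k := by
  obtain ⟨ε, hε⟩ : ∃ ε, ε = (D.l k).2 := ⟨_, rfl⟩
  unfold compTwist
  cases hl : (D.l k).1 with
  | sigma j =>
    have hlk : D.l k = (Gen.sigma j, ε) := by rw [hε, ← hl]
    rw [hlk]
    rfl
  | twist p =>
    have hlk : D.l k = (Gen.twist p, ε) := by rw [hε, ← hl]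
    rw [hlk]
    have hs := D.step k
    unfold LetterStep at hs
    rw [hl] at hs
    change D.ρ (k + 1) = D.ρ k at hs
    have hiff : s(node p k, node p (k + 1)) ∈ (h.polygon i).edges ↔
        ((D.ρ k).symm p).1.1 = i := by
      rw [h.edges_polygon]
      constructor
      · rintro ⟨a, ha, e, he, hx⟩
        have hp : D.pt ((D.ρ k).symm p) ((2 * (k + 1) : ℕ) : ℝ) = node p k := by
          rw [D.pt_level _ hk.le, Equiv.apply_symm_apply]
        have hn : node p k = D.pt a e.1 ∨ node p k = D.pt a e.2 := by
          rcases Sym2.eq_iff.1 hx with ⟨h1, -⟩ | ⟨h1, -⟩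
          · exact Or.inl h1
          · exact Or.inr h1
        have hk1 : ((2 * (k + 1) : ℕ) : ℝ) < 2 * D.K + 4 := by
          exact_mod_cast (by omega : 2 * (k + 1) < 2 * D.K + 4)
        have hk0 : (0 : ℝ) < ((2 * (k + 1) : ℕ) : ℝ) := by positivity
        have : (D.ρ k).symm p = a := by
          rw [← hp] at hn
          rcases hn with hn | hn
          · rcases (D.pt_eq_pt h.pos ⟨hk0.le, hk1.le⟩ hn).2 with h1 | h1 | h1
            · exact h1
            · exact absurd h1.1 hk0.ne'
            · exact absurd h1.1 hk1.ne
          · rcases (D.pt_eq_pt h.pos ⟨hk0.le, hk1.le⟩ hn).2 with h1 | h1 | h1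
            · exact h1
            · exact absurd h1.1 hk0.ne'
            · exact absurd h1.1 hk1.ne
        rw [this, ha]
      · intro ha
        have hb : ¬ D.IsBent ((D.ρ k).symm p) k := by
          rintro ⟨i, hi, -⟩
          rw [hl] at hi
          cases hi
        obtain ⟨e, he, hx⟩ := (D.straight_edge hk hb _).2 rfl
        refine ⟨_, ha, e, mem_strandDarts.2 ⟨k + 1, by omega, he⟩, ?_⟩
        rw [← hx, hs, Equiv.apply_symm_apply]
    unfold letterTwist
    simp only [hiff]

theorem Closes.isPlatDiagramLink {L : FramedLink} {m : Fin L.c → ℕ} [∀ i, NeZero (m i)]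
    {D : PlatData (Vertex m × Bool) n} (h : D.Closes)
    (hcomp : ∀ i, component L.curve i =
      {x | ∃ a : Vertex m × Bool, a.1.1 = i ∧ ∃ v ∈ Icc (0 : ℝ) (2 * D.K + 4), x = D.pt a v})
    (hfr : ∀ i, L.framing i = (h.polygon i).writhe + ∑ k ∈ Finset.range D.K, D.compTwist i k) :
    IsPlatDiagramLink n D.word L := by
  refine ⟨h.polygon, fun i => by rw [h.carrier_polygon, hcomp], h.iUnion_edges, fun i => ?_⟩
  rw [hfr, Finset.sum_range, add_right_inj]
  refine (Fin.sum_congr' (fun j : Fin D.word.length =>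
    letterTwist (h.polygon i).edges j (D.word.get j)) (by simp [word] : D.K = _)).symm.trans ?_ |>.symm
  refine Finset.sum_congr rfl fun k _ => ?_
  rw [← h.letterTwist_eq i k.2]
  simp only [word, List.get_ofFn]
  rfl

end Components

end PlatData

/-! ### Twist letters do not change the writhe -/

namespace PlatData

variable {c : ℕ} {m : Fin c → ℕ} {n : ℕ}

/-- The oriented edge `d` lies in the layer `j`. -/
def InLayer (D : PlatData (Vertex m × Bool) n) (j : ℕ) (d : (Vertex m × Bool) × ℕ × ℕ) : Prop :=
  d.1.2 = false ∧ d.2 ∈ D.layerDarts d.1 j ∨ d.1.2 = true ∧ d.2.swap ∈ D.layerDarts d.1 j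

theorem InLayer.param_mem {D : PlatData (Vertex m × Bool) n} {j : ℕ} {d : (Vertex m × Bool) × ℕ × ℕ} (h : D.InLayer j d) {s : ℝ}
    (hs : s ∈ Ioo (0 : ℝ) 1) :
    AffineMap.lineMap (d.2.1 : ℝ) (d.2.2 : ℝ) s ∈ Ioo (2 * j : ℝ) (2 * j + 2) := by
  have key : ∀ u w : ℕ, 2 * j ≤ u ∧ u < w ∧ w ≤ 2 * j + 2 → ∀ s ∈ Ioo (0 : ℝ) 1,
      AffineMap.lineMap (u : ℝ) (w : ℝ) s ∈ Ioo (2 * j : ℝ) (2 * j + 2) := by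
    rintro u w ⟨h1, h2, h3⟩ s hs
    have h1' : (2 * j : ℝ) ≤ u := by exact_mod_cast h1
    have h2' : (u : ℝ) < w := by exact_mod_cast h2
    have h3' : (w : ℝ) ≤ 2 * j + 2 := by exact_mod_cast h3
    rw [AffineMap.lineMap_apply_module', smul_eq_mul]
    constructor <;> nlinarith [hs.1, hs.2]
  rcases h with ⟨-, h⟩ | ⟨-, h⟩
  · exact key _ _ (layerDarts_bounds h) s hs
  · have := key _ _ (layerDarts_bounds h) (1 - s) ⟨by linarith [hs.2], by linarith [hs.1]⟩
    rwa [AffineMap.lineMap_apply_one_sub] at this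

variable [∀ i, NeZero (m i)]

/-- The sum over the oriented edges of the component `i` in the layer `j`. -/
def layerSum (D : PlatData (Vertex m × Bool) n) (i : Fin c) (j : ℕ)
    (f : (Vertex m × Bool) × ℕ × ℕ → ℤ) : ℤ :=
  ∑ k ∈ Finset.range (m i),
    (((D.layerDarts (vertex m i k, false) j).map fun e => f ((vertex m i k, false), e)).sum +
      ((D.layerDarts (vertex m i k, true) j).map fun e => f ((vertex m i k, true), e.swap)).sum)

variable {D : PlatData (Vertex m × Bool) n}

theorem sum_compDarts (i : Fin c) (f : (Vertex m × Bool) × ℕ × ℕ → ℤ) :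
    ((D.compDarts i).map f).sum = ∑ j ∈ Finset.range (D.K + 2), D.layerSum i j f := by
  unfold layerSum
  rw [Finset.sum_comm]
  unfold compDarts
  rw [sum_map_flatMap_range]
  refine Finset.sum_congr rfl fun k _ => ?_
  rw [List.map_append, List.sum_append, List.map_map, List.map_map, List.map_reverse,
    List.sum_reverse, Finset.sum_add_distrib]
  unfold strandDarts
  rw [sum_map_flatMap_range, sum_map_flatMap_range]
  rfl

/-- Two diagrams are allowed so that one with additional letters can be compared with the original,
layer by layer. -/
theorem layerSum_congr {D' : PlatData (Vertex m × Bool) n} {i : Fin c} {j : ℕ}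
    (hD : ∀ a, D'.layerDarts a j = D.layerDarts a j) {f g : (Vertex m × Bool) × ℕ × ℕ → ℤ}
    (h : ∀ d, d.1.1.1 = i → D.InLayer j d → f d = g d) :
    D.layerSum i j f = D'.layerSum i j g := by
  unfold layerSum
  refine Finset.sum_congr rfl fun k _ => ?_
  rw [hD, hD]
  congr 2
  · exact List.map_congr_left fun e he => h _ rfl (Or.inl ⟨rfl, he⟩)
  · exact List.map_congr_left fun e he => h _ rfl (Or.inr ⟨rfl, by rwa [Prod.swap_swap]⟩)

theorem layerSum_eq_zero {i : Fin c} {j : ℕ} {f : (Vertex m × Bool) × ℕ × ℕ → ℤ}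
    (h : ∀ d, d.1.1.1 = i → D.InLayer j d → f d = 0) : D.layerSum i j f = 0 := by
  rw [D.layerSum_congr (D' := D) (fun _ => rfl) h]
  simp [layerSum]

theorem InLayer.mem_compDarts {j : ℕ} (hj : j < D.K + 2) {d : (Vertex m × Bool) × ℕ × ℕ}
    (h : D.InLayer j d) : d ∈ D.compDarts d.1.1.1 := by
  refine PlatData.mem_compDarts.2 ⟨rfl, ?_⟩
  rcases h with ⟨h1, h2⟩ | ⟨h1, h2⟩
  · exact Or.inl ⟨h1, mem_strandDarts.2 ⟨j, hj, h2⟩⟩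
  · exact Or.inr ⟨h1, mem_strandDarts.2 ⟨j, hj, h2⟩⟩

/-- The projection keeps the height, and the height is a function of the parameter. The two
preimages of a crossing therefore have the same parameter, interior to an edge, which determines the
layer. -/
theorem exists_param_of_crossingSign_ne_zero {j j' : ℕ} (hj : j < D.K + 2) (hj' : j' < D.K + 2)
    {d d' : (Vertex m × Bool) × ℕ × ℕ} (hd : D.InLayer j d) (hd' : D.InLayer j' d')
    (h : crossingSign (D.source d) (D.target d) (D.source d') (D.target d') ≠ 0) :
    j = j' ∧ ∃ v ∈ Ioo (2 * j : ℝ) (2 * j + 2), D.x d.1 v = D.x d'.1 v := by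
  unfold crossingSign at h
  split_ifs at h with hc
  · obtain ⟨s, hs, t, ht, h0, h2⟩ := hc
    rw [← (dart_param_mem (hd.mem_compDarts hj) (Ioo_subset_Icc_self hs)).1,
      ← (dart_param_mem (hd'.mem_compDarts hj') (Ioo_subset_Icc_self ht)).1] at h0 h2
    simp only [pt, Matrix.cons_val] at h0 h2
    have hv : AffineMap.lineMap (d.2.1 : ℝ) (d.2.2 : ℝ) s =
        AffineMap.lineMap (d'.2.1 : ℝ) (d'.2.2 : ℝ) t := by linarith
    have m1 := hd.param_mem hs
    have m2 := hd'.param_mem ht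
    rw [← hv] at m2 h0
    refine ⟨?_, _, m1, h0⟩
    have e1 : (j : ℝ) < j' + 1 := by linarith [m1.1, m2.2]
    have e2 : (j' : ℝ) < j + 1 := by linarith [m1.2, m2.1]
    have e1' : j < j' + 1 := by exact_mod_cast e1
    have e2' : j' < j + 1 := by exact_mod_cast e2
    omega
  · exact absurd rfl h

/-- There are no crossings in a layer in which all strands are straight. -/
theorem crossingSign_eq_zero_of_straight (hK : 0 < D.K) {j : ℕ} (hj : j < D.K + 2)
    (hstr : ∀ a, D.layerDarts a j = [(2 * j, 2 * j + 2)])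
    (hy : ∀ a, ∀ v ∈ Ioo (2 * j : ℝ) (2 * j + 2), D.y a v = 0)
    {d d' : (Vertex m × Bool) × ℕ × ℕ} (hd : D.InLayer j d) (hd' : D.InLayer j d') :
    crossingSign (D.source d) (D.target d) (D.source d') (D.target d') = 0 := by
  by_contra h
  obtain ⟨-, v, hv, hx⟩ := exists_param_of_crossingSign_ne_zero hj hj hd hd' h
  have h0 : (0 : ℝ) < v := lt_of_le_of_lt (by positivity) hv.1
  have h1 : v < 2 * D.K + 4 := by
    have : (j : ℝ) ≤ D.K + 1 := by exact_mod_cast Nat.lt_succ_iff.1 hj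
    linarith [hv.2]
  -- Since all strands of the layer lie in the plane `y = 0`, a crossing of projections would be an
  -- actual meeting point.
  have hp : D.pt d.1 v = D.pt d'.1 v := by
    unfold pt
    rw [hx, hy _ v hv, hy _ v hv]
  have hab : d.1 = d'.1 := by
    rcases (D.pt_eq_pt hK ⟨h0.le, h1.le⟩ hp).2 with h | h | h
    · exact h
    · exact absurd h.1 h0.ne'
    · exact absurd h.1 h1.ne
  have hdd : d = d' := by
    obtain ⟨a, e⟩ := d
    obtain ⟨a', e'⟩ := d'
    dsimp only at hab
    subst hab
    unfold InLayer at hd hd'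
    simp only [hstr, List.mem_singleton] at hd hd'
    rcases hd with ⟨h1, h2⟩ | ⟨h1, h2⟩ <;> rcases hd' with ⟨h1', h2'⟩ | ⟨h1', h2'⟩
    · rw [h2, h2']
    · rw [h1] at h1'; cases h1'
    · rw [h1] at h1'; cases h1'
    · rw [Prod.swap_injective (h2.trans h2'.symm)]
  rw [hdd] at h
  exact h (crossingSign_self _ _)

/-- The contribution of the layer `j` to twice the writhe. -/
def layerWrithe (D : PlatData (Vertex m × Bool) n) (i : Fin c) (j : ℕ) : ℤ :=
  D.layerSum i j fun d => D.layerSum i j fun d' =>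
    crossingSign (D.source d) (D.target d) (D.source d') (D.target d')

/-- Edges in different layers occupy different ranges of heights and cannot cross, so only pairs
inside one layer contribute. -/
theorem Closes.two_mul_writhe_eq_sum (h : D.Closes) (i : Fin c) :
    2 * (h.polygon i).writhe = ∑ j ∈ Finset.range (D.K + 2), D.layerWrithe i j := by
  rw [h.two_mul_writhe_polygon, sum_compDarts]
  refine Finset.sum_congr rfl fun j hj => ?_
  refine layerSum_congr (fun _ => rfl) fun d _ hd => ?_
  rw [sum_compDarts, Finset.sum_eq_single j]
  · intro j' hj' hne
    refine layerSum_eq_zero fun d' _ hd' => ?_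
    by_contra hc
    exact hne (exists_param_of_crossingSign_ne_zero (Finset.mem_range.1 hj)
      (Finset.mem_range.1 hj') hd hd' hc).1.symm
  · exact fun h => absurd hj h

theorem layerWrithe_eq_zero (hK : 0 < D.K) {j : ℕ} (hj : j < D.K + 2) (i : Fin c)
    (hstr : ∀ a, D.layerDarts a j = [(2 * j, 2 * j + 2)])
    (hy : ∀ a, ∀ v ∈ Ioo (2 * j : ℝ) (2 * j + 2), D.y a v = 0) : D.layerWrithe i j = 0 :=
  layerSum_eq_zero fun _ _ hd => layerSum_eq_zero fun _ _ hd' =>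
    crossingSign_eq_zero_of_straight hK hj hstr hy hd hd'

/-- The layer below level `k` consists of straight strands. -/
def IsTwist (D : PlatData (Vertex m × Bool) n) (k : ℕ) : Prop := ∃ p, (D.l k).1 = Gen.twist p

theorem layerWrithe_of_isTwist (hK : 0 < D.K) {k : ℕ} (hk : k < D.K) (i : Fin c)
    (ht : D.IsTwist k) : D.layerWrithe i (k + 1) = 0 := by
  obtain ⟨p, hp⟩ := ht
  have hb : ∀ a, ¬ D.IsBent a k := by
    rintro a ⟨i, hi, -⟩
    rw [hp] at hi
    cases hi
  refine layerWrithe_eq_zero hK (by omega) i (fun a => D.layerDarts_of_not_isBent a (hb a)) ?_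
  intro a v hv
  push_cast at hv
  have hm := (mid_of_not_isBent (hb a)).2
  rcases le_total v (2 * k + 3) with h | h
  · rw [(D.x_y_fst a hk ⟨by linarith [hv.1], h⟩).2, hm, mul_zero]
  · rw [(D.x_y_snd a hk ⟨h, by linarith [hv.2]⟩).2, hm, mul_zero]

theorem Closes.two_mul_writhe_eq_sum_letters (h : D.Closes) (i : Fin c) :
    2 * (h.polygon i).writhe = ∑ k ∈ Finset.range D.K, D.layerWrithe i (k + 1) := by
  rw [h.two_mul_writhe_eq_sum, Finset.sum_range_succ, Finset.sum_range_succ',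
    layerWrithe_eq_zero h.pos (by omega) i D.layerDarts_zero
      fun a v hv => (D.x_y_top a ⟨by simpa using hv.1.le, by simpa using hv.2.le⟩).2,
    layerWrithe_eq_zero h.pos (by omega) i D.layerDarts_last, add_zero, add_zero]
  intro a v hv
  push_cast at hv
  exact (D.x_y_bot a ⟨by linarith [hv.1], by linarith [hv.2]⟩).2

/-- Twist letters at the end do not change the writhe. -/
theorem Closes.writhe_eq {D' : PlatData (Vertex m × Bool) n} (h : D.Closes) (h' : D'.Closes)
    (hK : D.K ≤ D'.K) (hρ : ∀ k ≤ D.K, D'.ρ k = D.ρ k) (hl : ∀ k < D.K, D'.l k = D.l k)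
    (ht : ∀ k, D.K ≤ k → k < D'.K → D'.IsTwist k) (i : Fin c) :
    (h'.polygon i).writhe = (h.polygon i).writhe := by
  have main : ∑ k ∈ Finset.range D'.K, D'.layerWrithe i (k + 1) =
      ∑ k ∈ Finset.range D.K, D.layerWrithe i (k + 1) := by
    rw [← Finset.sum_range_add_sum_Ico _ hK, add_eq_left.2]
    · refine Finset.sum_congr rfl fun k hk => ?_
      rw [Finset.mem_range] at hk
      have hk' : k < D'.K := hk.trans_le hK
      have hd : ∀ a, D.layerDarts a (k + 1) = D'.layerDarts a (k + 1) := by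
        intro a
        by_cases hb : D.IsBent a k
        · have hb' : D'.IsBent a k := by
            unfold IsBent
            rw [hl k hk, hρ k hk.le]
            exact hb
          rw [D.layerDarts_of_isBent a hk hb, D'.layerDarts_of_isBent a hk' hb']
        · have hb' : ¬ D'.IsBent a k := by
            unfold IsBent
            rw [hl k hk, hρ k hk.le]
            exact hb
          rw [D.layerDarts_of_not_isBent a hb, D'.layerDarts_of_not_isBent a hb']
      -- The vertices in a layer depend only on the letter and on the rankings directly above and
      -- below it.
      have hpt : ∀ a, ∀ v : ℕ, 2 * k + 2 ≤ v → v ≤ 2 * k + 4 → D'.pt a v = D.pt a v := by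
        intro a v h1 h2
        rw [D.pt_natCast a (by omega), D'.pt_natCast a (by omega)]
        obtain rfl | rfl | rfl : v = 2 * k + 2 ∨ v = 2 * k + 3 ∨ v = 2 * (k + 1) + 2 := by omega
        · rw [D.nodeX_level a hk.le, D'.nodeX_level a hk'.le, hρ k hk.le,
            show 2 * k + 2 = 2 * (k + 1) by ring, D.nodeY_even, D'.nodeY_even]
        · rw [D.nodeX_mid a hk, D'.nodeX_mid a hk', D.nodeY_mid a hk, D'.nodeY_mid a hk',
            hρ k hk.le, hl k hk]
        · rw [D.nodeX_level a hk, D'.nodeX_level a hk', hρ (k + 1) hk,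
            show 2 * (k + 1) + 2 = 2 * (k + 2) by ring, D.nodeY_even, D'.nodeY_even]
      have hsrc : ∀ d, D'.InLayer (k + 1) d → D'.source d = D.source d ∧ D'.target d = D.target d := by
        rintro d (⟨-, hd⟩ | ⟨-, hd⟩)
        · have := layerDarts_bounds hd
          exact ⟨hpt _ _ (by omega) (by omega), hpt _ _ (by omega) (by omega)⟩
        · have := layerDarts_bounds hd
          rw [Prod.fst_swap, Prod.snd_swap] at this
          exact ⟨hpt _ _ (by omega) (by omega), hpt _ _ (by omega) (by omega)⟩
      refine layerSum_congr hd fun d _ h1 => ?_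
      refine layerSum_congr hd fun d' _ h2 => ?_
      rw [(hsrc d h1).1, (hsrc d h1).2, (hsrc d' h2).1, (hsrc d' h2).2]
    · refine Finset.sum_eq_zero fun k hk => ?_
      rw [Finset.mem_Ico] at hk
      exact layerWrithe_of_isTwist h'.pos hk.2 i (ht k hk.1 hk.2)
  have e1 := h.two_mul_writhe_eq_sum_letters i
  have e2 := h'.two_mul_writhe_eq_sum_letters i
  omega

end PlatData

/-! ### Adjusting the framing -/

namespace PlatData

variable {c : ℕ} {m : Fin c → ℕ} [∀ i, NeZero (m i)] {n : ℕ}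

/-- The closed diagram with `T` additional twist letters at the lower end. -/
def extend {A : Type*} (D : PlatData A n) (T : ℕ) (w : ℕ → Fin (2 * n) × Bool) : PlatData A n where
  K := D.K + T
  -- Twists do not move the strands, so the ranking is frozen from level `D.K` on.
  ρ k := D.ρ (min k D.K)
  l k := if k < D.K then D.l k else (Gen.twist (w (k - D.K)).1, (w (k - D.K)).2)
  step k := by
    split_ifs with h
    · rw [min_eq_left h.le, min_eq_left h]
      exact D.step k
    · rw [min_eq_right (not_lt.1 h), min_eq_right (by omega)]
      rfl

section Extend

variable {A : Type*} (D : PlatData A n) (T : ℕ) (w : ℕ → Fin (2 * n) × Bool)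

theorem extend_ρ {k : ℕ} (hk : k ≤ D.K) : (D.extend T w).ρ k = D.ρ k := by
  simp only [extend, min_eq_left hk]

theorem extend_ρ_of_le {k : ℕ} (hk : D.K ≤ k) : (D.extend T w).ρ k = D.ρ D.K := by
  simp only [extend, min_eq_right hk]

theorem extend_l {k : ℕ} (hk : k < D.K) : (D.extend T w).l k = D.l k := by
  simp only [extend, if_pos hk]

theorem extend_l_of_le {k : ℕ} (hk : D.K ≤ k) :
    (D.extend T w).l k = (Gen.twist (w (k - D.K)).1, (w (k - D.K)).2) := by
  simp only [extend, if_neg (not_lt.2 hk)]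

theorem extend_top (a : A) : (D.extend T w).top a = D.top a := by
  unfold top
  rw [D.extend_ρ T w (Nat.zero_le _)]

theorem extend_bot (a : A) : (D.extend T w).bot a = D.bot a := by
  unfold bot
  rw [D.extend_ρ_of_le T w (show D.K ≤ (D.extend T w).K from Nat.le_add_right _ _)]

end Extend

variable {D : PlatData (Vertex m × Bool) n}

theorem Closes.extend (h : D.Closes) (T : ℕ) (w : ℕ → Fin (2 * n) × Bool) :
    (D.extend T w).Closes where
  pos := Nat.add_pos_left h.pos T
  top_true k := by rw [extend_top, extend_top, h.top_true]
  bot_true k := by rw [extend_bot, extend_bot, h.bot_true]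
  top_injective k l := by
    rw [extend_top, extend_top]
    exact h.top_injective k l
  bot_injective k l := by
    rw [extend_bot, extend_bot]
    exact h.bot_injective k l

theorem Closes.writhe_extend (h : D.Closes) (T : ℕ) (w : ℕ → Fin (2 * n) × Bool) (i : Fin c) :
    ((h.extend T w).polygon i).writhe = (h.polygon i).writhe :=
  h.writhe_eq (h.extend T w) (Nat.le_add_right _ _) (fun _ hk => D.extend_ρ T w hk)
    (fun _ hk => D.extend_l T w hk) (fun _ hk _ => ⟨_, by rw [D.extend_l_of_le T w hk]⟩) i

/-- For each component `i` the list contains `|d i|` copies of the representative `f i`, all with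
the sign of `d i`. -/
theorem exists_signed_list {α : Type*} (f : Fin c → α) (g : α → Fin c) (hfg : ∀ i, g (f i) = i)
    (d : Fin c → ℤ) : ∃ L : List (α × Bool), ∀ i,
      (L.map fun p => if g p.1 = i then exponent p.2 else 0).sum = d i := by
  have main : ∀ s : Finset (Fin c), ∃ L : List (α × Bool), ∀ i,
      (L.map fun p => if g p.1 = i then exponent p.2 else 0).sum = if i ∈ s then d i else 0 := by
    intro s
    induction s using Finset.induction_on with
    | empty => exact ⟨[], by simp⟩
    | insert j s hj ih =>
      obtain ⟨L, hL⟩ := ih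
      refine ⟨List.replicate (d j).natAbs (f j, decide (0 ≤ d j)) ++ L, fun i => ?_⟩
      rw [List.map_append, List.sum_append, hL, List.map_replicate, List.sum_replicate, hfg]
      by_cases hi : j = i
      · subst hi
        rw [if_neg hj, if_pos rfl, if_pos (Finset.mem_insert_self _ _)]
        unfold exponent
        by_cases h0 : 0 ≤ d j
        · simp [h0]
        · simp [h0, abs_of_neg (not_le.1 h0)]
      · simp [hi, Ne.symm hi]
  obtain ⟨L, hL⟩ := main Finset.univ
  exact ⟨L, fun i => by rw [hL, if_pos (Finset.mem_univ _)]⟩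

open Classical in
/-- Every framing vector is obtained by additional twist letters. -/
theorem Closes.exists_extend (h : D.Closes) (i0 : Fin c) (φ : Fin c → ℤ) : ∃ T w, ∀ i,
    φ i = ((h.extend T w).polygon i).writhe +
      ∑ k ∈ Finset.range (D.extend T w).K, (D.extend T w).compTwist i k := by
  -- The missing framing of a component is put on its strand `(vertex m i 0, false)`, at its
  -- position at the lower end. Twist letters already in the word are subtracted too.
  obtain ⟨L, hL⟩ := exists_signed_list (fun i => D.ρ D.K (vertex m i 0, false))
    (fun p => ((D.ρ D.K).symm p).1.1) (fun i => by simp [vertex])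
    (fun i => φ i - (h.polygon i).writhe - ∑ k ∈ Finset.range D.K, D.compTwist i k)
  -- The default letter only makes the sequence total; it stands beyond the `L.length` letters that
  -- are used.
  refine ⟨L.length, fun k => L.getD k (D.ρ D.K (vertex m i0 0, false), true), fun i => ?_⟩
  rw [h.writhe_extend]
  change _ = _ + ∑ k ∈ Finset.range (D.K + L.length), _
  rw [Finset.sum_range_add]
  have e1 : ∀ k ∈ Finset.range D.K, (D.extend L.length
      fun k => L.getD k (D.ρ D.K (vertex m i0 0, false), true)).compTwist i k =
      D.compTwist i k := by
    intro k hk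
    rw [Finset.mem_range] at hk
    unfold compTwist
    rw [D.extend_l _ _ hk, D.extend_ρ _ _ hk.le]
  have e2 : ∀ k ∈ Finset.range L.length, (D.extend L.length
      fun k => L.getD k (D.ρ D.K (vertex m i0 0, false), true)).compTwist i (D.K + k) =
      (fun p : Fin (2 * n) × Bool =>
        if ((D.ρ D.K).symm p.1).1.1 = i then exponent p.2 else 0)
        (L.getD k (D.ρ D.K (vertex m i0 0, false), true)) := by
    intro k hk
    unfold compTwist
    rw [D.extend_l_of_le _ _ (Nat.le_add_right _ _), D.extend_ρ_of_le _ _ (Nat.le_add_right _ _),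
      Nat.add_sub_cancel_left]
  rw [Finset.sum_congr rfl e1, Finset.sum_congr rfl e2, Finset.sum_range (n := L.length)]
  have e3 := hL i
  rw [← Fin.sum_univ_fun_getElem] at e3
  have e4 : ∀ k : Fin L.length, L.getD k (D.ρ D.K (vertex m i0 0, false), true) = L[k.val] :=
    fun k => List.getD_eq_getElem _ _ k.2
  simp only [e4]
  linarith

end PlatData

/-! ### The braid word of a motion of points in the plane -/

/-- A letter that realizes a step between rankings; its sign is given by `s` for a crossing. -/
theorem exists_letter {A : Type*} [Nonempty A] {M : ℕ} {ρ ρ' R R' : A ≃ Fin M}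
    (h : ρ' = ρ ∨ ∃ i : Fin (M - 1), ρ' = ρ.trans (adjSwap i) ∧
      ∀ a b, (ρ a).val = i.val → (ρ b).val = i.val + 1 → R a < R b ∧ R' b < R' a)
    (s : A → A → Bool) : ∃ l : Gen M × Bool, LetterStep l ρ ρ' ∧
      ∀ a b, ρ a < ρ b → ρ' b < ρ' a → R a < R b ∧ R' b < R' a ∧ l.2 = s a b := by
  rcases h with rfl | ⟨i, rfl, hi⟩
  -- A step that leaves the ranking unchanged is filled with an arbitrary twist. Its effect on the
  -- framing is compensated later.
  · refine ⟨(Gen.twist (ρ' (Classical.arbitrary A)), true), rfl, fun a b h1 h2 => ?_⟩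
    exact absurd h1 (not_lt.2 h2.le)
  · refine ⟨(Gen.sigma i, s (ρ.symm ⟨i.val, by omega⟩) (ρ.symm ⟨i.val + 1, by omega⟩)), rfl,
      fun a b h1 h2 => ?_⟩
    by_cases hab : (ρ a).val = i.val ∧ (ρ b).val = i.val + 1
    · obtain ⟨h3, h4⟩ := hi a b hab.1 hab.2
      refine ⟨h3, h4, ?_⟩
      dsimp only
      congr 1
      · rw [Equiv.symm_apply_eq]
        exact Fin.ext hab.1.symm
      · rw [Equiv.symm_apply_eq]
        exact Fin.ext hab.2.symm
    · exact absurd (adjSwap_lt_adjSwap i h1 hab) (not_lt.2 h2.le)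

/-- The difference `f - g` has Lipschitz constant `2C`, so within a time window of length `1 / N` it
changes by less than `δ`. Differences of coordinates are thus controlled by their values at either
end of a window. -/
theorem abs_sub_sub_le {f g : ℝ → ℝ} {C : ℝ≥0} (hf : LipschitzWith C f) (hg : LipschitzWith C g)
    {N : ℕ} {δ : ℝ} (hN : 2 * C / δ < N) (hδ : 0 < δ) {j : ℕ} {s t : ℝ}
    (hs : s ∈ Icc ((j : ℝ) / N) ((j + 1) / N)) (ht : t ∈ Icc ((j : ℝ) / N) ((j + 1) / N)) :
    |(f t - g t) - (f s - g s)| < δ := by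
  have hN0 : (0 : ℝ) < N := lt_of_le_of_lt (by positivity) hN
  have h1 := hf.dist_le_mul t s
  have h2 := hg.dist_le_mul t s
  rw [Real.dist_eq, Real.dist_eq] at h1 h2
  have h3 : |t - s| ≤ 1 / N := by
    have : ((j : ℝ) + 1) / N = j / N + 1 / N := by ring
    rw [this] at hs ht
    rw [abs_le]
    constructor <;> linarith [hs.1, hs.2, ht.1, ht.2]
  have h4 : (C : ℝ) * |t - s| ≤ C * (1 / N) := mul_le_mul_of_nonneg_left h3 C.2
  have h5 : 2 * ((C : ℝ) * (1 / N)) < δ := by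
    rw [div_lt_iff₀ hδ] at hN
    rw [← mul_assoc, mul_one_div, div_lt_iff₀ hN0]
    linarith
  have h6 : (f t - g t) - (f s - g s) = (f t - f s) - (g t - g s) := by ring
  rw [h6]
  linarith [abs_sub (f t - f s) (g t - g s)]

/-- A motion of separated points in the plane is described by a braid word. -/
theorem exists_platData_of_motion {A : Type*} [Fintype A] [Nonempty A] {n : ℕ} (X Y : A → ℝ → ℝ)
    (C : ℝ≥0) (hX : ∀ a, LipschitzWith C (X a)) (hY : ∀ a, LipschitzWith C (Y a)) (δ : ℝ)
    (hδ : 0 < δ) (hsep : ∀ a b, a ≠ b → ∀ t ∈ Icc (0 : ℝ) 1,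
      δ ≤ |X a t - X b t| ∨ δ ≤ |Y a t - Y b t|) (R R' : A ≃ Fin (2 * n))
    (hR : ∀ a b, R a < R b → X a 0 ≤ X b 0) (hR' : ∀ a b, R' a < R' b → X a 1 ≤ X b 1) :
    ∃ D : PlatData A n, 0 < D.K ∧ D.ρ 0 = R ∧ D.ρ D.K = R' ∧ ∀ k < D.K,
      ∀ t ∈ Icc ((k : ℝ) / D.K) ((k + 1) / D.K), ∀ a b, D.ρ k a < D.ρ k b →
        (D.ρ (k + 1) a < D.ρ (k + 1) b → X a t - X b t < |Y a t - Y b t|) ∧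
        (D.ρ (k + 1) b < D.ρ (k + 1) a →
          0 < (exponent (D.l k).2 : ℝ) * (Y a t - Y b t)) := by
  obtain ⟨N, hN⟩ := exists_nat_gt (2 * C / δ)
  have hN0 : (0 : ℝ) < N := lt_of_le_of_lt (by positivity) hN
  have hN1 : 0 < N := by exact_mod_cast hN0
  choose S hS using fun j : ℕ => exists_ranking R fun a => X a ((j : ℝ) / N)
  -- The ranking `Q j` sorts the points at time `j / N`. At both ends it is the prescribed one,
  -- since the pairing of strands at tips must be respected there.
  let Q : ℕ → (A ≃ Fin (2 * n)) := fun j => if j = 0 then R else if N ≤ j then R' else S j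
  have hQ : ∀ j ≤ N, ∀ a b, Q j a < Q j b → X a ((j : ℝ) / N) ≤ X b ((j : ℝ) / N) := by
    intro j hj a b hab
    dsimp only [Q] at hab
    split_ifs at hab with h1 h2
    · subst h1
      simpa using hR a b hab
    · obtain rfl : N = j := le_antisymm h2 hj
      rw [div_self hN0.ne']
      exact hR' a b hab
    · exact hS j a b hab
  choose ρ hρ0 hρ1 hρlt hρstep using fun j => exists_sorting_sequence (Q j) (Q (j + 1))
  -- Each window receives the same number `B` of letters, more than sorting can need, so the letter
  -- `k` belongs to window `k / B`.
  let B := Fintype.card (A × A) + 1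
  have hB : 0 < B := Nat.succ_pos _
  let P : ℕ → (A ≃ Fin (2 * n)) := fun k => ρ (k / B) (k % B)
  have hsucc : ∀ k, P (k + 1) = ρ (k / B) (k % B + 1) := by
    intro k
    have hlt := Nat.mod_lt k hB
    have hk := Nat.div_add_mod k B
    rcases Nat.lt_or_ge (k % B + 1) B with h | h
    · have e0 : k + 1 = B * (k / B) + (k % B + 1) := by omega
      have e1 : (k + 1) / B = k / B := by
        conv_lhs => rw [e0]
        rw [Nat.mul_add_div hB, Nat.div_eq_of_lt h, add_zero]
      have e2 : (k + 1) % B = k % B + 1 := by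
        have := Nat.div_add_mod (k + 1) B
        rw [e1] at this
        omega
      dsimp only [P]
      rw [e1, e2]
    · have e0 : k % B + 1 = B := by omega
      have e3 : k + 1 = B * (k / B + 1) := by
        rw [mul_add, mul_one]
        omega
      have e1 : (k + 1) / B = k / B + 1 := by
        rw [e3, Nat.mul_div_cancel_left _ hB]
      have e2 : (k + 1) % B = 0 := by
        rw [e3, Nat.mul_mod_right]
      dsimp only [P]
      rw [e1, e2, hρ0, hρ1 _ _ (by omega)]
  choose l hl1 hl2 using fun k => exists_letter (ρ := P k) (ρ' := P (k + 1)) (R := Q (k / B))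
    (R' := Q (k / B + 1)) (by rw [hsucc]; exact hρstep _ _)
    -- The sign of a crossing is read off from the `y`-difference at the beginning of its window.
    (fun a b => decide (0 < Y a (((k / B : ℕ) : ℝ) / N) - Y b (((k / B : ℕ) : ℝ) / N)))
  refine ⟨⟨N * B, P, l, hl1⟩, Nat.mul_pos hN1 hB, ?_, ?_, ?_⟩
  · dsimp only [P]
    rw [Nat.zero_div, Nat.zero_mod, hρ0]
    simp [Q]
  · dsimp only [P]
    rw [Nat.mul_div_cancel _ hB, Nat.mul_mod_left, hρ0]
    simp [Q, hN1.ne']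
  dsimp only
  intro k hk t ht a b hab
  obtain ⟨j, hj⟩ : ∃ j, j = k / B := ⟨_, rfl⟩
  have hjN : j < N := by
    rw [hj, Nat.div_lt_iff_lt_mul hB]
    exact hk
  have hB0 : (0 : ℝ) < B := by exact_mod_cast hB
  have ht' : t ∈ Icc ((j : ℝ) / N) ((j + 1) / N) := by
    have e1 : B * j ≤ k := by rw [hj]; exact Nat.mul_div_le k B
    have e2 : k + 1 ≤ B * (j + 1) := by
      rw [hj, Nat.succ_le_iff]
      exact Nat.lt_mul_div_succ k hB
    have e1' : (B : ℝ) * j ≤ k := by exact_mod_cast e1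
    have e2' : (k : ℝ) + 1 ≤ B * (j + 1) := by exact_mod_cast e2
    push_cast at ht
    constructor
    · refine le_trans ?_ ht.1
      rw [div_le_div_iff₀ hN0 (by positivity)]
      nlinarith
    · refine le_trans ht.2 ?_
      rw [div_le_div_iff₀ (by positivity) hN0]
      nlinarith
  have ht01 : t ∈ Icc (0 : ℝ) 1 := by
    refine ⟨le_trans (by positivity) ht'.1, ht'.2.trans ?_⟩
    rw [div_le_one hN0]
    exact_mod_cast hjN
  have hs0 : (j : ℝ) / N ∈ Icc ((j : ℝ) / N) ((j + 1) / N) :=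
    ⟨le_rfl, div_le_div_of_nonneg_right (by linarith) hN0.le⟩
  have hs1 : ((j : ℝ) + 1) / N ∈ Icc ((j : ℝ) / N) ((j + 1) / N) :=
    ⟨div_le_div_of_nonneg_right (by linarith) hN0.le, le_rfl⟩
  have hne : a ≠ b := fun h => (ne_of_lt hab) (by rw [h])
  have h0 : Q j a < Q j b → X a t - X b t < δ := by
    intro h
    have h1 := hQ j hjN.le a b h
    have h2 := abs_lt.1 (abs_sub_sub_le (hX a) (hX b) hN hδ hs0 ht')
    linarith
  have h1 : ∀ a b, Q (j + 1) a < Q (j + 1) b → X a t - X b t < δ := by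
    intro a b h
    have h1 := hQ (j + 1) hjN a b h
    push_cast at h1
    have h2 := abs_lt.1 (abs_sub_sub_le (hX a) (hX b) hN hδ hs1 ht')
    linarith
  constructor
  · intro _
    -- If both sampled rankings had `b` before `a`, sorting would never put `a` first. So `a` comes
    -- first at one end of the window, where `X a ≤ X b`, and the difference varies by less than
    -- `δ`.
    have hlt : X a t - X b t < δ := by
      by_cases h2 : Q j a < Q j b
      · exact h0 h2
      · by_cases h3 : Q (j + 1) a < Q (j + 1) b
        · exact h1 a b h3
        · exfalso
          have h2' := lt_of_le_of_ne (not_lt.1 h2) fun h => hne ((Q j).injective h).symm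
          have h3' := lt_of_le_of_ne (not_lt.1 h3) fun h => hne ((Q (j + 1)).injective h).symm
          have := hρlt j (k % B) b a h2' h3'
          rw [hj] at this
          exact absurd hab (not_lt.2 this.le)
    rcases hsep a b hne t ht01 with h | h
    · have : X a t - X b t < 0 := by
        by_contra hc
        rw [abs_of_nonneg (not_lt.1 hc)] at h
        exact absurd hlt (not_lt.2 h)
      exact this.trans_le (abs_nonneg _)
    · exact hlt.trans_le h
  · intro hba
    obtain ⟨h2, h3, h4⟩ := hl2 k a b hab hba
    rw [← hj] at h2 h3 h4
    -- An exchanged pair is ordered oppositely at the two ends of the window, so its `x`-difference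
    -- is below `δ` in absolute value throughout, and the separation must come from `y`.
    have hY0 : ∀ t ∈ Icc ((j : ℝ) / N) ((j + 1) / N), t ∈ Icc (0 : ℝ) 1 →
        δ ≤ |Y a t - Y b t| := by
      intro t ht ht01
      refine (hsep a b hne t ht01).resolve_left (not_le.2 ?_)
      have e1 := hQ j hjN.le a b h2
      have e2 := hQ (j + 1) hjN b a h3
      push_cast at e2
      have e3 := abs_lt.1 (abs_sub_sub_le (hX a) (hX b) hN hδ hs0 ht)
      have e4 := abs_lt.1 (abs_sub_sub_le (hX a) (hX b) hN hδ hs1 ht)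
      rw [abs_lt]
      constructor <;> linarith
    have h5 := hY0 _ hs0 ⟨by positivity, hs0.2.trans (by
      rw [div_le_one hN0]
      exact_mod_cast hjN)⟩
    -- The `y`-difference has size at least `δ` at the start and varies by less than `δ`, so its
    -- sign persists in the whole window.
    have h6 := abs_lt.1 (abs_sub_sub_le (hY a) (hY b) hN hδ hs0 ht')
    rw [h4]
    by_cases hpos : 0 < Y a ((j : ℝ) / N) - Y b ((j : ℝ) / N)
    · rw [abs_of_pos hpos] at h5
      simp only [hpos, decide_true, exponent, if_true]
      push_cast
      linarith
    · rw [abs_of_nonpos (not_lt.1 hpos)] at h5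
      simp only [hpos, decide_false, exponent, Bool.false_eq_true, if_false]
      push_cast
      linarith

/-! ### Systems of strands -/

/-- A system of strands between the heights `-H` and `H`, given as graphs over the third
coordinate, that meet in pairs at the upper and at the lower tips, are disjoint otherwise and are
straight near the tips. -/
structure Strands (A I : Type*) where
  H : ℝ
  one_lt : 1 < H
  X : A → ℝ → ℝ
  Y : A → ℝ → ℝ
  C : ℝ≥0
  lipX : ∀ a, LipschitzWith C (X a)
  lipY : ∀ a, LipschitzWith C (Y a)
  disjoint : ∀ a b, a ≠ b → ∀ z ∈ Ioo (-H) H, X a z = X b z → Y a z = Y b z → False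
  top : A ≃ I × Bool
  bot : A ≃ I × Bool
  tipTop : I → ℝ × ℝ
  tipBot : I → ℝ × ℝ
  tipTop_injective : ∀ i j, (tipTop i).1 = (tipTop j).1 → i = j
  tipBot_injective : ∀ i j, (tipBot i).1 = (tipBot j).1 → i = j
  slopeTop : A → ℝ × ℝ
  slopeBot : A → ℝ × ℝ
  near_top : ∀ a, ∀ z ∈ Icc (H - 1) H,
    X a z = (tipTop (top a).1).1 + (slopeTop a).1 * (H - z) ∧
      Y a z = (tipTop (top a).1).2 + (slopeTop a).2 * (H - z)
  near_bot : ∀ a, ∀ z ∈ Icc (-H) (-H + 1),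
    X a z = (tipBot (bot a).1).1 + (slopeBot a).1 * (z + H) ∧
      Y a z = (tipBot (bot a).1).2 + (slopeBot a).2 * (z + H)

/-- The descending piecewise linear function with the slopes `p`, `q`, `r` on `v ≤ 2`,
`2 ≤ v ≤ c + 2`, `c + 2 ≤ v` and the value `H` at `0`. -/
def descent (H p q r c v : ℝ) : ℝ :=
  H - (p * min v 2 + q * max 0 (min (v - 2) c) + r * max 0 (v - 2 - c))

theorem descent_fst {H p q r c v : ℝ} (hc : 0 ≤ c) (h : v ≤ 2) :
    descent H p q r c v = H - p * v := by
  unfold descent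
  rw [min_eq_left h, max_eq_left (min_le_of_left_le (by linarith)), max_eq_left (by linarith)]
  ring

theorem descent_snd {H p q r c v : ℝ} (h : 2 ≤ v) (h' : v ≤ c + 2) :
    descent H p q r c v = H - p * 2 - q * (v - 2) := by
  unfold descent
  rw [min_eq_right h, min_eq_left (by linarith), max_eq_right (by linarith),
    max_eq_left (by linarith)]
  ring

theorem descent_trd {H p q r c v : ℝ} (hc : 0 ≤ c) (h : c + 2 ≤ v) :
    descent H p q r c v = H - p * 2 - q * c - r * (v - 2 - c) := by
  unfold descent
  rw [min_eq_right (by linarith), min_eq_right (by linarith), max_eq_right hc,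
    max_eq_right (by linarith)]
  ring

theorem descent_sub {H p q r c v w : ℝ} (hvw : v ≤ w) (hc : 0 ≤ c) :
    ∃ d₁ d₂ d₃ : ℝ, 0 ≤ d₁ ∧ 0 ≤ d₂ ∧ 0 ≤ d₃ ∧ w - v = d₁ + d₂ + d₃ ∧
      descent H p q r c v - descent H p q r c w = p * d₁ + q * d₂ + r * d₃ := by
  refine ⟨min w 2 - min v 2, max 0 (min (w - 2) c) - max 0 (min (v - 2) c),
    max 0 (w - 2 - c) - max 0 (v - 2 - c), ?_, ?_, ?_, ?_, ?_⟩
  · exact sub_nonneg.2 (min_le_min_right _ hvw)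
  · exact sub_nonneg.2 (max_le_max le_rfl (min_le_min_right _ (by linarith)))
  · exact sub_nonneg.2 (max_le_max le_rfl (by linarith))
  · have key : ∀ u : ℝ, u = min u 2 + max 0 (min (u - 2) c) + max 0 (u - 2 - c) := by
      intro u
      rcases le_total u 2 with h | h
      · rw [min_eq_left h, max_eq_left (min_le_of_left_le (by linarith)),
          max_eq_left (by linarith)]
        ring
      · rcases le_total u (c + 2) with h' | h'
        · rw [min_eq_right h, min_eq_left (by linarith), max_eq_right (by linarith),
            max_eq_left (by linarith)]
          ring
        · rw [min_eq_right h, min_eq_right (by linarith), max_eq_right hc,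
            max_eq_right (by linarith)]
          ring
    linarith [key v, key w]
  · unfold descent
    ring

theorem le_descent_sub {H p q r c v w : ℝ} (hvw : v ≤ w) (hc : 0 ≤ c) :
    min p (min q r) * (w - v) ≤ descent H p q r c v - descent H p q r c w := by
  obtain ⟨d₁, d₂, d₃, h1, h2, h3, h4, h5⟩ := descent_sub (H := H) (p := p) (q := q) (r := r) hvw hc
  rw [h4, h5, mul_add, mul_add]
  exact add_le_add (add_le_add (mul_le_mul_of_nonneg_right (min_le_left _ _) h1)
    (mul_le_mul_of_nonneg_right ((min_le_right _ _).trans (min_le_left _ _)) h2))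
    (mul_le_mul_of_nonneg_right ((min_le_right _ _).trans (min_le_right _ _)) h3)

theorem descent_sub_le {H p q r c v w : ℝ} (hvw : v ≤ w) (hc : 0 ≤ c) :
    descent H p q r c v - descent H p q r c w ≤ max p (max q r) * (w - v) := by
  obtain ⟨d₁, d₂, d₃, h1, h2, h3, h4, h5⟩ := descent_sub (H := H) (p := p) (q := q) (r := r) hvw hc
  rw [h4, h5, mul_add, mul_add]
  exact add_le_add (add_le_add (mul_le_mul_of_nonneg_right (le_max_left _ _) h1)
    (mul_le_mul_of_nonneg_right ((le_max_left _ _).trans (le_max_right _ _)) h2))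
    (mul_le_mul_of_nonneg_right ((le_max_right _ _).trans (le_max_right _ _)) h3)

theorem lipschitzWith_descent {H p q r c : ℝ} (hp : 0 < p) (hq : 0 < q) (hr : 0 < r)
    (hc : 0 ≤ c) : LipschitzWith (Real.toNNReal (max p (max q r))) (descent H p q r c) := by
  have hM : 0 ≤ max p (max q r) := hp.le.trans (le_max_left _ _)
  have hm : 0 ≤ min p (min q r) := le_min hp.le (le_min hq.le hr.le)
  have key : ∀ v w, v ≤ w → dist (descent H p q r c v) (descent H p q r c w) ≤
      max p (max q r) * dist v w := by
    intro v w hvw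
    have h1 := le_descent_sub (H := H) (p := p) (q := q) (r := r) hvw hc
    have h2 := mul_nonneg hm (sub_nonneg.2 hvw)
    rw [Real.dist_eq, Real.dist_eq, abs_sub_comm v w, abs_of_nonneg (sub_nonneg.2 hvw),
      abs_of_nonneg (h2.trans h1)]
    exact descent_sub_le hvw hc
  refine LipschitzWith.of_dist_le_mul fun v w => ?_
  rw [Real.coe_toNNReal _ hM]
  rcases le_total v w with h | h
  · exact key v w h
  · rw [dist_comm, dist_comm v w]
    exact key w v h

/-! ### From a system of strands to a closed diagram. -/

namespace Strands

variable {A I : Type*} (S : Strands A I)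

/-- The point of the strand `a` at height `z`. -/
def pt (a : A) (z : ℝ) : Space := ![S.X a z, S.Y a z, z]

/-- Strands with different tips are strictly ordered near the tips. -/
theorem exists_margin [Finite A] [Finite I] : ∃ η : ℝ, 0 < η ∧ η ≤ 1 ∧
    (∀ a b, (S.tipTop (S.top a).1).1 < (S.tipTop (S.top b).1).1 →
      ∀ z ∈ Icc (S.H - η) S.H, S.X a z < S.X b z) ∧
    (∀ a b, (S.tipBot (S.bot a).1).1 < (S.tipBot (S.bot b).1).1 →
      ∀ z ∈ Icc (-S.H) (-S.H + η), S.X a z < S.X b z) := by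
  have key : ∀ t s : A → ℝ, ∃ η : ℝ, 0 < η ∧ ∀ a b, t a < t b → ∀ w, 0 ≤ w → w ≤ η →
      t a + s a * w < t b + s b * w := by
    intro t s
    have h1 : ∀ᶠ w in 𝓝[>] (0 : ℝ), ∀ c : A × A, t c.1 < t c.2 →
        ∀ w', 0 ≤ w' → w' ≤ w → t c.1 + s c.1 * w' < t c.2 + s c.2 * w' := by
      rw [Filter.eventually_all]
      rintro ⟨a, b⟩
      by_cases h : t a < t b
      -- Up to this distance the difference of slopes cannot make up for the gap between the tips;
      -- the summand `1` avoids division by zero.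
      · have hpos : 0 < (t b - t a) / (|s a - s b| + 1) := div_pos (by linarith) (by positivity)
        filter_upwards [Ioo_mem_nhdsGT hpos] with w hw _ w' h0 hw'
        have h3 : w * (|s a - s b| + 1) < t b - t a := by
          rw [← lt_div_iff₀ (by positivity)]
          exact hw.2
        nlinarith [le_abs_self (s a - s b), abs_nonneg (s a - s b), hw.1]
      · exact Filter.Eventually.of_forall fun w h' => absurd h' h
    obtain ⟨η, h2, h3⟩ := (h1.and self_mem_nhdsWithin).exists
    exact ⟨η, h3, fun a b h w h0 hw => h2 (a, b) h w h0 hw⟩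
  obtain ⟨η₁, h1, h2⟩ := key (fun a => (S.tipTop (S.top a).1).1) (fun a => (S.slopeTop a).1)
  obtain ⟨η₂, h3, h4⟩ := key (fun a => (S.tipBot (S.bot a).1).1) (fun a => (S.slopeBot a).1)
  have e1 : min 1 (min η₁ η₂) ≤ 1 := min_le_left _ _
  have e2 : min 1 (min η₁ η₂) ≤ η₁ := (min_le_right _ _).trans (min_le_left _ _)
  have e3 : min 1 (min η₁ η₂) ≤ η₂ := (min_le_right _ _).trans (min_le_right _ _)
  refine ⟨min 1 (min η₁ η₂), lt_min one_pos (lt_min h1 h3), e1, fun a b hab z hz => ?_,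
    fun a b hab z hz => ?_⟩
  · rw [(S.near_top a z ⟨by linarith [hz.1], hz.2⟩).1, (S.near_top b z ⟨by linarith [hz.1], hz.2⟩).1]
    exact h2 a b hab _ (by linarith [hz.2]) (by linarith [hz.1])
  · rw [(S.near_bot a z ⟨hz.1, by linarith [hz.2]⟩).1, (S.near_bot b z ⟨hz.1, by linarith [hz.2]⟩).1]
    exact h4 a b hab _ (by linarith [hz.1]) (by linarith [hz.2])

/-- Away from the tips the strands are uniformly separated. -/
theorem exists_separation [Finite A] {η : ℝ} (hη : 0 < η) : ∃ δ : ℝ, 0 < δ ∧ ∀ a b, a ≠ b →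
    ∀ z ∈ Icc (-(S.H - η)) (S.H - η), δ ≤ |S.X a z - S.X b z| ∨ δ ≤ |S.Y a z - S.Y b z| := by
  have key : ∀ c : A × A, ∃ δ : ℝ, 0 < δ ∧ (c.1 ≠ c.2 →
      ∀ z ∈ Icc (-(S.H - η)) (S.H - η), δ ≤ |S.X c.1 z - S.X c.2 z| ∨
        δ ≤ |S.Y c.1 z - S.Y c.2 z|) := by
    rintro ⟨a, b⟩
    by_cases hab : a = b
    · exact ⟨1, one_pos, fun h => absurd hab h⟩
    have hf : Continuous fun z => max |S.X a z - S.X b z| |S.Y a z - S.Y b z| :=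
      (((S.lipX a).continuous.sub (S.lipX b).continuous).abs).max
        (((S.lipY a).continuous.sub (S.lipY b).continuous).abs)
    rcases (Icc (-(S.H - η)) (S.H - η)).eq_empty_or_nonempty with he | hne
    · exact ⟨1, one_pos, fun _ z hz => by rw [he] at hz; exact hz.elim⟩
    obtain ⟨z₀, hz₀, hmin⟩ := isCompact_Icc.exists_isMinOn hne hf.continuousOn
    refine ⟨max |S.X a z₀ - S.X b z₀| |S.Y a z₀ - S.Y b z₀|, ?_, fun _ z hz => ?_⟩
    · by_contra hc
      have h1 := max_le_iff.1 (not_lt.1 hc)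
      exact S.disjoint a b hab z₀ ⟨by linarith [hz₀.1], by linarith [hz₀.2]⟩
        (sub_eq_zero.1 (abs_nonpos_iff.1 h1.1)) (sub_eq_zero.1 (abs_nonpos_iff.1 h1.2))
    · exact le_max_iff.1 (hmin hz)
  choose δ h0 h1 using key
  rcases isEmpty_or_nonempty (A × A) with he | hne
  · exact ⟨1, one_pos, fun a b _ => (he.false (a, b)).elim⟩
  obtain ⟨c, hc⟩ := Finite.exists_min δ
  refine ⟨δ c, h0 c, fun a b hab z hz => ?_⟩
  exact (h1 (a, b) hab z hz).imp (hc _).trans (hc _).trans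

/-- Every system of strands is isotopic to a closed diagram, with any number of additional twist
letters. -/
theorem exists_platData [Fintype A] [Nonempty A] [Finite I] {n : ℕ} (e : I ≃ Fin n) :
    ∃ (D : PlatData A n) (r s : I ≃ Fin n), 0 < D.K ∧ (∀ a, D.top a = (r (S.top a).1).val) ∧
      (∀ a, D.bot a = (s (S.bot a).1).val) ∧ ∀ T w, ∃ Φ : Space ≃ₜ Space, IsotopicToId Φ ∧
        ∀ a, Φ '' (S.pt a '' Icc (-S.H) S.H) =
          (D.extend T w).pt a '' Icc (0 : ℝ) (2 * (D.extend T w).K + 4) := by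
  obtain ⟨η, hη, hη1, htop, hbot⟩ := S.exists_margin
  obtain ⟨δ, hδ, hsep⟩ := S.exists_separation hη
  have hH := S.one_lt
  obtain ⟨r, hr⟩ := exists_ranking e fun i => (S.tipTop i).1
  obtain ⟨s, hs⟩ := exists_ranking e fun i => (S.tipBot i).1
  have hr' : ∀ i j, r i < r j → (S.tipTop i).1 < (S.tipTop j).1 := fun i j h =>
    lt_of_le_of_ne (hr i j h) fun h' => h.ne (by rw [S.tipTop_injective i j h'])
  have hs' : ∀ i j, s i < s j → (S.tipBot i).1 < (S.tipBot j).1 := fun i j h =>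
    lt_of_le_of_ne (hs i j h) fun h' => h.ne (by rw [S.tipBot_injective i j h'])
  -- The two strands at a tip must occupy a pair of positions joined by an arc. Inside the pair they
  -- are ordered by `X` at the inner end of the margin.
  obtain ⟨R, hR1, hR2⟩ := exists_block_ranking S.top r fun a => S.X a (S.H - η)
  obtain ⟨R', hR1', hR2'⟩ := exists_block_ranking S.bot s fun a => S.X a (-S.H + η)
  -- the order of the tips
  have hordT : ∀ a b, (R a).val / 2 < (R b).val / 2 → ∀ z ∈ Icc (S.H - η) S.H,
      S.X a z < S.X b z := by
    intro a b h
    rw [hR1, hR1] at h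
    exact htop a b (hr' _ _ h)
  have hordB : ∀ a b, (R' a).val / 2 < (R' b).val / 2 → ∀ z ∈ Icc (-S.H) (-S.H + η),
      S.X a z < S.X b z := by
    intro a b h
    rw [hR1', hR1'] at h
    exact hbot a b (hs' _ _ h)
  have hsameT : ∀ a b, (R a).val / 2 = (R b).val / 2 → (S.top a).1 = (S.top b).1 := by
    intro a b h
    rw [hR1, hR1] at h
    exact r.injective (Fin.ext h)
  have hsameB : ∀ a b, (R' a).val / 2 = (R' b).val / 2 → (S.bot a).1 = (S.bot b).1 := by
    intro a b h
    rw [hR1', hR1'] at h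
    exact s.injective (Fin.ext h)
  -- Time `0` to `1` runs through the heights from `H - η` down to `-(H - η)`, where the strands are
  -- uniformly separated.
  let ζ : ℝ → ℝ := fun t => (S.H - η) * (1 - 2 * t)
  have hζ : LipschitzWith (Real.toNNReal (2 * (S.H - η))) ζ := by
    refine LipschitzWith.of_dist_le_mul fun t t' => ?_
    rw [Real.coe_toNNReal _ (by linarith), Real.dist_eq, Real.dist_eq]
    have : ζ t - ζ t' = -(2 * (S.H - η)) * (t - t') := by
      dsimp only [ζ]
      ring
    rw [this, abs_mul, abs_neg, abs_of_nonneg (by linarith : 0 ≤ 2 * (S.H - η))]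
  obtain ⟨D, hK, hD0, hD1, hD⟩ := exists_platData_of_motion (fun a t => S.X a (ζ t))
    (fun a t => S.Y a (ζ t)) (S.C * Real.toNNReal (2 * (S.H - η)))
    (fun a => (S.lipX a).comp hζ) (fun a => (S.lipY a).comp hζ) δ hδ
    (fun a b hab t ht => hsep a b hab _ (by
      dsimp only [ζ]
      constructor <;> nlinarith [ht.1, ht.2])) R R'
    (by
      intro a b hab
      have : ζ 0 = S.H - η := by simp [ζ]
      rw [this]
      rcases lt_or_eq_of_le (Nat.div_le_div_right (c := 2) (Fin.lt_def.1 hab).le) with h | h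
      · exact (hordT a b h _ ⟨le_rfl, by linarith⟩).le
      · exact hR2 a b (hsameT a b h) hab)
    (by
      intro a b hab
      have : ζ 1 = -S.H + η := by simp only [ζ]; ring
      rw [this]
      rcases lt_or_eq_of_le (Nat.div_le_div_right (c := 2) (Fin.lt_def.1 hab).le) with h | h
      · exact (hordB a b h _ ⟨by linarith, le_rfl⟩).le
      · exact hR2' a b (hsameB a b h) hab)
  have hDtop : ∀ a, D.top a = (R a).val / 2 := fun a => by rw [PlatData.top, hD0]
  have hDbot : ∀ a, D.bot a = (R' a).val / 2 := fun a => by rw [PlatData.bot, hD1]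
  refine ⟨D, r, s, hK, fun a => by rw [hDtop, hR1], fun a => by rw [hDbot, hR1'], fun T w => ?_⟩
  have hK0 : (0 : ℝ) < D.K := by exact_mod_cast hK
  have hEK : ((D.extend T w).K : ℝ) = D.K + T := by
    change ((D.K + T : ℕ) : ℝ) = _
    push_cast
    rfl
  have hT0 : (0 : ℝ) ≤ T := Nat.cast_nonneg T
  -- the heights
  let h := descent S.H (η / 2) ((S.H - η) / D.K) (η / (2 * T + 2)) (2 * D.K)
  have hc : (0 : ℝ) ≤ 2 * D.K := by positivity
  have hp : 0 < η / 2 := by positivity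
  have hq : 0 < (S.H - η) / D.K := div_pos (by linarith) hK0
  have hq' : 0 < η / (2 * T + 2) := by positivity
  have h1 : ∀ v : ℝ, v ≤ 2 → h v = S.H - η / 2 * v := fun v hv => descent_fst hc hv
  have h2 : ∀ v : ℝ, 2 ≤ v → v ≤ 2 * D.K + 2 → h v = ζ ((v - 2) / (2 * D.K)) := by
    intro v hv hv'
    dsimp only [h, ζ]
    rw [descent_snd hv hv']
    field_simp
  have h3 : ∀ v : ℝ, 2 * D.K + 2 ≤ v → h v = -S.H + η / (2 * T + 2) * (2 * (D.K + T) + 4 - v) := by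
    intro v hv
    dsimp only [h]
    rw [descent_trd hc hv]
    field_simp
    ring
  have h3mem : ∀ v : ℝ, 2 * D.K + 2 ≤ v → v ≤ 2 * (D.K + T) + 4 →
      h v ∈ Icc (-S.H) (-S.H + η) := by
    intro v hv hv'
    rw [h3 v hv]
    have e1 : 0 ≤ η / (2 * T + 2) * (2 * (D.K + T) + 4 - v) := mul_nonneg hq'.le (by linarith)
    have e2 : η / (2 * T + 2) * (2 * (D.K + T) + 4 - v) ≤ η / (2 * T + 2) * (2 * T + 2) :=
      mul_le_mul_of_nonneg_left (by linarith) hq'.le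
    rw [div_mul_cancel₀ _ (by positivity)] at e2
    constructor <;> linarith
  have hlip := lipschitzWith_descent (H := S.H) hp hq hq' hc
  obtain ⟨C, hC⟩ : ∃ C, C = Real.toNNReal (max (η / 2) (max ((S.H - η) / D.K)
    (η / (2 * T + 2)))) := ⟨_, rfl⟩
  rw [← hC] at hlip
  obtain ⟨Φ, hΦ, hΦ'⟩ := (D.extend T w).exists_isotopy (Nat.add_pos_left hK T)
    (fun a v => S.X a (h v)) (fun a v => S.Y a (h v)) h (max (S.C * C) C)
    (fun a => ((S.lipX a).comp hlip).weaken (le_max_left _ _))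
    (fun a => ((S.lipY a).comp hlip).weaken (le_max_left _ _)) (hlip.weaken (le_max_right _ _))
    (min (η / 2) (min ((S.H - η) / D.K) (η / (2 * T + 2)))) (lt_min hp (lt_min hq hq'))
    (fun v w hvw => le_descent_sub hvw hc)
    (by
      intro a b hab v hv
      rw [D.extend_top, D.extend_top, hDtop, hDtop] at hab
      rw [h1 v hv.2]
      exact hordT a b hab _ ⟨by nlinarith [hv.2], by nlinarith [hv.1]⟩)
    (by
      intro a b hab v hv
      rw [D.extend_top, D.extend_top, hDtop, hDtop] at hab
      have e0 := hsameT a b hab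
      have e1 : ∀ v ∈ Icc (0 : ℝ) 2, S.H - η / 2 * v ∈ Icc (S.H - 1) S.H := fun v hv =>
        ⟨by nlinarith [hv.2], by nlinarith [hv.1]⟩
      have e2 : (2 : ℝ) ∈ Icc (0 : ℝ) 2 := ⟨by norm_num, le_rfl⟩
      rw [h1 v hv.2, h1 2 le_rfl, (S.near_top a _ (e1 v hv)).1, (S.near_top a _ (e1 v hv)).2,
        (S.near_top b _ (e1 v hv)).1, (S.near_top b _ (e1 v hv)).2,
        (S.near_top a _ (e1 2 e2)).1, (S.near_top a _ (e1 2 e2)).2,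
        (S.near_top b _ (e1 2 e2)).1, (S.near_top b _ (e1 2 e2)).2, e0]
      constructor <;> ring)
    (by
      intro a b hab v hv
      rw [D.extend_bot, D.extend_bot, hDbot, hDbot] at hab
      rw [hEK] at hv
      exact hordB a b hab _ (h3mem v (by linarith [hv.1]) hv.2))
    (by
      intro a b hab v hv
      rw [D.extend_bot, D.extend_bot, hDbot, hDbot] at hab
      rw [hEK] at hv ⊢
      have e0 := hsameB a b hab
      have e1 : ∀ v : ℝ, 2 * D.K + 2 ≤ v → v ≤ 2 * (D.K + T) + 4 → h v ∈ Icc (-S.H) (-S.H + 1) :=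
        fun v hv hv' => ⟨(h3mem v hv hv').1, by linarith [(h3mem v hv hv').2]⟩
      have m1 : (2 * D.K + 2 : ℝ) ≤ v := by linarith [hv.1]
      have m2 : (2 * D.K + 2 : ℝ) ≤ 2 * (D.K + T) + 2 := by linarith
      have m3 : (2 * (D.K + T) + 2 : ℝ) ≤ 2 * (D.K + T) + 4 := by linarith
      rw [(S.near_bot a _ (e1 v m1 hv.2)).1, (S.near_bot a _ (e1 v m1 hv.2)).2,
        (S.near_bot b _ (e1 v m1 hv.2)).1, (S.near_bot b _ (e1 v m1 hv.2)).2,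
        (S.near_bot a _ (e1 _ m2 m3)).1, (S.near_bot a _ (e1 _ m2 m3)).2,
        (S.near_bot b _ (e1 _ m2 m3)).1, (S.near_bot b _ (e1 _ m2 m3)).2, e0, h3 v m1, h3 _ m2]
      constructor <;> ring)
    (by
      intro k hk a b hab hab' v hv
      rcases Nat.lt_or_ge k D.K with hkK | hkK
      · rw [D.extend_ρ T w hkK.le] at hab
        rw [D.extend_ρ T w hkK] at hab'
        have hkK' : (k : ℝ) + 1 ≤ D.K := by exact_mod_cast hkK
        rw [h2 v (by linarith [hv.1, Nat.cast_nonneg (α := ℝ) k]) (by linarith [hv.2])]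
        refine (hD k hkK _ ⟨?_, ?_⟩ a b hab).1 hab'
        · rw [div_le_div_iff₀ hK0 (by positivity)]
          nlinarith [hv.1]
        · rw [div_le_div_iff₀ (by positivity) hK0]
          nlinarith [hv.2]
      · rw [D.extend_ρ_of_le T w hkK, hD1] at hab
        have hk1 : (D.K : ℝ) ≤ k := by exact_mod_cast hkK
        have hk2 : (k : ℝ) + 1 ≤ D.K + T := by
          have : k + 1 ≤ D.K + T := hk
          exact_mod_cast this
        have m1 : (2 * D.K + 2 : ℝ) ≤ v := by linarith [hv.1]
        have m2 : v ≤ 2 * (D.K + T) + 4 := by linarith [hv.2]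
        have hm := h3mem v m1 m2
        rcases lt_or_eq_of_le (Nat.div_le_div_right (c := 2) (Fin.lt_def.1 hab).le) with hl | hl
        · have := hordB a b hl _ hm
          exact (sub_neg.2 this).trans_le (abs_nonneg _)
        -- In the twist layers, strands with the same lower tip have relative position equal to the
        -- difference of slopes times the height above the tip. The ranking makes the first
        -- component nonpositive; if it is zero, disjointness makes the second one nonzero.
        · have e0 := hsameB a b hl
          have hle := hR2' a b e0 hab
          have mη : -S.H + η ∈ Icc (-S.H) (-S.H + 1) := ⟨by linarith, by linarith⟩
          have hab0 : a ≠ b := fun h => hab.ne (by rw [h])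
          have hne := S.disjoint a b hab0 (-S.H + η) ⟨by linarith, by linarith⟩
          have hpos : 0 < h v + S.H := by
            rw [h3 v m1]
            have : 0 < η / (2 * T + 2) * (2 * (D.K + T) + 4 - v) :=
              mul_pos hq' (by linarith [hv.2])
            linarith
          have mv : h v ∈ Icc (-S.H) (-S.H + 1) := ⟨hm.1, by linarith [hm.2]⟩
          rw [(S.near_bot a _ mη).1, (S.near_bot b _ mη).1, (S.near_bot a _ mη).2,
            (S.near_bot b _ mη).2, e0] at hne
          rw [(S.near_bot a _ mη).1, (S.near_bot b _ mη).1, e0] at hle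
          rw [(S.near_bot a _ mv).1, (S.near_bot b _ mv).1, (S.near_bot a _ mv).2,
            (S.near_bot b _ mv).2, e0]
          have hsl : (S.slopeBot a).1 ≤ (S.slopeBot b).1 := by nlinarith
          rcases lt_or_eq_of_le hsl with hlt | heq
          · refine lt_of_lt_of_le ?_ (abs_nonneg _)
            nlinarith
          · have hY : (S.slopeBot a).2 ≠ (S.slopeBot b).2 := fun h => hne (by rw [heq]) (by rw [h])
            rw [heq, sub_self, abs_pos]
            have : ((S.tipBot (S.bot b).1).2 + (S.slopeBot a).2 * (h v + S.H)) -
                ((S.tipBot (S.bot b).1).2 + (S.slopeBot b).2 * (h v + S.H)) =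
                ((S.slopeBot a).2 - (S.slopeBot b).2) * (h v + S.H) := by ring
            rw [this]
            exact mul_ne_zero (sub_ne_zero.2 hY) hpos.ne')
    (by
      intro k hk a b hab hab' v hv
      rcases Nat.lt_or_ge k D.K with hkK | hkK
      · rw [D.extend_ρ T w hkK.le] at hab
        rw [D.extend_ρ T w hkK] at hab'
        have hkK' : (k : ℝ) + 1 ≤ D.K := by exact_mod_cast hkK
        rw [h2 v (by linarith [hv.1, Nat.cast_nonneg (α := ℝ) k]) (by linarith [hv.2]),
          D.extend_l T w hkK]
        refine (hD k hkK _ ⟨?_, ?_⟩ a b hab).2 hab'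
        · rw [div_le_div_iff₀ hK0 (by positivity)]
          nlinarith [hv.1]
        · rw [div_le_div_iff₀ (by positivity) hK0]
          nlinarith [hv.2]
      · rw [D.extend_ρ_of_le T w hkK] at hab
        rw [D.extend_ρ_of_le T w (hkK.trans (Nat.le_succ k))] at hab'
        exact absurd hab (not_lt.2 hab'.le))
  refine ⟨Φ, hΦ, fun a => ?_⟩
  -- The reparametrized strands are the full strands, by the intermediate value theorem for the
  -- decreasing function `h`.
  have himg : h '' Icc (0 : ℝ) (2 * (D.extend T w).K + 4) = Icc (-S.H) S.H := by
    rw [hEK]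
    have e0 : h 0 = S.H := by rw [h1 0 (by norm_num)]; ring
    have e1 : h (2 * (D.K + T) + 4) = -S.H := by rw [h3 _ (by linarith)]; ring
    have hanti : ∀ v w, v ≤ w → h w ≤ h v := by
      intro v w hvw
      have e2 := le_descent_sub (H := S.H) (p := η / 2) (q := (S.H - η) / D.K)
        (r := η / (2 * T + 2)) hvw hc
      have e3 := mul_nonneg (le_min hp.le (le_min hq.le hq'.le)) (sub_nonneg.2 hvw)
      exact sub_nonneg.1 (e3.trans e2)
    apply Subset.antisymm
    · rintro _ ⟨v, hv, rfl⟩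
      exact ⟨e1 ▸ hanti _ _ hv.2, e0 ▸ hanti _ _ hv.1⟩
    · have := intermediate_value_Icc' (f := h) (by positivity : (0 : ℝ) ≤ 2 * (D.K + T) + 4)
        hlip.continuous.continuousOn
      rwa [e0, e1] at this
  rw [← himg, image_image, image_image]
  exact image_congr fun v hv => hΦ' a v hv

end Strands

/-! ### Polygons in general position -/

section Generic

/-- The value `γ` avoids the finitely many roots of the nonzero polynomials in the family, so only
identically zero polynomials vanish there. -/
theorem exists_generic {ι : Type*} [Finite ι] (a b c : ι → ℝ) :
    ∃ γ : ℝ, ∀ i, a i + γ * b i + γ ^ 2 * c i = 0 → a i = 0 ∧ b i = 0 ∧ c i = 0 := by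
  open Polynomial in
  let p : ι → ℝ[X] := fun i => C (a i) + C (b i) * X + C (c i) * X ^ 2
  have hfin : (⋃ i, ((p i).roots.toFinset : Set ℝ)).Finite :=
    Set.finite_iUnion fun i => Finset.finite_toSet _
  obtain ⟨γ, hγ⟩ := hfin.infinite_compl.nonempty
  refine ⟨γ, fun i h => ?_⟩
  have h0 : (p i).eval γ = 0 := by
    simp only [p, Polynomial.eval_add, Polynomial.eval_mul, Polynomial.eval_C, Polynomial.eval_X,
      Polynomial.eval_pow]
    linarith
  have hp : p i = 0 := by
    by_contra hne
    apply hγ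
    rw [mem_iUnion]
    exact ⟨i, by simpa [hne] using h0⟩
  have h1 := congrArg (fun q => Polynomial.coeff q 0) hp
  have h2 := congrArg (fun q => Polynomial.coeff q 1) hp
  have h3 := congrArg (fun q => Polynomial.coeff q 2) hp
  simp [p, Polynomial.coeff_X, Polynomial.coeff_C, Polynomial.coeff_X_pow] at h1 h2 h3
  exact ⟨h1, h2, h3⟩

theorem exists_linear_shear (i j k : Fin 3) (hj : j ≠ i) (hk : k ≠ i) (p q : ℝ) :
    ∃ Φ : Space ≃ₜ Space, IsotopicToId Φ ∧ (∀ x, Φ x i = x i + (p * x j + q * x k)) ∧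
      (∀ x l, l ≠ i → Φ x l = x l) ∧
      ∀ (a b : Space) (s : ℝ), Φ (AffineMap.lineMap a b s) = AffineMap.lineMap (Φ a) (Φ b) s := by
  obtain ⟨Φ, h1, h2⟩ := exists_shear i (fun x => p * x j + q * x k)
    ((continuous_const.mul (continuous_apply j)).add (continuous_const.mul (continuous_apply k)))
    (fun x r => by simp [Function.update_of_ne hj, Function.update_of_ne hk])
  refine ⟨Φ, h1, fun x => by rw [h2, Function.update_self],
    fun x l hl => by rw [h2, Function.update_of_ne hl], fun a b s => ?_⟩
  ext l
  rw [h2, h2, h2, AffineMap.lineMap_apply_module, AffineMap.lineMap_apply_module]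
  by_cases hl : l = i
  · subst hl
    simp
    ring
  · simp [Function.update_of_ne hl]

end Generic

section GeneralPosition

variable {I : Type*} (nxt : I → I) (V : I → Space)

/-- The end points of the edge `k`: its source for `b = false` and its target for `b = true`. -/
def edgeEnd (b : Bool) (k : I) : I := if b then nxt k else k

/-- The edge `k`, parametrized from its source for `b = false` and from its target for
`b = true`. -/
def edge (b : Bool) (k : I) (s : ℝ) : Space :=
  AffineMap.lineMap (V (edgeEnd nxt b k)) (V (edgeEnd nxt (!b) k)) s

/-- The edges form simple closed polygons. -/
def IsSimple : Prop := ∀ k l, ∀ s ∈ Ico (0 : ℝ) 1, ∀ t ∈ Ico (0 : ℝ) 1,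
  edge nxt V false k s = edge nxt V false l t → k = l ∧ s = t

/-- General position with respect to the projection to the first two coordinates. -/
structure InGeneralPosition : Prop where
  simple : IsSimple nxt V
  fst_injective : ∀ k l, V k 0 = V l 0 → k = l
  trd_ne : ∀ k, V k 2 ≠ V (nxt k) 2
  vertex_proj : ∀ k l, ∀ s ∈ Icc (0 : ℝ) 1, V k 0 = edge nxt V false l s 0 →
    V k 1 = edge nxt V false l s 1 → V k = edge nxt V false l s

variable {nxt V}

theorem edge_apply (b : Bool) (k : I) (s : ℝ) (i : Fin 3) : edge nxt V b k s i =
    V (edgeEnd nxt b k) i + s * (V (edgeEnd nxt (!b) k) i - V (edgeEnd nxt b k) i) := by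
  unfold edge
  rw [AffineMap.lineMap_apply_module']
  simp
  ring

theorem edge_zero (b : Bool) (k : I) : edge nxt V b k 0 = V (edgeEnd nxt b k) := by
  simp [edge]

theorem edge_one (b : Bool) (k : I) : edge nxt V b k 1 = V (edgeEnd nxt (!b) k) := by
  simp [edge]

theorem edge_not (b : Bool) (k : I) (s : ℝ) : edge nxt V (!b) k s = edge nxt V b k (1 - s) := by
  unfold edge
  rw [AffineMap.lineMap_apply_one_sub, Bool.not_not]

theorem continuous_edge (b : Bool) (k : I) : Continuous (edge nxt V b k) :=
  AffineMap.lineMap_continuous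

theorem exists_edge_false (b : Bool) (k : I) {s : ℝ} (hs : s ∈ Icc (0 : ℝ) 1) :
    ∃ t ∈ Icc (0 : ℝ) 1, edge nxt V b k s = edge nxt V false k t := by
  cases b with
  | false => exact ⟨s, hs, rfl⟩
  | true => exact ⟨1 - s, ⟨by linarith [hs.2], by linarith [hs.1]⟩, edge_not false k s⟩

namespace IsSimple

variable (h : IsSimple nxt V)
include h

theorem injective {k l : I} (hkl : V k = V l) : k = l :=
  (h k l 0 (by simp) 0 (by simp) (by rw [edge_zero, edge_zero]; exact hkl)).1

theorem nxt_ne (k : I) : nxt k ≠ k := by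
  intro hk
  have := (h k k 0 (by simp) (1 / 2) (by norm_num) (by simp [edge, edgeEnd, hk])).2
  norm_num at this

/-- Two edges with the same pair of ends would share their midpoint, so there are no bigons. -/
theorem nxt_nxt_ne (k : I) : nxt (nxt k) ≠ k := by
  intro hk
  refine h.nxt_ne k (h (nxt k) k (1 / 2) (by norm_num) (1 / 2) (by norm_num) ?_).1
  have := edge_not (nxt := nxt) (V := V) false k (1 / 2)
  rw [show (1 : ℝ) - 1 / 2 = 1 / 2 by norm_num] at this
  rw [← this]
  simp [edge, edgeEnd, hk]

theorem end_ne (b : Bool) (k : I) : edgeEnd nxt (!b) k ≠ edgeEnd nxt b k := by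
  cases b with
  | false => exact h.nxt_ne k
  | true => exact (h.nxt_ne k).symm

theorem vertex_on_edge {j l : I} {b : Bool} {s : ℝ} (hs : s ∈ Icc (0 : ℝ) 1)
    (hj : V j = edge nxt V b l s) : j = edgeEnd nxt b l ∧ s = 0 ∨ j = edgeEnd nxt (!b) l ∧ s = 1 := by
  have key : ∀ t ∈ Icc (0 : ℝ) 1, V j = edge nxt V false l t → j = l ∧ t = 0 ∨ j = nxt l ∧ t = 1 := by
    intro t ht hj
    rcases eq_or_lt_of_le ht.2 with h1 | h1
    · subst h1
      rw [edge_one] at hj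
      exact Or.inr ⟨h.injective hj, rfl⟩
    · have := h j l 0 (by simp) t ⟨ht.1, h1⟩ (by rw [edge_zero]; exact hj)
      exact Or.inl ⟨this.1, this.2.symm⟩
  cases b with
  | false => exact key s hs hj
  | true =>
    rw [show edge nxt V true l s = edge nxt V false l (1 - s) from edge_not false l s] at hj
    rcases key _ ⟨by linarith [hs.2], by linarith [hs.1]⟩ hj with ⟨h1, h2⟩ | ⟨h1, h2⟩
    · exact Or.inr ⟨h1, by linarith⟩
    · exact Or.inl ⟨h1, by linarith⟩

theorem edge_injective {k : I} {b : Bool} {s t : ℝ}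
    (hst : edge nxt V b k s = edge nxt V b k t) : s = t := by
  have hne : V (edgeEnd nxt b k) ≠ V (edgeEnd nxt (!b) k) := fun h' =>
    h.end_ne b k (h.injective h').symm
  exact AffineMap.lineMap_injective ℝ hne hst

/-- Interior points lie on a unique edge, and a vertex lies on an edge only as one of its ends. So
different edges meet at most in end points. -/
theorem edge_eq_edge {k l : I} {b b' : Bool} {s t : ℝ} (hs : s ∈ Icc (0 : ℝ) 1)
    (ht : t ∈ Icc (0 : ℝ) 1) (hst : edge nxt V b k s = edge nxt V b' l t) :
    k = l ∨ (s = 0 ∨ s = 1) ∧ (t = 0 ∨ t = 1) := by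
  have hend : ∀ {k l : I} {b b' : Bool} {s t : ℝ}, t ∈ Icc (0 : ℝ) 1 → s = 0 ∨ s = 1 →
      edge nxt V b k s = edge nxt V b' l t → t = 0 ∨ t = 1 := by
    intro k l b b' s t ht hs hst
    rcases hs with rfl | rfl
    · rw [edge_zero] at hst
      exact (h.vertex_on_edge ht hst).imp And.right And.right
    · rw [edge_one] at hst
      exact (h.vertex_on_edge ht hst).imp And.right And.right
  by_cases h1 : s = 0 ∨ s = 1
  · exact Or.inr ⟨h1, hend ht h1 hst⟩
  by_cases h2 : t = 0 ∨ t = 1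
  · exact Or.inr ⟨hend hs h2 hst.symm, h2⟩
  left
  rw [not_or] at h1 h2
  have hs' : s ∈ Ioo (0 : ℝ) 1 := ⟨lt_of_le_of_ne hs.1 (Ne.symm h1.1), lt_of_le_of_ne hs.2 h1.2⟩
  have ht' : t ∈ Ioo (0 : ℝ) 1 := ⟨lt_of_le_of_ne ht.1 (Ne.symm h2.1), lt_of_le_of_ne ht.2 h2.2⟩
  have key : ∀ (b : Bool) (k : I) (s : ℝ), s ∈ Ioo (0 : ℝ) 1 →
      ∃ s' ∈ Ico (0 : ℝ) 1, edge nxt V b k s = edge nxt V false k s' := by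
    intro b k s hs
    cases b with
    | false => exact ⟨s, ⟨hs.1.le, hs.2⟩, rfl⟩
    | true => exact ⟨1 - s, ⟨by linarith [hs.2], by linarith [hs.1]⟩, edge_not false k s⟩
  obtain ⟨s', m1, e1⟩ := key b k s hs'
  obtain ⟨t', m2, e2⟩ := key b' l t ht'
  exact (h k l s' m1 t' m2 (by rw [← e1, ← e2, hst])).1

/-- Different edges at the same vertex have different far ends. -/
theorem far_end_ne {k l : I} (hkl : k ≠ l) {b b' : Bool}
    (hb : edgeEnd nxt b k = edgeEnd nxt b' l) : edgeEnd nxt (!b) k ≠ edgeEnd nxt (!b') l := by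
  intro hf
  cases b <;> cases b' <;> simp [edgeEnd] at hb hf
  · exact hkl hb
  · exact h.nxt_nxt_ne k (by rw [hf, hb])
  · exact h.nxt_nxt_ne k (by rw [hb, hf])
  · exact hkl hf

theorem far_end_not_on_edge {k l : I} (hkl : k ≠ l) {b b' : Bool}
    (hb : edgeEnd nxt b k = edgeEnd nxt b' l) {s : ℝ} (hs : s ∈ Icc (0 : ℝ) 1) :
    V (edgeEnd nxt (!b) k) ≠ edge nxt V b' l s := by
  intro hf
  rcases h.vertex_on_edge hs hf with ⟨h1, -⟩ | ⟨h1, -⟩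
  · rw [← hb] at h1
    exact h.end_ne b k h1
  · exact h.far_end_ne hkl hb h1

theorem map {Φ : Space ≃ₜ Space}
    (hΦ : ∀ (a b : Space) (s : ℝ), Φ (AffineMap.lineMap a b s) = AffineMap.lineMap (Φ a) (Φ b) s) :
    IsSimple nxt (fun k => Φ (V k)) := by
  intro k l s hs t ht hst
  unfold edge at hst
  rw [← hΦ, ← hΦ] at hst
  exact h k l s hs t ht (Φ.injective hst)

/-- Polygons can be moved into general position. -/
theorem exists_general_position [Finite I] : ∃ (Φ : Space ≃ₜ Space) (W : I → Space),
    IsotopicToId Φ ∧ InGeneralPosition nxt W ∧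
      ∀ k s, Φ (edge nxt V false k s) = edge nxt W false k s := by
  -- The shear by `α y + α² z` turns each coordinate difference of two vertices into a polynomial in
  -- `α`; if it vanishes, the vertices coincide. This makes the first coordinates distinct.
  obtain ⟨α, hα⟩ := exists_generic (fun c : I × I => V c.1 0 - V c.2 0)
    (fun c => V c.1 1 - V c.2 1) (fun c => V c.1 2 - V c.2 2)
  obtain ⟨Φ₁, i1, a1, b1, c1⟩ := exists_linear_shear 0 1 2 (by decide) (by decide) α (α ^ 2)
  have hx : ∀ k l, Φ₁ (V k) 0 = Φ₁ (V l) 0 → k = l := by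
    intro k l hkl
    rw [a1, a1] at hkl
    obtain ⟨h0, h1, h2⟩ := hα (k, l) (by dsimp only; linarith)
    apply h.injective
    ext i
    fin_cases i
    · exact sub_eq_zero.1 h0
    · exact sub_eq_zero.1 h1
    · exact sub_eq_zero.1 h2
  -- Since the ends of an edge now differ in `x`, a shear of `z` by a multiple of `x` makes no edge
  -- horizontal, without touching `x`.
  obtain ⟨β, hβ⟩ := exists_generic (fun k : I => Φ₁ (V k) 2 - Φ₁ (V (nxt k)) 2)
    (fun k => Φ₁ (V k) 0 - Φ₁ (V (nxt k)) 0) (fun _ => 0)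
  obtain ⟨Φ₂, i2, a2, b2, c2⟩ := exists_linear_shear 2 0 1 (by decide) (by decide) β 0
  have hz : ∀ k, Φ₂ (Φ₁ (V k)) 2 ≠ Φ₂ (Φ₁ (V (nxt k))) 2 := by
    intro k hk
    rw [a2, a2] at hk
    have := (hβ k (by linarith)).2.1
    exact h.nxt_ne k (hx _ _ (sub_eq_zero.1 this)).symm
  let U : I → Space := fun k => Φ₂ (Φ₁ (V k))
  have hxU : ∀ k l, U k 0 = U l 0 → k = l := by
    intro k l hkl
    dsimp only [U] at hkl
    rw [b2 _ 0 (by decide), b2 _ 0 (by decide)] at hkl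
    exact hx k l hkl
  -- This is the only parameter at which the line of edge `l` has the first coordinate of vertex
  -- `k`. It suffices that a shear of `y` by a multiple of `z` separates these two points in `y`
  -- unless they agree.
  let σ : I → I → ℝ := fun k l => (U k 0 - U l 0) / (U (nxt l) 0 - U l 0)
  obtain ⟨γ, hγ⟩ := exists_generic
    (fun c : I × I => U c.1 1 - edge nxt U false c.2 (σ c.1 c.2) 1)
    (fun c => U c.1 2 - edge nxt U false c.2 (σ c.1 c.2) 2) (fun _ => 0)
  obtain ⟨Φ₃, i3, a3, b3, c3⟩ := exists_linear_shear 1 2 0 (by decide) (by decide) γ 0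
  have hline : ∀ (a b : Space) (s : ℝ), (Φ₁.trans (Φ₂.trans Φ₃)) (AffineMap.lineMap a b s) =
      AffineMap.lineMap ((Φ₁.trans (Φ₂.trans Φ₃)) a) ((Φ₁.trans (Φ₂.trans Φ₃)) b) s := by
    intro a b s
    simp only [Homeomorph.trans_apply, c1, c2, c3]
  have hedge : ∀ l s, edge nxt (fun k => Φ₃ (U k)) false l s = Φ₃ (edge nxt U false l s) :=
    fun l s => (c3 _ _ _).symm
  refine ⟨Φ₁.trans (Φ₂.trans Φ₃), fun k => Φ₃ (U k), i1.trans (i2.trans i3),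
    ⟨h.map hline, ?_, ?_, ?_⟩, fun k s => hline _ _ _⟩
  · intro k l hkl
    rw [b3 _ 0 (by decide), b3 _ 0 (by decide)] at hkl
    exact hxU k l hkl
  · intro k
    rw [b3 _ 2 (by decide), b3 _ 2 (by decide)]
    exact hz k
  · intro k l s hs h0 h1
    rw [hedge] at h0 h1 ⊢
    rw [b3 _ 0 (by decide), b3 _ 0 (by decide)] at h0
    rw [a3, a3] at h1
    have hne : U (nxt l) 0 - U l 0 ≠ 0 := sub_ne_zero.2 fun h' => h.nxt_ne l (hxU _ _ h')
    have hs' : s = σ k l := by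
      rw [eq_div_iff hne, h0, edge_apply]
      simp only [edgeEnd, Bool.not_false, if_true, Bool.false_eq_true, if_false]
      ring
    subst hs'
    obtain ⟨e1, e2, -⟩ := hγ (k, l) (by dsimp only; linarith)
    congr 1
    ext i
    fin_cases i
    · exact h0
    · exact sub_eq_zero.1 e1
    · exact sub_eq_zero.1 e2

end IsSimple

/-! ### Double points of the projection near the vertices. -/

namespace InGeneralPosition

variable (h : InGeneralPosition nxt V)
include h

theorem vertex_proj' {k l : I} {b : Bool} {s : ℝ} (hs : s ∈ Icc (0 : ℝ) 1)
    (h0 : V k 0 = edge nxt V b l s 0) (h1 : V k 1 = edge nxt V b l s 1) :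
    V k = edge nxt V b l s := by
  obtain ⟨t, ht, e⟩ := exists_edge_false (nxt := nxt) (V := V) b l hs
  rw [e] at h0 h1 ⊢
  exact h.vertex_proj k l t ht h0 h1

theorem slope_ne (b : Bool) (k : I) : V (edgeEnd nxt (!b) k) 0 - V (edgeEnd nxt b k) 0 ≠ 0 :=
  sub_ne_zero.2 fun h' => h.simple.end_ne b k (h.fst_injective _ _ h')

/-- If the projections of two edges from a common vertex met again, they would lie along one ray.
Rescaling would put the far end of one of them over the other edge, hence on it, contradicting
simplicity. -/
theorem proj_eq_of_same_end {k l : I} (hkl : k ≠ l) {b b' : Bool}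
    (hb : edgeEnd nxt b k = edgeEnd nxt b' l) {s t : ℝ} (hs : 0 ≤ s) (ht : 0 ≤ t)
    (h0 : edge nxt V b k s 0 = edge nxt V b' l t 0) (h1 : edge nxt V b k s 1 = edge nxt V b' l t 1) :
    edge nxt V b k s = edge nxt V b' l t := by
  have key : ∀ {k l : I}, k ≠ l → ∀ {b b' : Bool}, edgeEnd nxt b k = edgeEnd nxt b' l →
      ∀ {s t : ℝ}, 0 ≤ t → t ≤ s → edge nxt V b k s 0 = edge nxt V b' l t 0 →
      edge nxt V b k s 1 = edge nxt V b' l t 1 → s = 0 := by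
    intro k l hkl b b' hb s t ht hts h0 h1
    by_contra hs
    have hs' : 0 < s := lt_of_le_of_ne (ht.trans hts) (Ne.symm hs)
    refine h.simple.far_end_not_on_edge hkl hb (s := t / s)
      ⟨div_nonneg ht hs'.le, (div_le_one hs').2 hts⟩ ?_
    have e : ∀ i, edge nxt V b k s i = edge nxt V b' l t i →
        V (edgeEnd nxt (!b) k) i = edge nxt V b' l (t / s) i := by
      intro i hi
      rw [edge_apply, edge_apply, hb, add_right_inj] at hi
      rw [edge_apply, div_mul_eq_mul_div, ← hi, mul_div_cancel_left₀ _ hs]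
      ring
    exact h.vertex_proj' ⟨div_nonneg ht hs'.le, (div_le_one hs').2 hts⟩ (e 0 h0) (e 1 h1)
  have hst : s = 0 ∧ t = 0 := by
    rcases le_total t s with hts | hts
    · have := key hkl hb ht hts h0 h1
      exact ⟨this, le_antisymm (this ▸ hts) ht⟩
    · have := key hkl.symm hb.symm hs hts h0.symm h1.symm
      exact ⟨le_antisymm (this ▸ hts) hs, this⟩
  rw [hst.1, hst.2, edge_zero, edge_zero, hb]

theorem proj_eq_of_same_edge {k : I} {b b' : Bool} {s t : ℝ}
    (h0 : edge nxt V b k s 0 = edge nxt V b' k t 0) : edge nxt V b k s = edge nxt V b' k t := by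
  have key : ∀ {s t : ℝ}, edge nxt V b k s 0 = edge nxt V b k t 0 → s = t := by
    intro s t hst
    rw [edge_apply, edge_apply, add_right_inj] at hst
    exact mul_right_cancel₀ (h.slope_ne b k) hst
  by_cases hb : b' = b
  · subst hb
    rw [key h0]
  · obtain rfl : b' = !b := by cases b <;> cases b' <;> simp at hb ⊢
    rw [edge_not] at h0 ⊢
    rw [key h0]

/-- Near the vertices the projection has no double points. -/
theorem eventually_proj_eq [Finite I] : ∀ᶠ τ in 𝓝[>] (0 : ℝ),
    ∀ b k, ∀ s ∈ Icc 0 τ, ∀ b' l, ∀ t ∈ Icc (0 : ℝ) 1, edge nxt V b k s 0 = edge nxt V b' l t 0 →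
      edge nxt V b k s 1 = edge nxt V b' l t 1 → edge nxt V b k s = edge nxt V b' l t := by
  have main : ∀ b k b' l, ∀ᶠ τ in 𝓝[>] (0 : ℝ), ∀ s ∈ Icc 0 τ, ∀ t ∈ Icc (0 : ℝ) 1,
      edge nxt V b k s 0 = edge nxt V b' l t 0 →
      edge nxt V b k s 1 = edge nxt V b' l t 1 → edge nxt V b k s = edge nxt V b' l t := by
    intro b k b' l
    by_cases hkl : k = l
    · subst hkl
      exact Filter.Eventually.of_forall fun τ s _ t _ h0 _ => h.proj_eq_of_same_edge h0
    by_cases hb : edgeEnd nxt b k = edgeEnd nxt b' l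
    · exact Filter.Eventually.of_forall fun τ s hs t ht h0 h1 =>
        h.proj_eq_of_same_end hkl hb hs.1 ht.1 h0 h1
    by_cases hb' : edgeEnd nxt b k = edgeEnd nxt (!b') l
    · refine Filter.Eventually.of_forall fun τ s hs t ht h0 h1 => ?_
      have e : edge nxt V b' l t = edge nxt V (!b') l (1 - t) := by
        rw [edge_not, sub_sub_cancel]
      rw [e] at h0 h1 ⊢
      exact h.proj_eq_of_same_end hkl hb' hs.1 (by linarith [ht.2]) h0 h1
    -- The remaining edges do not contain the vertex, so its projection misses theirs; by
    -- compactness the same holds for all points close to it on edge `k`.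
    have hev : ∀ᶠ s in 𝓝 (0 : ℝ), ∀ t ∈ Icc (0 : ℝ) 1,
        ¬ (edge nxt V b k s 0 = edge nxt V b' l t 0 ∧ edge nxt V b k s 1 = edge nxt V b' l t 1) := by
      refine isCompact_Icc.eventually_forall_of_forall_eventually fun t ht => ?_
      have hc : ∀ i, IsClosed {z : ℝ × ℝ | edge nxt V b k z.1 i = edge nxt V b' l z.2 i} := fun i =>
        isClosed_eq ((continuous_apply i).comp ((continuous_edge b k).comp continuous_fst))
          ((continuous_apply i).comp ((continuous_edge b' l).comp continuous_snd))
      refine ((hc 0).inter (hc 1)).isOpen_compl.mem_nhds ?_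
      rintro ⟨h0, h1⟩
      simp only [mem_ofPred_eq, edge_zero] at h0 h1
      have := h.vertex_proj' ht h0 h1
      rcases h.simple.vertex_on_edge ht this with h2 | h2
      · exact hb h2.1
      · exact hb' h2.1
    obtain ⟨ε, hε, hball⟩ := Metric.eventually_nhds_iff.1 hev
    filter_upwards [Ioo_mem_nhdsGT hε] with τ hτ s hs t ht h0 h1
    refine absurd ⟨h0, h1⟩ (hball ?_ t ht)
    rw [Real.dist_eq, sub_zero, abs_of_nonneg hs.1]
    exact hs.2.trans_lt hτ.2
  have main' : ∀ᶠ τ in 𝓝[>] (0 : ℝ), ∀ b k b' l, ∀ s ∈ Icc 0 τ, ∀ t ∈ Icc (0 : ℝ) 1,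
      edge nxt V b k s 0 = edge nxt V b' l t 0 →
      edge nxt V b k s 1 = edge nxt V b' l t 1 → edge nxt V b k s = edge nxt V b' l t := by
    simp only [Filter.eventually_all]
    exact main
  filter_upwards [main'] with τ hτ b k s hs b' l t ht
  exact hτ b k b' l s hs t ht

/-- Points on the edges close to their ends have different first coordinates. -/
theorem eventually_fst_injective [Finite I] (lo : I → Bool) :
    ∀ᶠ τ in 𝓝[>] (0 : ℝ), ∀ k l,
      edge nxt V (lo k) k (τ / 2) 0 = edge nxt V (lo l) l (τ / 2) 0 → k = l := by
  simp only [Filter.eventually_all]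
  intro k l
  by_cases hkl : k = l
  · exact Filter.Eventually.of_forall fun _ _ => hkl
  by_cases hb : edgeEnd nxt (lo k) k = edgeEnd nxt (lo l) l
  -- For two edges from the same vertex, equal first coordinates at the same positive parameter
  -- would make those of the far ends equal.
  · filter_upwards [self_mem_nhdsWithin] with τ hτ hx
    have hτ' : (0 : ℝ) < τ := hτ
    rw [edge_apply, edge_apply, hb, add_right_inj] at hx
    have := h.fst_injective _ _ (sub_left_injective (mul_left_cancel₀ (by positivity) hx))
    exact absurd this (h.simple.far_end_ne hkl hb)
  · have hc : ∀ k, Continuous fun τ : ℝ => edge nxt V (lo k) k (τ / 2) 0 := fun k =>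
      (continuous_apply 0).comp ((continuous_edge _ k).comp (continuous_id.div_const 2))
    have hne : edge nxt V (lo k) k (0 / 2) 0 ≠ edge nxt V (lo l) l (0 / 2) 0 := by
      rw [zero_div, edge_zero, edge_zero]
      exact fun h' => hb (h.fst_injective _ _ h')
    filter_upwards [nhdsWithin_le_nhds
      ((isClosed_eq (hc k) (hc l)).isOpen_compl.mem_nhds hne)] with τ hτ hx
    exact absurd hx hτ

end InGeneralPosition

end GeneralPosition

/-! ### From polygons to strands -/

section Param

/-- The function that increases from `0` to `1` between `p` and `q`. -/
def ramp (p q z : ℝ) : ℝ := max 0 (min 1 (z / (q - p) - p / (q - p)))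

theorem ramp_of_le {p q z : ℝ} (hpq : p < q) (hz : z ≤ p) : ramp p q z = 0 := by
  unfold ramp
  rw [← sub_div]
  have : (z - p) / (q - p) ≤ 0 := div_nonpos_of_nonpos_of_nonneg (by linarith) (by linarith)
  exact max_eq_left (min_le_of_right_le this)

theorem ramp_of_ge {p q z : ℝ} (hpq : p < q) (hz : q ≤ z) : ramp p q z = 1 := by
  unfold ramp
  rw [← sub_div]
  have : 1 ≤ (z - p) / (q - p) := by
    rw [one_le_div (by linarith)]
    linarith
  rw [min_eq_left this]
  exact max_eq_right zero_le_one

theorem ramp_of_mem {p q z : ℝ} (hpq : p < q) (hz : z ∈ Icc p q) :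
    ramp p q z = (z - p) / (q - p) := by
  unfold ramp
  rw [← sub_div, min_eq_right, max_eq_right]
  · exact div_nonneg (by linarith [hz.1]) (by linarith)
  · rw [div_le_one (by linarith)]
    linarith [hz.2]

theorem exists_lipschitzWith_affine_comp {f : ℝ → ℝ} (hf : ∃ C, LipschitzWith C f) (c d : ℝ) :
    ∃ C, LipschitzWith C fun z => c + d * f z := by
  obtain ⟨C, hC⟩ := hf
  have h : LipschitzWith ‖d‖₊ fun x : ℝ => c + d * x := by
    refine LipschitzWith.of_dist_le_mul fun x y => ?_
    rw [Real.dist_eq, Real.dist_eq, coe_nnnorm, Real.norm_eq_abs, ← abs_mul]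
    apply le_of_eq
    congr 1
    ring
  exact ⟨_, h.comp hC⟩

theorem exists_lipschitzWith_ramp (p q : ℝ) : ∃ C, LipschitzWith C (ramp p q) := by
  obtain ⟨C, hC⟩ := exists_lipschitzWith_affine_comp ⟨1, LipschitzWith.id⟩ 0 (1 / (q - p))
  have h := (lipschitzWith_clamp (p / (q - p))).comp hC
  have e : ramp p q = (fun v : ℝ => max 0 (min 1 (v - p / (q - p)))) ∘
      fun z => 0 + 1 / (q - p) * id z := by
    funext z
    rw [Function.comp_apply, zero_add, one_div_mul_eq_div]
    rfl
  exact ⟨_, e ▸ h⟩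

/-- The parameter of the long part of an edge at height `z`. -/
def longParam (τ H z₁ z₂ z : ℝ) : ℝ :=
  τ / 2 + (τ / 2 * ramp (-H) z₁ z + ((1 - 2 * τ) * ramp z₁ z₂ z + τ * ramp z₂ H z))

variable {τ H z₁ z₂ z : ℝ}

/-- The parameter runs from `τ / 2` to `τ` on `[-H, z₁]`, to `1 - τ` on `[z₁, z₂]`, and to `1` on
`[z₂, H]`. Later `z₁` and `z₂` are the heights of the edge at `τ` and `1 - τ`, so the middle piece
keeps its height and only the ends are stretched. -/
theorem longParam_fst (h1 : -H < z₁) (h2 : z₁ < z₂) (h3 : z₂ < H) (hz : z ∈ Icc (-H) z₁) :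
    longParam τ H z₁ z₂ z = τ / 2 + τ / 2 * ((z + H) / (z₁ + H)) := by
  unfold longParam
  rw [ramp_of_mem h1 hz, ramp_of_le h2 hz.2, ramp_of_le h3 (hz.2.trans h2.le), sub_neg_eq_add,
    sub_neg_eq_add]
  ring

theorem longParam_snd (h1 : -H < z₁) (h2 : z₁ < z₂) (h3 : z₂ < H) (hz : z ∈ Icc z₁ z₂) :
    longParam τ H z₁ z₂ z = τ + (1 - 2 * τ) * ((z - z₁) / (z₂ - z₁)) := by
  unfold longParam
  rw [ramp_of_ge h1 hz.1, ramp_of_mem h2 hz, ramp_of_le h3 hz.2]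
  ring

theorem longParam_trd (h1 : -H < z₁) (h2 : z₁ < z₂) (h3 : z₂ < H) (hz : z ∈ Icc z₂ H) :
    longParam τ H z₁ z₂ z = 1 - τ * ((H - z) / (H - z₂)) := by
  have h4 : H - z₂ ≠ 0 := by linarith
  unfold longParam
  rw [ramp_of_ge h1 (h2.le.trans hz.1), ramp_of_ge h2 hz.1, ramp_of_mem h3 hz]
  field_simp
  ring

theorem longParam_strictMonoOn (hτ : 0 < τ) (hτ' : τ < 1 / 2) (h1 : -H < z₁) (h2 : z₁ < z₂)
    (h3 : z₂ < H) : StrictMonoOn (longParam τ H z₁ z₂) (Icc (-H) H) := by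
  have e1 : StrictMonoOn (longParam τ H z₁ z₂) (Icc (-H) z₁) := by
    intro v hv w hw hvw
    rw [longParam_fst h1 h2 h3 hv, longParam_fst h1 h2 h3 hw]
    have : (v + H) / (z₁ + H) < (w + H) / (z₁ + H) :=
      div_lt_div_of_pos_right (by linarith) (by linarith)
    nlinarith
  have e2 : StrictMonoOn (longParam τ H z₁ z₂) (Icc z₁ z₂) := by
    intro v hv w hw hvw
    rw [longParam_snd h1 h2 h3 hv, longParam_snd h1 h2 h3 hw]
    have : (v - z₁) / (z₂ - z₁) < (w - z₁) / (z₂ - z₁) :=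
      div_lt_div_of_pos_right (by linarith) (by linarith)
    nlinarith
  have e3 : StrictMonoOn (longParam τ H z₁ z₂) (Icc z₂ H) := by
    intro v hv w hw hvw
    rw [longParam_trd h1 h2 h3 hv, longParam_trd h1 h2 h3 hw]
    have : (H - w) / (H - z₂) < (H - v) / (H - z₂) :=
      div_lt_div_of_pos_right (by linarith) (by linarith)
    nlinarith
  have e4 := e1.union e2 (isGreatest_Icc h1.le) (isLeast_Icc h2.le)
  rw [Icc_union_Icc_eq_Icc h1.le h2.le] at e4
  have e5 := e4.union e3 (isGreatest_Icc (h1.trans h2).le) (isLeast_Icc h3.le)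
  rwa [Icc_union_Icc_eq_Icc (h1.trans h2).le h3.le] at e5

theorem exists_lipschitzWith_longParam (τ H z₁ z₂ : ℝ) :
    ∃ C, LipschitzWith C (longParam τ H z₁ z₂) := by
  obtain ⟨C₁, h1⟩ := exists_lipschitzWith_affine_comp (exists_lipschitzWith_ramp (-H) z₁)
    (τ / 2) (τ / 2)
  obtain ⟨C₂, h2⟩ := exists_lipschitzWith_affine_comp (exists_lipschitzWith_ramp z₁ z₂)
    0 (1 - 2 * τ)
  obtain ⟨C₃, h3⟩ := exists_lipschitzWith_affine_comp (exists_lipschitzWith_ramp z₂ H) 0 τ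
  refine ⟨C₁ + (C₂ + C₃), ?_⟩
  have e : longParam τ H z₁ z₂ = fun z => (τ / 2 + τ / 2 * ramp (-H) z₁ z) +
      ((0 + (1 - 2 * τ) * ramp z₁ z₂ z) + (0 + τ * ramp z₂ H z)) := by
    funext z
    unfold longParam
    ring
  rw [e]
  exact h1.add (h2.add h3)

end Param

/-- A function on a compact space that is constant on the fibres of a map to a normal Hausdorff
space comes from a continuous function on that space. -/
theorem exists_continuous_factor {Z Y : Type*} [TopologicalSpace Z] [CompactSpace Z]
    [TopologicalSpace Y] [T2Space Y] [NormalSpace Y] (q : Z → Y) (hq : Continuous q) (u : Z → ℝ)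
    (hu : Continuous u) (h : ∀ p p', q p = q p' → u p = u p') :
    ∃ ψ : Y → ℝ, Continuous ψ ∧ ∀ p, ψ (q p) = u p := by
  let q' : C(Z, range q) := ⟨rangeFactorization q, hq.subtype_mk _⟩
  -- A continuous map from a compact space onto a Hausdorff space is closed, hence a quotient map,
  -- so `u` descends to the compact image. Tietze's theorem extends it from there.
  have hquot : IsQuotientMap q' :=
    q'.continuous.isClosedMap.isQuotientMap q'.continuous rangeFactorization_surjective
  let v : C(range q, ℝ) := hquot.lift ⟨u, hu⟩ fun p p' hp => h p p' (congrArg Subtype.val hp)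
  obtain ⟨ψ, hψ⟩ := v.exists_restrict_eq (isCompact_range hq).isClosed
  refine ⟨ψ, ψ.continuous, fun p => ?_⟩
  have h1 := congrArg (fun g : C(range q, ℝ) => g (q' p)) hψ
  have h2 : v (q' p) = u p := congrArg (fun g : C(Z, ℝ) => g p)
    (hquot.lift_comp ⟨u, hu⟩ fun p p' hp => h p p' (congrArg Subtype.val hp))
  exact h1.trans h2

/-! ### Cutting every edge into a short and a long strand. -/

section Lift

variable {I : Type*} {nxt : I → I} {V : I → Space}

/-- The lower end of an edge. -/
def lowEnd (nxt : I → I) (V : I → Space) (k : I) : Bool := decide (V (nxt k) 2 < V k 2)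

/-- The edge `k`, parametrized from its lower end. -/
def upEdge (nxt : I → I) (V : I → Space) (k : I) (s : ℝ) : Space := edge nxt V (lowEnd nxt V k) k s

/-- The parameter of the point that is lifted to the height `z`, for the strand that starts at
the end `a.2` of the edge `a.1`. -/
def strandParam (nxt : I → I) (V : I → Space) (τ H : ℝ) (a : I × Bool) (z : ℝ) : ℝ :=
  -- The short strand runs from the lower vertex, at height `H`, down to the cut point `τ / 2`, at
  -- height `-H`. The long one runs from the cut point to the other vertex, again at height `H`.
  if a.2 = lowEnd nxt V a.1 then τ / (4 * H) * (H - z)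
  else longParam τ H (upEdge nxt V a.1 τ 2) (upEdge nxt V a.1 (1 - τ) 2) z

theorem strandParam_short {τ H : ℝ} {a : I × Bool} (ha : a.2 = lowEnd nxt V a.1) (z : ℝ) :
    strandParam nxt V τ H a z = τ / (4 * H) * (H - z) := if_pos ha

theorem strandParam_long {τ H : ℝ} {a : I × Bool} (ha : ¬ a.2 = lowEnd nxt V a.1) (z : ℝ) :
    strandParam nxt V τ H a z =
      longParam τ H (upEdge nxt V a.1 τ 2) (upEdge nxt V a.1 (1 - τ) 2) z := if_neg ha

theorem strandParam_top_short {τ H : ℝ} {a : I × Bool} (ha : a.2 = lowEnd nxt V a.1) :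
    strandParam nxt V τ H a H = 0 := by
  rw [strandParam_short ha]
  simp

/-- The point that is lifted to the height `z`. -/
def strandPoint (nxt : I → I) (V : I → Space) (τ H : ℝ) (a : I × Bool) (z : ℝ) : Space :=
  upEdge nxt V a.1 (strandParam nxt V τ H a z)

theorem exists_lipschitzWith_strandPoint [Finite I] (τ H : ℝ) :
    ∃ C, ∀ a i, LipschitzWith C fun z => strandPoint nxt V τ H a z i := by
  have h1 : ∀ c : (I × Bool) × Fin 3, ∃ C, LipschitzWith C fun z => strandPoint nxt V τ H c.1 z c.2 := by
    rintro ⟨a, i⟩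
    have h2 : ∃ C, LipschitzWith C (strandParam nxt V τ H a) := by
      by_cases ha : a.2 = lowEnd nxt V a.1
      · obtain ⟨C, hC⟩ := exists_lipschitzWith_affine_comp ⟨1, LipschitzWith.id⟩
          (τ / (4 * H) * H) (-(τ / (4 * H)))
        refine ⟨C, ?_⟩
        convert hC using 2 with z
        rw [strandParam_short ha, id]
        ring
      · obtain ⟨C, hC⟩ := exists_lipschitzWith_longParam τ H (upEdge nxt V a.1 τ 2)
          (upEdge nxt V a.1 (1 - τ) 2)
        refine ⟨C, ?_⟩
        convert hC using 1
        exact funext (strandParam_long ha)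
    obtain ⟨C, hC⟩ := exists_lipschitzWith_affine_comp h2
      (V (edgeEnd nxt (lowEnd nxt V a.1) a.1) i)
      (V (edgeEnd nxt (!lowEnd nxt V a.1) a.1) i - V (edgeEnd nxt (lowEnd nxt V a.1) a.1) i)
    refine ⟨C, ?_⟩
    convert hC using 2 with z
    unfold strandPoint upEdge
    rw [edge_apply]
    ring
  choose C hC using h1
  have := Fintype.ofFinite ((I × Bool) × Fin 3)
  exact ⟨Finset.univ.sup C, fun a i => (hC (a, i)).weaken (Finset.le_sup (Finset.mem_univ _))⟩

/-- The conditions on the sizes of the neighbourhoods of the vertices and of the tips. -/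
structure IsLiftable (nxt : I → I) (V : I → Space) (τ H : ℝ) : Prop where
  general : InGeneralPosition nxt V
  pos : 0 < τ
  lt_half : τ < 1 / 2
  proj : ∀ b k, ∀ s ∈ Icc 0 τ, ∀ b' l, ∀ t ∈ Icc (0 : ℝ) 1,
    edge nxt V b k s 0 = edge nxt V b' l t 0 → edge nxt V b k s 1 = edge nxt V b' l t 1 →
      edge nxt V b k s = edge nxt V b' l t
  tips : ∀ k l, upEdge nxt V k (τ / 2) 0 = upEdge nxt V l (τ / 2) 0 → k = l
  one_lt : 1 < H
  bound : ∀ k, |V k 2| ≤ H - 1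

theorem InGeneralPosition.exists_isLiftable [Finite I] (h : InGeneralPosition nxt V) :
    ∃ τ H, IsLiftable nxt V τ H := by
  have h1 : ∀ᶠ τ in 𝓝[>] (0 : ℝ), τ ∈ Ioo (0 : ℝ) (1 / 2) := Ioo_mem_nhdsGT (by norm_num)
  obtain ⟨τ, hτ, h2, h3⟩ := (h1.and (h.eventually_proj_eq.and
    (h.eventually_fst_injective (lowEnd nxt V)))).exists
  obtain ⟨B, hB⟩ := (Set.finite_range fun k => |V k 2|).bddAbove
  -- Keeping all vertices one unit inside `[-H, H]` leaves room near the tips where the strands are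
  -- affine.
  refine ⟨τ, max B 1 + 1, h, hτ.1, hτ.2, h2, h3, ?_, fun k => ?_⟩
  · linarith [le_max_right B 1]
  · rw [add_sub_cancel_right]
    exact (hB ⟨k, rfl⟩).trans (le_max_left _ _)

namespace IsLiftable

variable {τ H : ℝ} (h : IsLiftable nxt V τ H)
include h

theorem low_lt_high (k : I) :
    V (edgeEnd nxt (lowEnd nxt V k) k) 2 < V (edgeEnd nxt (!lowEnd nxt V k) k) 2 := by
  by_cases hk : V (nxt k) 2 < V k 2
  · simp [lowEnd, hk, edgeEnd]
  · simpa [lowEnd, hk, edgeEnd] using lt_of_le_of_ne (not_lt.1 hk) (h.general.trd_ne k)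

theorem levels (k : I) : -H + 1 ≤ upEdge nxt V k τ 2 ∧
    upEdge nxt V k τ 2 < upEdge nxt V k (1 - τ) 2 ∧ upEdge nxt V k (1 - τ) 2 ≤ H - 1 := by
  have h1 := h.low_lt_high k
  have h2 := abs_le.1 (h.bound (edgeEnd nxt (lowEnd nxt V k) k))
  have h3 := abs_le.1 (h.bound (edgeEnd nxt (!lowEnd nxt V k) k))
  have h4 := h.pos
  have h5 := h.lt_half
  unfold upEdge
  rw [edge_apply, edge_apply]
  refine ⟨by nlinarith, by nlinarith, by nlinarith⟩

theorem strictAntiOn_short {a : I × Bool} (ha : a.2 = lowEnd nxt V a.1) :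
    StrictAntiOn (strandParam nxt V τ H a) (Icc (-H) H) := by
  intro v _ w _ hvw
  rw [strandParam_short ha, strandParam_short ha]
  have : 0 < τ / (4 * H) := div_pos h.pos (by linarith [h.one_lt])
  nlinarith

theorem strictMonoOn_long {a : I × Bool} (ha : ¬ a.2 = lowEnd nxt V a.1) :
    StrictMonoOn (strandParam nxt V τ H a) (Icc (-H) H) := by
  obtain ⟨h1, h2, h3⟩ := h.levels a.1
  intro v hv w hw hvw
  rw [strandParam_long ha, strandParam_long ha]
  exact longParam_strictMonoOn h.pos h.lt_half (by linarith) h2 (by linarith) hv hw hvw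

theorem injOn_param (a : I × Bool) : InjOn (strandParam nxt V τ H a) (Icc (-H) H) := by
  by_cases ha : a.2 = lowEnd nxt V a.1
  · exact (h.strictAntiOn_short ha).injOn
  · exact (h.strictMonoOn_long ha).injOn

theorem param_bot (a : I × Bool) : strandParam nxt V τ H a (-H) = τ / 2 := by
  have hH : H ≠ 0 := by linarith [h.one_lt]
  by_cases ha : a.2 = lowEnd nxt V a.1
  · rw [strandParam_short ha]
    field_simp
    ring
  · obtain ⟨h1, h2, h3⟩ := h.levels a.1
    rw [strandParam_long ha, longParam_fst (by linarith) h2 (by linarith) ⟨le_rfl, by linarith⟩]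
    simp

theorem param_top_long {a : I × Bool} (ha : ¬ a.2 = lowEnd nxt V a.1) :
    strandParam nxt V τ H a H = 1 := by
  obtain ⟨h1, h2, h3⟩ := h.levels a.1
  rw [strandParam_long ha, longParam_trd (by linarith) h2 (by linarith) ⟨by linarith, le_rfl⟩]
  simp

theorem param_mem_short {a : I × Bool} (ha : a.2 = lowEnd nxt V a.1) {z : ℝ}
    (hz : z ∈ Icc (-H) H) : strandParam nxt V τ H a z ∈ Icc 0 (τ / 2) := by
  have hH := h.one_lt
  rw [← h.param_bot a, ← strandParam_top_short ha]
  exact ⟨(h.strictAntiOn_short ha).antitoneOn hz ⟨by linarith, le_rfl⟩ hz.2,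
    (h.strictAntiOn_short ha).antitoneOn ⟨le_rfl, by linarith⟩ hz hz.1⟩

theorem param_mem_long {a : I × Bool} (ha : ¬ a.2 = lowEnd nxt V a.1) {z : ℝ}
    (hz : z ∈ Icc (-H) H) : strandParam nxt V τ H a z ∈ Icc (τ / 2) 1 := by
  have hH := h.one_lt
  rw [← h.param_bot a, ← h.param_top_long ha]
  exact ⟨(h.strictMonoOn_long ha).monotoneOn ⟨le_rfl, by linarith⟩ hz hz.1,
    (h.strictMonoOn_long ha).monotoneOn hz ⟨by linarith, le_rfl⟩ hz.2⟩

theorem param_mem (a : I × Bool) {z : ℝ} (hz : z ∈ Icc (-H) H) :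
    strandParam nxt V τ H a z ∈ Icc (0 : ℝ) 1 := by
  have h1 := h.pos
  have h2 := h.lt_half
  by_cases ha : a.2 = lowEnd nxt V a.1
  · have := h.param_mem_short ha hz
    exact ⟨this.1, by linarith [this.2]⟩
  · have := h.param_mem_long ha hz
    exact ⟨by linarith [this.1], this.2⟩

theorem eq_top_of_param {a : I × Bool} {z : ℝ} (hz : z ∈ Icc (-H) H)
    (hs : strandParam nxt V τ H a z = 0 ∨ strandParam nxt V τ H a z = 1) : z = H := by
  have h1 := h.pos
  have h2 := h.lt_half
  have hH : H ∈ Icc (-H) H := ⟨by linarith [h.one_lt], le_rfl⟩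
  by_cases ha : a.2 = lowEnd nxt V a.1
  · have := h.param_mem_short ha hz
    rcases hs with hs | hs
    · exact h.injOn_param a hz hH (hs.trans (strandParam_top_short ha).symm)
    · linarith [this.2]
  · have := h.param_mem_long ha hz
    rcases hs with hs | hs
    · linarith [this.1]
    · exact h.injOn_param a hz hH (hs.trans (h.param_top_long ha).symm)

/-- The middle part of an edge keeps its height. -/
theorem height_of_mem {a : I × Bool} {z : ℝ} (hz : z ∈ Icc (-H) H)
    (hs : strandParam nxt V τ H a z ∈ Icc τ (1 - τ)) : strandPoint nxt V τ H a z 2 = z := by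
  have h0 := h.pos
  have h0' := h.lt_half
  by_cases ha : a.2 = lowEnd nxt V a.1
  · linarith [(h.param_mem_short ha hz).2, hs.1]
  obtain ⟨h1, h2, h3⟩ := h.levels a.1
  obtain ⟨z₁, e1⟩ : ∃ z₁, z₁ = upEdge nxt V a.1 τ 2 := ⟨_, rfl⟩
  obtain ⟨z₂, e2⟩ : ∃ z₂, z₂ = upEdge nxt V a.1 (1 - τ) 2 := ⟨_, rfl⟩
  have hlong := strandParam_long (τ := τ) (H := H) ha
  simp only [← e1, ← e2] at h1 h2 h3 hlong
  have m1 : z₁ ∈ Icc (-H) H := ⟨by linarith, by linarith⟩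
  have m2 : z₂ ∈ Icc (-H) H := ⟨by linarith, by linarith⟩
  have p1 : strandParam nxt V τ H a z₁ = τ := by
    rw [hlong, longParam_snd (by linarith) h2 (by linarith) ⟨le_rfl, h2.le⟩]
    simp
  have p2 : strandParam nxt V τ H a z₂ = 1 - τ := by
    rw [hlong, longParam_snd (by linarith) h2 (by linarith) ⟨h2.le, le_rfl⟩,
      div_self (by linarith)]
    ring
  have hz' : z ∈ Icc z₁ z₂ := by
    rw [← p2] at hs
    nth_rw 1 [← p1] at hs
    exact ⟨(h.strictMonoOn_long ha).le_iff_le m1 hz |>.1 hs.1,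
      (h.strictMonoOn_long ha).le_iff_le hz m2 |>.1 hs.2⟩
  unfold strandPoint
  rw [hlong, longParam_snd (by linarith) h2 (by linarith) hz']
  unfold upEdge at e1 e2 ⊢
  rw [edge_apply] at e1 e2 ⊢
  have hd : z₂ - z₁ = (1 - 2 * τ) * (V (edgeEnd nxt (!lowEnd nxt V a.1) a.1) 2 -
      V (edgeEnd nxt (lowEnd nxt V a.1) a.1) 2) := by
    rw [e1, e2]
    ring
  have hd' : (1 - 2 * τ) * ((z - z₁) / (z₂ - z₁)) * (V (edgeEnd nxt (!lowEnd nxt V a.1) a.1) 2 -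
      V (edgeEnd nxt (lowEnd nxt V a.1) a.1) 2) = z - z₁ := by
    have hne : z₂ - z₁ ≠ 0 := by linarith
    rw [mul_right_comm, ← hd, mul_div_cancel₀ _ hne]
  linarith

/-- The strands meet only at their tips. -/
theorem eq_of_point_eq {a b : I × Bool} {z w : ℝ} (hz : z ∈ Icc (-H) H) (hw : w ∈ Icc (-H) H)
    (he : strandPoint nxt V τ H a z = strandPoint nxt V τ H b w) :
    z = w ∧ (a = b ∨ z = H ∨ z = -H) := by
  have hH := h.one_lt
  have hbot : -H ∈ Icc (-H) H := ⟨le_rfl, by linarith⟩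
  unfold strandPoint upEdge at he
  -- The two strands of one edge share only the cut point, at height `-H`; strands of different
  -- edges share at most vertices, which are at height `H`.
  rcases h.general.simple.edge_eq_edge (h.param_mem a hz) (h.param_mem b hw) he with hk | ⟨h1, h2⟩
  · obtain ⟨k, c⟩ := a
    obtain ⟨l, d⟩ := b
    dsimp only at hk
    subst hk
    have hs := h.general.simple.edge_injective he
    by_cases hcd : c = d
    · subst hcd
      exact ⟨h.injOn_param _ hz hw hs, Or.inl rfl⟩
    · have hbot' : strandParam nxt V τ H (k, c) z = τ / 2 := by
        by_cases hc : c = lowEnd nxt V k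
        · have hd : ¬ d = lowEnd nxt V k := fun hd => hcd (hc.trans hd.symm)
          have e1 := h.param_mem_short (a := (k, c)) hc hz
          have e2 := h.param_mem_long (a := (k, d)) hd hw
          exact le_antisymm e1.2 (hs ▸ e2.1)
        · have hd : d = lowEnd nxt V k := by
            cases c <;> cases d <;> cases hl : lowEnd nxt V k <;> simp_all
          have e1 := h.param_mem_long (a := (k, c)) hc hz
          have e2 := h.param_mem_short (a := (k, d)) hd hw
          exact le_antisymm (hs ▸ e2.2) e1.1
      have e1 := h.injOn_param _ hz hbot (hbot'.trans (h.param_bot _).symm)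
      have e2 := h.injOn_param _ hw hbot ((hs.symm.trans hbot').trans (h.param_bot _).symm)
      exact ⟨e1.trans e2.symm, Or.inr (Or.inr e1)⟩
  · have e1 := h.eq_top_of_param hz h1
    have e2 := h.eq_top_of_param hw h2
    exact ⟨e1.trans e2.symm, Or.inr (Or.inl e1)⟩

/-- The change of the height is determined by the projection. -/
theorem height_sub_eq {a b : I × Bool} {z w : ℝ} (hz : z ∈ Icc (-H) H) (hw : w ∈ Icc (-H) H)
    (h0 : strandPoint nxt V τ H a z 0 = strandPoint nxt V τ H b w 0)
    (h1 : strandPoint nxt V τ H a z 1 = strandPoint nxt V τ H b w 1) :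
    z - strandPoint nxt V τ H a z 2 = w - strandPoint nxt V τ H b w 2 := by
  have key : ∀ {a b : I × Bool} {z w : ℝ}, z ∈ Icc (-H) H → w ∈ Icc (-H) H →
      strandPoint nxt V τ H a z 0 = strandPoint nxt V τ H b w 0 →
      strandPoint nxt V τ H a z 1 = strandPoint nxt V τ H b w 1 →
      strandParam nxt V τ H a z ∉ Icc τ (1 - τ) →
      z - strandPoint nxt V τ H a z 2 = w - strandPoint nxt V τ H b w 2 := by
    intro a b z w hz hw h0 h1 hs
    -- Outside the middle part of an edge, equal projections imply equal points of the link, and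
    -- these are lifted to equal heights. If both points lie in middle parts, neither height changes
    -- and both differences vanish.
    have hpt : strandPoint nxt V τ H a z = strandPoint nxt V τ H b w := by
      have m1 := h.param_mem a hz
      have m2 := h.param_mem b hw
      by_cases hlt : strandParam nxt V τ H a z < τ
      · exact h.proj _ _ _ ⟨m1.1, hlt.le⟩ _ _ _ m2 h0 h1
      · have hgt : 1 - τ < strandParam nxt V τ H a z := by
          by_contra hc
          exact hs ⟨not_lt.1 hlt, not_lt.1 hc⟩
        have e : strandPoint nxt V τ H a z =
            edge nxt V (!lowEnd nxt V a.1) a.1 (1 - strandParam nxt V τ H a z) := by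
          rw [edge_not, sub_sub_cancel]
          rfl
        rw [e] at h0 h1 ⊢
        exact h.proj _ _ _ ⟨by linarith [m1.2], by linarith⟩ _ _ _ m2 h0 h1
    rw [hpt, (h.eq_of_point_eq hz hw hpt).1]
  by_cases hs : strandParam nxt V τ H a z ∈ Icc τ (1 - τ)
  · by_cases ht : strandParam nxt V τ H b w ∈ Icc τ (1 - τ)
    · rw [h.height_of_mem hz hs, h.height_of_mem hw ht, sub_self, sub_self]
    · exact (key hw hz h0.symm h1.symm ht).symm
  · exact key hz hw h0 h1 hs

end IsLiftable

end Lift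

/-! ### The shear in the direction of the height and the resulting strands. -/

section Lift

variable {I : Type*} {nxt : I → I} {V : I → Space}

namespace IsLiftable

variable {τ H : ℝ} (h : IsLiftable nxt V τ H)
include h

/-- Within one unit of the top the parameter is affine in `z`, so the strand is straight there with
a slope given by its type, as a system of strands requires. -/
theorem point_near_top {a : I × Bool} {z : ℝ} (hz : z ∈ Icc (H - 1) H) (i : Fin 3) :
    strandPoint nxt V τ H a z i = V (edgeEnd nxt a.2 a.1) i +
      (if a.2 = lowEnd nxt V a.1 then τ / (4 * H) else τ / (H - upEdge nxt V a.1 (1 - τ) 2)) *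
      (V (edgeEnd nxt (!a.2) a.1) i - V (edgeEnd nxt a.2 a.1) i) * (H - z) := by
  unfold strandPoint upEdge
  rw [edge_apply]
  split_ifs with ha
  · rw [strandParam_short ha, ← ha]
    ring
  · obtain ⟨h1, h2, h3⟩ := h.levels a.1
    have hn : lowEnd nxt V a.1 = !a.2 := by
      cases h2 : a.2 <;> cases hl : lowEnd nxt V a.1 <;> simp_all
    rw [strandParam_long ha, longParam_trd (by linarith) h2 (by linarith)
      ⟨by linarith [hz.1], hz.2⟩, hn, Bool.not_not]
    unfold upEdge
    rw [hn]
    ring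

theorem point_near_bot {a : I × Bool} {z : ℝ} (hz : z ∈ Icc (-H) (-H + 1)) (i : Fin 3) :
    strandPoint nxt V τ H a z i = upEdge nxt V a.1 (τ / 2) i +
      (if a.2 = lowEnd nxt V a.1 then -(τ / (4 * H)) else τ / 2 / (upEdge nxt V a.1 τ 2 + H)) *
      (V (edgeEnd nxt (!lowEnd nxt V a.1) a.1) i - V (edgeEnd nxt (lowEnd nxt V a.1) a.1) i) *
      (z + H) := by
  have hH : H ≠ 0 := by linarith [h.one_lt]
  unfold strandPoint upEdge
  rw [edge_apply, edge_apply]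
  split_ifs with ha
  · rw [strandParam_short ha]
    field_simp
    ring
  · obtain ⟨h1, h2, h3⟩ := h.levels a.1
    rw [strandParam_long ha, longParam_fst (by linarith) h2 (by linarith)
      ⟨hz.1, by linarith [hz.2]⟩]
    unfold upEdge
    ring

/-- By the intermediate value theorem the short strand covers the parameters in `[0, τ / 2]` and the
long one those in `[τ / 2, 1]`. -/
theorem image_edge (k : I) : edge nxt V false k '' Icc (0 : ℝ) 1 =
    ⋃ c, strandPoint nxt V τ H (k, c) '' Icc (-H) H := by
  have hH := h.one_lt
  have hτ := h.pos
  apply Subset.antisymm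
  · rintro _ ⟨s, hs, rfl⟩
    obtain ⟨t, ht, e⟩ : ∃ t ∈ Icc (0 : ℝ) 1, edge nxt V false k s = upEdge nxt V k t := by
      unfold upEdge
      cases lowEnd nxt V k with
      | false => exact ⟨s, hs, rfl⟩
      | true =>
        refine ⟨1 - s, ⟨by linarith [hs.2], by linarith [hs.1]⟩, ?_⟩
        rw [show edge nxt V true k (1 - s) = edge nxt V false k (1 - (1 - s)) from edge_not false k (1 - s),
          sub_sub_cancel]
    rw [e, mem_iUnion]
    have hcont : ∀ a, ContinuousOn (strandParam nxt V τ H a) (Icc (-H) H) := by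
      intro a
      by_cases ha : a.2 = lowEnd nxt V a.1
      · have : strandParam nxt V τ H a = fun z => τ / (4 * H) * (H - z) :=
          funext (strandParam_short ha)
        rw [this]
        fun_prop
      · have : strandParam nxt V τ H a = _ := funext (strandParam_long ha)
        rw [this]
        obtain ⟨C, hC⟩ := exists_lipschitzWith_longParam τ H (upEdge nxt V a.1 τ 2)
          (upEdge nxt V a.1 (1 - τ) 2)
        exact hC.continuous.continuousOn
    rcases le_total t (τ / 2) with htτ | htτ
    · have := intermediate_value_Icc' (by linarith : -H ≤ H) (hcont (k, lowEnd nxt V k))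
      rw [h.param_bot, strandParam_top_short rfl] at this
      obtain ⟨z, hz, hzt⟩ := this ⟨ht.1, htτ⟩
      exact ⟨_, z, hz, by rw [strandPoint, hzt]⟩
    · have := intermediate_value_Icc (by linarith : -H ≤ H) (hcont (k, !lowEnd nxt V k))
      rw [h.param_bot, h.param_top_long (by simp)] at this
      obtain ⟨z, hz, hzt⟩ := this ⟨htτ, ht.2⟩
      exact ⟨_, z, hz, by rw [strandPoint, hzt]⟩
  · refine iUnion_subset fun c => ?_
    rintro _ ⟨z, hz, rfl⟩
    obtain ⟨t, ht, e⟩ := exists_edge_false (nxt := nxt) (V := V) (lowEnd nxt V k) k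
      (h.param_mem (k, c) hz)
    exact ⟨t, ht, e.symm⟩

/-- The lift of the strands to their heights. -/
theorem exists_lift [Finite I] : ∃ Φ : Space ≃ₜ Space, IsotopicToId Φ ∧
    ∀ a, ∀ z ∈ Icc (-H) H, Φ (strandPoint nxt V τ H a z) =
      ![strandPoint nxt V τ H a z 0, strandPoint nxt V τ H a z 1, z] := by
  obtain ⟨C, hC⟩ := exists_lipschitzWith_strandPoint (nxt := nxt) (V := V) τ H
  have hcont : ∀ i, Continuous fun p : Σ _ : I × Bool, Icc (-H) H =>
      strandPoint nxt V τ H p.1 p.2 i := fun i =>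
    continuous_sigma fun a => (hC a i).continuous.comp continuous_subtype_val
  have hq : Continuous fun p : Σ _ : I × Bool, Icc (-H) H =>
      (![strandPoint nxt V τ H p.1 p.2 0, strandPoint nxt V τ H p.1 p.2 1, 0] : Space) := by
    refine continuous_pi fun i => ?_
    fin_cases i
    · exact hcont 0
    · exact hcont 1
    · exact continuous_const
  have hu : Continuous fun p : Σ _ : I × Bool, Icc (-H) H =>
      (p.2 : ℝ) - strandPoint nxt V τ H p.1 p.2 2 :=
    (continuous_sigma fun a => continuous_subtype_val).sub (hcont 2)
  -- The strands are parametrized by a finite disjoint union of compact intervals. On their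
  -- projection the change of height is well defined, and its extension gives the amount of the
  -- shear.
  obtain ⟨ψ, hψ, hψ'⟩ := exists_continuous_factor _ hq _ hu (by
    rintro ⟨a, z⟩ ⟨b, w⟩ he
    exact h.height_sub_eq z.2 w.2 (congrFun he 0) (congrFun he 1))
  obtain ⟨Φ, h1, h2⟩ := exists_shear 2 (fun x => ψ ![x 0, x 1, 0]) (hψ.comp (by
      refine continuous_pi fun i => ?_
      fin_cases i
      · exact continuous_apply 0
      · exact continuous_apply 1
      · exact continuous_const)) (fun x r => by
    rw [Function.update_of_ne (by decide), Function.update_of_ne (by decide)])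
  refine ⟨Φ, h1, fun a z hz => ?_⟩
  have h3 := hψ' ⟨a, z, hz⟩
  dsimp only at h3
  rw [h2, h3]
  ext i
  fin_cases i
  · simp
  · simp
  · simp

/-- The system of strands that is obtained from polygons in general position. -/
theorem exists_strands [Finite I] (hinj : Function.Injective nxt) :
    ∃ (S : Strands (I × Bool) I) (Φ : Space ≃ₜ Space), IsotopicToId Φ ∧
      (∀ a, (S.top a).1 = edgeEnd nxt a.2 a.1) ∧ (∀ a, (S.bot a).1 = a.1) ∧
      ∀ k, Φ '' (edge nxt V false k '' Icc (0 : ℝ) 1) =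
        ⋃ c, S.pt (k, c) '' Icc (-S.H) S.H := by
  obtain ⟨C, hC⟩ := exists_lipschitzWith_strandPoint (nxt := nxt) (V := V) τ H
  obtain ⟨Φ, hΦ, hΦ'⟩ := h.exists_lift
  -- At a vertex exactly one outgoing and one incoming edge meet: the incoming one is unique because
  -- `nxt` is injective and exists because `I` is finite.
  have hbij : Function.Bijective fun a : I × Bool => (edgeEnd nxt a.2 a.1, a.2) := by
    rw [← Finite.injective_iff_bijective]
    rintro ⟨k, c⟩ ⟨l, d⟩ hkl
    obtain ⟨h1, h2⟩ := Prod.ext_iff.1 hkl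
    dsimp only at h1 h2
    subst h2
    cases c with
    | false => exact Prod.ext h1 rfl
    | true => exact Prod.ext (hinj h1) rfl
  let S : Strands (I × Bool) I :=
    { H := H
      one_lt := h.one_lt
      X := fun a z => strandPoint nxt V τ H a z 0
      Y := fun a z => strandPoint nxt V τ H a z 1
      C := C
      lipX := fun a => hC a 0
      lipY := fun a => hC a 1
      disjoint := by
        intro a b hab z hz h0 h1
        have hz' := Ioo_subset_Icc_self hz
        have h2 := h.height_sub_eq hz' hz' h0 h1
        have he : strandPoint nxt V τ H a z = strandPoint nxt V τ H b z := by
          ext i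
          fin_cases i
          · exact h0
          · exact h1
          · exact sub_right_injective h2
        rcases (h.eq_of_point_eq hz' hz' he).2 with h3 | h3 | h3
        · exact hab h3
        · exact hz.2.ne h3
        · exact hz.1.ne' h3
      top := Equiv.ofBijective _ hbij
      bot := Equiv.refl _
      tipTop := fun i => (V i 0, V i 1)
      tipBot := fun k => (upEdge nxt V k (τ / 2) 0, upEdge nxt V k (τ / 2) 1)
      tipTop_injective := h.general.fst_injective
      tipBot_injective := h.tips
      slopeTop := fun a => (_, _)
      slopeBot := fun a => (_, _)
      near_top := fun a z hz => ⟨h.point_near_top hz 0, h.point_near_top hz 1⟩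
      near_bot := fun a z hz => ⟨h.point_near_bot hz 0, h.point_near_bot hz 1⟩ }
  refine ⟨S, Φ, hΦ, fun a => rfl, fun a => rfl, fun k => ?_⟩
  rw [h.image_edge, image_iUnion]
  refine iUnion_congr fun c => ?_
  rw [image_image]
  exact image_congr fun z hz => hΦ' _ z hz

end IsLiftable

end Lift

/-! ### Every framed link is a plat closure -/

section Polygons

variable {c : ℕ} (P : Fin c → ClosedPolygon)

instance (i : Fin c) : NeZero (P i).m := ⟨(P i).m_pos.ne'⟩

/-- The vertices of a family of closed polygons. -/
def polygonVertex (k : Vertex fun i => (P i).m) : Space := (P k.1).v k.2.val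

theorem polygonVertex_nextVertex (k : Vertex fun i => (P i).m) :
    polygonVertex P (nextVertex k) = (P k.1).v (k.2.val + 1) := by
  unfold polygonVertex nextVertex vertex
  simp only [Fin.ofNat]
  rcases Nat.lt_or_ge (k.2.val + 1) (P k.1).m with h | h
  · rw [Nat.mod_eq_of_lt h]
  · have : k.2.val + 1 = (P k.1).m := le_antisymm k.2.2 h
    rw [this, Nat.mod_self, (P k.1).closed]

theorem edge_polygonVertex (k : Vertex fun i => (P i).m) (s : ℝ) :
    edge nextVertex (polygonVertex P) false k s =
      AffineMap.lineMap ((P k.1).v k.2.val) ((P k.1).v (k.2.val + 1)) s := by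
  rw [← polygonVertex_nextVertex]
  rfl

theorem carrier_eq_iUnion (i : Fin c) : (P i).carrier =
    ⋃ k : Vertex fun i => (P i).m, ⋃ _ : k.1 = i,
      edge nextVertex (polygonVertex P) false k '' Icc (0 : ℝ) 1 := by
  ext x
  simp only [mem_iUnion, mem_image, edge_polygonVertex]
  constructor
  · rintro ⟨j, hj, hx⟩
    rw [segment_eq_image_lineMap] at hx
    exact ⟨⟨i, j, hj⟩, rfl, hx⟩
  · rintro ⟨k, rfl, hx⟩
    refine ⟨k.2.val, k.2.2, ?_⟩
    rw [segment_eq_image_lineMap]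
    exact hx

theorem isSimple_polygonVertex
    (hdisj : ∀ i j, i ≠ j → Disjoint (P i).carrier (P j).carrier) :
    IsSimple nextVertex (polygonVertex P) := by
  intro k l s hs t ht hst
  have hmem : ∀ (k : Vertex fun i => (P i).m) s, s ∈ Ico (0 : ℝ) 1 →
      edge nextVertex (polygonVertex P) false k s ∈ (P k.1).carrier := by
    intro k s hs
    rw [carrier_eq_iUnion]
    exact mem_iUnion₂.2 ⟨k, rfl, s, Ico_subset_Icc_self hs, rfl⟩
  have hkl : k.1 = l.1 := by
    by_contra hne
    exact Set.disjoint_left.1 (hdisj _ _ hne) (hmem k s hs) (hst ▸ hmem l t ht)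
  obtain ⟨i, k⟩ := k
  obtain ⟨j, l⟩ := l
  dsimp only at hkl
  subst hkl
  rw [edge_polygonVertex, edge_polygonVertex] at hst
  obtain ⟨h1, h2⟩ := (P i).simple _ k.2 _ l.2 s hs t ht hst
  exact ⟨by rw [Fin.ext h1], h2⟩

end Polygons

theorem component_comp {c : ℕ} (γ : Fin c × Circle → Space) (Φ : Space → Space) (i : Fin c) :
    component (Φ ∘ γ) i = Φ '' component γ i :=
  range_comp Φ fun z => γ (i, z)

/-- The core curves of a framed link are isotopic to those of a closed diagram with any number of
additional twist letters. -/
theorem FramedLink.exists_platData (L : FramedLink) : ∃ (n : ℕ) (m : Fin L.c → ℕ)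
    (_ : ∀ i, NeZero (m i)) (D : PlatData (Vertex m × Bool) n), 0 < n ∧ D.Closes ∧
      ∀ T w, ∃ Φ : Space ≃ₜ Space, IsotopicToId Φ ∧ ∀ i, Φ '' component L.curve i =
        {x | ∃ a : Vertex m × Bool, a.1.1 = i ∧
          ∃ v ∈ Icc (0 : ℝ) (2 * (D.extend T w).K + 4), x = (D.extend T w).pt a v} := by
  obtain ⟨F, hF, P, hP⟩ := L.tame
  have hdisj : ∀ i j, i ≠ j → Disjoint (P i).carrier (P j).carrier := by
    intro i j hij
    rw [← hP, ← hP, disjoint_image_iff (F 1).injective, Set.disjoint_left]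
    rintro _ ⟨z, rfl⟩ ⟨w, hw⟩
    exact hij (congrArg Prod.fst (L.isEmbedding.injective hw)).symm
  obtain ⟨Φ₁, W, i1, hW, h1⟩ := (isSimple_polygonVertex P hdisj).exists_general_position
  obtain ⟨τ, H, hl⟩ := hW.exists_isLiftable
  obtain ⟨S, Φ₂, i2, htop, hbot, h2⟩ := hl.exists_strands nextVertex_injective
  have : Nonempty (Vertex fun i => (P i).m) := ⟨⟨⟨0, L.c_pos⟩, ⟨0, (P _).m_pos⟩⟩⟩
  -- There is one upper arc per vertex and one lower arc per edge, so the plat has as many arcs on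
  -- each side as the polygons have vertices.
  obtain ⟨D, r, s, hK, hDt, hDb, hD⟩ :=
    S.exists_platData (Fintype.equivFin (Vertex fun i => (P i).m))
  refine ⟨_, _, inferInstance, D, Fintype.card_pos, ⟨hK, ?_, ?_, ?_, ?_⟩, fun T w => ?_⟩
  · intro k
    rw [hDt, hDt, htop, htop]
    rfl
  · intro k
    rw [hDb, hDb, hbot, hbot]
  · intro k l hkl
    rw [hDt, hDt, htop, htop] at hkl
    exact r.injective (Fin.ext hkl)
  · intro k l hkl
    rw [hDb, hDb, hbot, hbot] at hkl
    exact s.injective (Fin.ext hkl)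
  · obtain ⟨Φ₃, i3, h3⟩ := hD T w
    refine ⟨(F 1).trans (Φ₁.trans (Φ₂.trans Φ₃)),
      IsotopicToId.trans ⟨F, hF, rfl⟩ (i1.trans (i2.trans i3)), fun i => ?_⟩
    have himg : ∀ k, Φ₁ '' (edge nextVertex (polygonVertex P) false k '' Icc (0 : ℝ) 1) =
        edge nextVertex W false k '' Icc (0 : ℝ) 1 := fun k => by
      rw [image_image]
      exact image_congr fun s _ => h1 k s
    have hcomp : ((F 1).trans (Φ₁.trans (Φ₂.trans Φ₃))) '' component L.curve i =
        Φ₃ '' (Φ₂ '' (Φ₁ '' (F 1 '' component L.curve i))) := by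
      simp only [image_image]
      rfl
    rw [hcomp, hP, carrier_eq_iUnion]
    simp only [image_iUnion, himg, h2, h3]
    ext x
    simp only [mem_iUnion, mem_image, mem_ofPred_eq]
    constructor
    · rintro ⟨k, hk, b, v, hv, rfl⟩
      exact ⟨(k, b), hk, v, hv, rfl⟩
    · rintro ⟨⟨k, b⟩, hk, v, hv, rfl⟩
      exact ⟨k, hk, b, v, hv, rfl⟩

end FramedPlat

end

theorem mainTheorem8 (L : FramedPlat.FramedLink) :
    ∃ n : ℕ, 0 < n ∧ ∃ b : FramedPlat.FramedBraidGroup (2 * n), ∃ L' : FramedPlat.FramedLink,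
      FramedPlat.IsPlatClosure b L' ∧ L.Isotopic L' := by
  obtain ⟨n, m, _, D, hn, hD, hΦ⟩ := L.exists_platData
  obtain ⟨T, w, hfr⟩ := hD.exists_extend ⟨0, L.c_pos⟩ L.framing
  obtain ⟨Φ, ⟨F, hF, rfl⟩, hcomp⟩ := hΦ T w
  -- The image of the link under the isotopy, with unchanged framing vector. Its components are
  -- already polygons, so the constant isotopy shows tameness; the twist letters were chosen so that
  -- the diagram has exactly this framing.
  let L' : FramedPlat.FramedLink :=
    { c := L.c
      c_pos := L.c_pos
      curve := F 1 ∘ L.curve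
      isEmbedding := (F 1).isEmbedding.comp L.isEmbedding
      tame := ⟨fun _ => Homeomorph.refl _, ⟨continuous_snd, rfl⟩, (hD.extend T w).polygon,
        fun i => by
          rw [(hD.extend T w).carrier_polygon, ← hcomp, FramedPlat.component_comp]
          exact Set.image_id _⟩
      framing := L.framing }
  refine ⟨n, hn, (D.extend T w).word.toBraid, L', ⟨_, rfl, ?_⟩, F, hF, Equiv.refl _, fun i =>
    ⟨(FramedPlat.component_comp _ _ _).symm, rfl⟩⟩
  exact (hD.extend T w).isPlatDiagramLink (L := L')
    (fun i => (FramedPlat.component_comp _ _ _).trans (hcomp i)) hfr
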